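/- Let $\mathbb K$ be an algebraically closed field (of any characteristic), let $p,U\in\mathbb K[[x,y]]$ with $x\nmid p$ and $U$ a unit, let $c>0$, and let $P(x,y,T)=p(x,y)-T\,x^c\,U(x,y)\in\mathbb K(T)[[x,y]]$ be the corresponding special pencil. *Edges.* A compact edge $\ell$ of the Newton polygon of a series $S\in\mathbb K(T)[[x,y]]$ lies on a line $n i+m j=\omega$ with $n,m>0$ coprime, where $\omega$ is the minimum of $ni+mj$ on the support of $S$; $n=n_\ell$ is its v-ratio. The part of $S$ on this line is $S_\ell=x^u y^v q_\ell(x^m,y^n)$ with $q_\ell(s_1,s_2)$ homogeneous of degree $d_\ell>0$ and coprime with $s_1s_2$. The edge is dicritical if it has a vertex $(i,0)$ on the axis $j=0$ and the coefficient of $x^i$ in $S$ is not in $\mathbb K$ (it depends on $T$). *Toric-Newton process.* Fix for all coprime $n,m>0$ integers $a,b>0$ with $bn-am=1$. Starting from $P$, repeat the following with each series $S$ obtained. If $S$ has an edge with $n=1$ and $S_\ell$ is a constant multiple of $(y-Ax^m)^e$ with $A\in\mathbb K$, replace $S$ by $S(x,y+Ax^m)$. Otherwise, for each non-dicritical edge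 $\ell$ of $S$ and each root $\alpha\in\mathbb K$ of $q_\ell(1,s)$, pass to the strict transform $$S_{\ell,\alpha}(x,y)=\frac{S\big(x^n(y+\alpha)^a,\;x^m(y+\alpha)^b\big)}{x^{\omega}(y+\alpha)^{\tilde v}},$$ where $\tilde v$ is the minimum of $ai+bj$ on the support of $S$; strict transforms of arbitrary series are defined by the same formula. The dicritical edges of the process are the dicritical edges of all series obtained, each taken together with the path (sequence of steps) that leads to it. **Theorem.** The toric-Newton process of $P$ has only finitely many dicritical edges $\ell^1,\dots,\ell^s$, and there are irreducible factors $Q_{\ell^1},\dots,Q_{\ell^s}$ of $P$ in $\mathbb K(T)[[x,y]]$ such that: 1. every irreducible factor of $P$ in $\mathbb K(T)[[x,y]]$ is associated to $Q_{\ell^j}$ for exactly one $j$, so that $\ell^j\mapsto Q_{\ell^j}$ is a bijection from the dicritical edges onto the irreducible factors of $P$ up to units; moreover $P$ is the product of a unit and $Q_{\ell^1}\cdots Q_{\ell^s}$; 2. if $\ell^j$ is an edge of the series $S$ of the process, the successive transforms of $Q_{\ell^j}$ along the path to $\ell^j$ end in an irreducible factor of $S$ in $\mathbb K(T)[[x,y]]$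 whose initial form for the weights $(n_{\ell^j},m_{\ell^j})$ equals $q_{\ell^j}(x^{m_{\ell^j}},y^{n_{\ell^j}})$; 3. $Q_{\ell^j}(0,y)$ has order $d_{\ell^j}\cdot\prod_k n^j_k$, the product being over the v-ratios of the edges used by the toric-Newton transformations along the path to $\ell^j$ and of $\ell^j$ itself. -/

import Mathlib

/-!  Special pencils, their toric-Newton process and its dicritical edges. -/

namespace ToricNewton

open MvPowerSeries

/-- The ring `F⟦x, y⟧`, with `x = X 0` and `y = X 1`. -/
abbrev Ser (F : Type*) : Type _ := MvPowerSeries (Fin 2) F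

section Newton

variable {F : Type*} [Field F]

/-- The coefficient of `x ^ i * y ^ j`. -/
noncomputable def cf (P : Ser F) (i j : ℕ) : F :=
  coeff (Finsupp.single 0 i + Finsupp.single 1 j) P

/-- The support of a power series, as a set of exponents `(i, j)`. -/
def supp (P : Ser F) : Set (ℕ × ℕ) := {e | cf P e.1 e.2 ≠ 0}

/-- The least value of the weight `n * i + m * j` on the support of a (non-zero) series. -/
noncomputable def wOrder (n m : ℕ) (P : Ser F) : ℕ :=
  sInf ((fun e : ℕ × ℕ => n * e.1 + m * e.2) '' supp P)

/-- The points of the support on the supporting line `n * i + m * j = wOrder n m P`. -/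
def face (n m : ℕ) (P : Ser F) : Set (ℕ × ℕ) :=
  {e | e ∈ supp P ∧ n * e.1 + m * e.2 = wOrder n m P}

/-- The weighted initial form of `P`: its part of least weight. -/
noncomputable def initialForm (n m : ℕ) (P : Ser F) : Ser F :=
  fun e => open Classical in if n * e 0 + m * e 1 = wOrder n m P then coeff e P else 0

/-- The compact edges of the Newton polygon of `P` (the boundary of the convex hull of
`supp P + ℕ²`), each given by its primitive inner normal vector `(n, m)`, with `n` the v-ratio
and `m` the h-ratio: `n`, `m` are positive and coprime and the supporting line of `P` with this
normal contains at least two points of the support. -/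
structure IsEdge (P : Ser F) (n m : ℕ) : Prop where
  n_pos : 0 < n
  m_pos : 0 < m
  coprime : Nat.Coprime n m
  nontrivial : (face n m P).Nontrivial

/-- The exponent `u` in `P_ℓ = x ^ u * y ^ v * q_ℓ(x ^ m, y ^ n)`. -/
noncomputable def edgeU (n m : ℕ) (P : Ser F) : ℕ := sInf (Prod.fst '' face n m P)

/-- The exponent `v` in `P_ℓ = x ^ u * y ^ v * q_ℓ(x ^ m, y ^ n)`. -/
noncomputable def edgeV (n m : ℕ) (P : Ser F) : ℕ := sInf (Prod.snd '' face n m P)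

/-- The degree `d_ℓ` of `q_ℓ`, from the relation `ω = n * u + m * v + n * m * d_ℓ`
(so that the division and the subtraction are exact for an edge). -/
noncomputable def edgeDegree (n m : ℕ) (P : Ser F) : ℕ :=
  (wOrder n m P - (n * edgeU n m P + m * edgeV n m P)) / (n * m)

/-- The coefficient of `s₁ ^ (d_ℓ - k) * s₂ ^ k` in the homogeneous polynomial `q_ℓ(s₁, s₂)`. -/
noncomputable def edgeCoeff (n m : ℕ) (P : Ser F) (k : ℕ) : F :=
  cf P (edgeU n m P + m * (edgeDegree n m P - k)) (edgeV n m P + n * k)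

/-- The polynomial `q_ℓ(1, s)`. -/
noncomputable def edgePoly (n m : ℕ) (P : Ser F) : Polynomial F :=
  ∑ k ∈ Finset.range (edgeDegree n m P + 1), Polynomial.monomial k (edgeCoeff n m P k)

/-- The quasi-homogeneous polynomial `q_ℓ(x ^ m, y ^ n)`. -/
noncomputable def edgeForm (n m : ℕ) (P : Ser F) : Ser F :=
  ∑ k ∈ Finset.range (edgeDegree n m P + 1),
    C (edgeCoeff n m P k) * (X 0 ^ m) ^ (edgeDegree n m P - k) * (X 1 ^ n) ^ k

/-- `P` is `y`-regular of order `d`: the series `P(0, y)` is non-zero, of order `d`. -/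
def HasYOrder (P : Ser F) (d : ℕ) : Prop :=
  cf P 0 d ≠ 0 ∧ ∀ j < d, cf P 0 j = 0

end Newton

variable {K : Type*} [Field K]

/-- The special pencil `P(x, y, T) = p(x, y) - T * x ^ c * U(x, y)`, as an element of
`K(T)⟦x, y⟧`. -/
noncomputable def pencil (p U : Ser K) (c : ℕ) : Ser (RatFunc K) :=
  MvPowerSeries.map (algebraMap K (RatFunc K)) p -
    C (RatFunc.X : RatFunc K) * X 0 ^ c * MvPowerSeries.map (algebraMap K (RatFunc K)) U

/-- Dicritical edges: the edge reaches the axis `j = 0`, and the coefficient of its vertex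
there depends on `T`, i.e. is not in `K`. -/
def IsDicritical (P : Ser (RatFunc K)) (n m : ℕ) : Prop :=
  IsEdge P n m ∧
    ∃ i, (i, 0) ∈ face n m P ∧ cf P i 0 ∉ Set.range (algebraMap K (RatFunc K))

/-- The situation in which a preliminary change of variables `y = y₁ + A * x ^ m` is made:
there is an edge with `n = 1` and `P_ℓ` is proportional to `(y - A * x ^ m) ^ e`, `A ∈ K`. -/
def NeedsTranslation (P : Ser (RatFunc K)) (m : ℕ) (A : K) : Prop :=
  IsEdge P 1 m ∧ ∃ (β : RatFunc K) (e : ℕ), β ≠ 0 ∧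
    initialForm 1 m P = C β * (X 1 - C (algebraMap K (RatFunc K) A) * X 0 ^ m) ^ e

/-- The transformations used in the process: `translation m A` is `y = y₁ + A * x ^ m`, and
`toric n m α` is the toric-Newton transformation attached to the edge `(n, m)` and to the
root `α`. -/
inductive Step (K : Type*) : Type _
  | translation (m : ℕ) (A : K)
  | toric (n m : ℕ) (α : K)

/-- The v-ratio of a step; translations are not attached to an edge and do not contribute. -/
def Step.vRatio : Step K → ℕ
  | .translation _ _ => 1
  | .toric n _ _ => n

/-- A choice, for all coprime positive `n`, `m`, of integers `a, b > 0` with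
`b * n - a * m = 1`. -/
def IsBezoutChoice (bz : ℕ → ℕ → ℕ × ℕ) : Prop :=
  ∀ n m : ℕ, 0 < n → 0 < m → Nat.Coprime n m →
    0 < (bz n m).1 ∧ 0 < (bz n m).2 ∧ (bz n m).2 * n = (bz n m).1 * m + 1

/-- `Transform bz s P S`: the series `S` is the (strict) transform of `P` under the step `s`.
For a toric step, `S` is
`P(x₁ ^ n * (y₁ + α) ^ a, x₁ ^ m * (y₁ + α) ^ b) / (x₁ ^ ω * (y₁ + α) ^ v')`, where `ω` and `v'`
are the least values of `n * i + m * j` and of `a * i + b * j` on the support of `P`. -/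
def Transform (bz : ℕ → ℕ → ℕ × ℕ) : Step K → Ser (RatFunc K) → Ser (RatFunc K) → Prop
  | .translation m A, P, S =>
      S = MvPowerSeries.subst
        (![X 0, X 1 + C (algebraMap K (RatFunc K) A) * X 0 ^ m] : Fin 2 → Ser (RatFunc K)) P
  | .toric n m α, P, S =>
      let a := (bz n m).1
      let b := (bz n m).2
      let z : Ser (RatFunc K) := X 1 + C (algebraMap K (RatFunc K) α)
      X 0 ^ wOrder n m P * z ^ wOrder a b P * S =
        MvPowerSeries.subst
          (![X 0 ^ n * z ^ a, X 0 ^ m * z ^ b] : Fin 2 → Ser (RatFunc K)) P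

/-- The steps of the process that start at the pencil `P`: the translation, if it is needed;
if not, the toric-Newton transformations attached to the non-dicritical edges of the Newton
polygon of `P` and to the roots `α ∈ K` of `q_ℓ(1, s)`. -/
def Allowed (P : Ser (RatFunc K)) : Step K → Prop
  | .translation m A => NeedsTranslation P m A
  | .toric n m α =>
      (¬ ∃ m' A, NeedsTranslation P m' A) ∧ IsEdge P n m ∧ ¬ IsDicritical P n m ∧
        (edgePoly n m P).IsRoot (algebraMap K (RatFunc K) α)

/-- `S` is obtained from `P` by successive (strict) transforms along a list of steps. -/
def Transforms (bz : ℕ → ℕ → ℕ × ℕ) :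
    List (Step K) → Ser (RatFunc K) → Ser (RatFunc K) → Prop
  | [], P, S => S = P
  | s :: σ, P, S => ∃ P₁, Transform bz s P P₁ ∧ Transforms bz σ P₁ S

/-- The toric-Newton process: `S` is the pencil obtained from the pencil `P` by following the
given list of steps, each of them allowed at the pencil where it is applied. -/
def Reaches (bz : ℕ → ℕ → ℕ × ℕ) :
    List (Step K) → Ser (RatFunc K) → Ser (RatFunc K) → Prop
  | [], P, S => S = P
  | s :: σ, P, S => ∃ P₁, Allowed P s ∧ Transform bz s P P₁ ∧ Reaches bz σ P₁ S

/-- The dicritical edges of the toric-Newton process of `P`: a path in the process, the pencil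
`node` at its end (which is determined by the path), and a dicritical edge of its Newton
polygon. -/
structure DicriticalEdge (bz : ℕ → ℕ → ℕ × ℕ) (P : Ser (RatFunc K)) where
  path : List (Step K)
  node : Ser (RatFunc K)
  n : ℕ
  m : ℕ
  reached : Reaches bz path P node
  dicritical : IsDicritical node n m

/-- The degree `d_ℓ` of a dicritical edge. -/
noncomputable def DicriticalEdge.degree {bz : ℕ → ℕ → ℕ × ℕ} {P : Ser (RatFunc K)}
    (l : DicriticalEdge bz P) : ℕ :=
  edgeDegree l.n l.m l.node

/-- The product of the v-ratios of all edges along the path, the dicritical edge included. -/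
def DicriticalEdge.vProduct {bz : ℕ → ℕ → ℕ × ℕ} {P : Ser (RatFunc K)}
    (l : DicriticalEdge bz P) : ℕ :=
  (l.path.map Step.vRatio).prod * l.n

/-- `Q` is a factor of `P` attached to the dicritical edge `l`: `Q` is an irreducible factor of
`P`, and its successive strict transforms along the path of `l` end in an irreducible factor of
the pencil that carries `l`, with weighted initial form `q_ℓ(x ^ m, y ^ n)`. -/
def DicriticalEdge.IsFactor {bz : ℕ → ℕ → ℕ × ℕ} {P : Ser (RatFunc K)}
    (l : DicriticalEdge bz P) (Q : Ser (RatFunc K)) : Prop :=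
  Irreducible Q ∧ Q ∣ P ∧ ∃ Q' : Ser (RatFunc K),
    Transforms bz l.path Q Q' ∧ Irreducible Q' ∧ Q' ∣ l.node ∧
      initialForm l.n l.m Q' = edgeForm l.n l.m l.node

end ToricNewton

/-! Factors of the pencil are followed through monomial substitutions. For weights `(n, m)` with `bn
- am = 1`, putting `x = X^n z^a`, `y = X^m z^b` (`weighted`) embeds `F⟦x, y⟧` in the domain
`F[z]⟦X⟧`. The leading coefficient in `X` is a power of `z` times `q_ℓ(1, z)` (`leadPoly_eq`), so
all edge data are additive or multiplicative on products (`edge_mul`). Setting `z = y + β` with `β ≠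
0` gives the strict transform, whose order on `x = 0` is the multiplicity of the root `β` of `q_ℓ(1,
s)`.

Two facts relate factors before and after a toric step. Lifting: every series of `y`-order `e` is,
up to a unit, the strict transform of a series of `y`-order `n e`
(`exists_isStrictTransform_associated`). Descent: for such a pair, if the transform divides the
transform of `A`, then the original divides `A` (`IsStrictTransform.dvd_of_dvd`). Hence prime
transforms come from primes, and an irreducible series whose transform is not a unit has an
irreducible transform, with `y`-order divided by `n`.

The pencil enters through `Special`, a property kept by all allowed steps: the columns `i < c` have
coefficients in `K`, and the coefficient of `x^c` has degree one in `T`. So the polynomial of a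
non-dicritical edge lies in `K[s]` and splits, while that of a dicritical edge is `p(s) + kT` with
`k ≠ 0` and `p ∈ K[s]` not constant, which is irreducible over `K(T)` (`Special.dicritical_edge`). A
dicritical edge is therefore carried by exactly one irreducible factor, and that factor occurs once.

`Attached` records that a factor follows a path to a dicritical edge. Lifting from the end of the
path gives existence (`exists_attached`); `Attached.unique_factor` and `Attached.path_unique` give
injectivity in both directions. Every irreducible factor is reached
(`exists_attached_of_irreducible`) because toric steps lower the `y`-order and translations raise
the order of `S(x, 0)`, which is bounded by `c`. Counting `y`-orders gives finiteness, and the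
simplicity of the factors gives the product formula. -/

namespace ToricNewton
open MvPowerSeries

/-! ### Coefficients, restriction to `x = 0`, and `y`-orders. -/

section Coefficients

variable {F : Type*} [Field F]

theorem exponent_eq (e : Fin 2 →₀ ℕ) :
    (Finsupp.single 0 (e 0) + Finsupp.single 1 (e 1) : Fin 2 →₀ ℕ) = e := by
  ext k; fin_cases k <;> simp

theorem coeff_eq_cf (A : Ser F) (e : Fin 2 →₀ ℕ) : coeff e A = cf A (e 0) (e 1) := by
  rw [cf, exponent_eq]

theorem cf_ext {A B : Ser F} (h : ∀ i j, cf A i j = cf B i j) : A = B := by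
  ext e; rw [coeff_eq_cf, coeff_eq_cf, h]

theorem exists_cf_ne_zero {A : Ser F} (h : A ≠ 0) : ∃ i j, cf A i j ≠ 0 := by
  by_contra! hA
  exact h (cf_ext fun i j => by rw [hA, cf, map_zero])

@[simp] theorem cf_zero (i j : ℕ) : cf (0 : Ser F) i j = 0 := by simp [cf]

@[simp] theorem cf_add (A B : Ser F) (i j : ℕ) : cf (A + B) i j = cf A i j + cf B i j := by
  simp [cf]

@[simp] theorem cf_sub (A B : Ser F) (i j : ℕ) : cf (A - B) i j = cf A i j - cf B i j := by
  simp [cf]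

@[simp] theorem cf_C_mul (r : F) (A : Ser F) (i j : ℕ) : cf (C r * A) i j = r * cf A i j := by
  simp [cf]

/-- The series with prescribed coefficients. -/
def ofCf (f : ℕ → ℕ → F) : Ser F := fun e => f (e 0) (e 1)

@[simp] theorem cf_ofCf (f : ℕ → ℕ → F) (i j : ℕ) : cf (ofCf f) i j = f i j := by
  show f _ _ = _
  simp

theorem cf_mul (A B : Ser F) (i j : ℕ) :
    cf (A * B) i j = ∑ p ∈ Finset.HasAntidiagonal.antidiagonal i, ∑ q ∈ Finset.HasAntidiagonal.antidiagonal j,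
      cf A p.1 q.1 * cf B p.2 q.2 := by
  rw [← Finset.sum_product', cf, coeff_mul]
  refine Finset.sum_bij'
    (fun e _ => ((e.1 0, e.2 0), (e.1 1, e.2 1)))
    (fun p _ => (Finsupp.single 0 p.1.1 + Finsupp.single 1 p.2.1,
      Finsupp.single 0 p.1.2 + Finsupp.single 1 p.2.2)) ?_ ?_ ?_ ?_ ?_
  · rintro ⟨e, f⟩ h
    rw [Finset.HasAntidiagonal.mem_antidiagonal] at h
    simp only [Finset.mem_product, Finset.HasAntidiagonal.mem_antidiagonal]
    exact ⟨by simpa using DFunLike.congr_fun h 0, by simpa using DFunLike.congr_fun h 1⟩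
  · rintro ⟨⟨a, b⟩, ⟨c, d⟩⟩ h
    simp only [Finset.mem_product, Finset.HasAntidiagonal.mem_antidiagonal] at h ⊢
    obtain ⟨rfl, rfl⟩ := h
    simp only [Finsupp.single_add]
    abel
  · rintro ⟨e, f⟩ _
    simp [exponent_eq]
  · rintro ⟨⟨a, b⟩, ⟨c, d⟩⟩ _
    simp
  · rintro ⟨e, f⟩ _
    simp [coeff_eq_cf]

/-- A series in `x`, `y` as a series in `x` whose coefficients are series in `y`. -/
noncomputable def iterSer : Ser F ≃+* PowerSeries (PowerSeries F) where
  toFun A := PowerSeries.mk fun i => PowerSeries.mk fun j => cf A i j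
  invFun B := ofCf fun i j => PowerSeries.coeff j (PowerSeries.coeff i B)
  left_inv A := cf_ext fun i j => by simp
  right_inv B := by ext i j; simp
  map_mul' A B := by
    ext i j
    simp [PowerSeries.coeff_mul, cf_mul]
  map_add' A B := by ext i j; simp

@[simp] theorem coeff_coeff_iterSer (A : Ser F) (i j : ℕ) :
    PowerSeries.coeff j (PowerSeries.coeff i (iterSer A)) = cf A i j := by
  simp [iterSer]

/-- The restriction of a series to `x = 0`. -/
noncomputable def restrictX : Ser F →+* PowerSeries F :=
  (PowerSeries.constantCoeff (R := PowerSeries F)).comp (iterSer (F := F)).toRingHom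

@[simp] theorem coeff_restrictX (A : Ser F) (j : ℕ) :
    PowerSeries.coeff j (restrictX A) = cf A 0 j := by
  rw [← coeff_coeff_iterSer, PowerSeries.coeff_zero_eq_constantCoeff]; rfl

theorem coeff_zero_iterSer (A : Ser F) : PowerSeries.coeff 0 (iterSer A) = restrictX A := by
  ext j; rw [coeff_coeff_iterSer, coeff_restrictX]

theorem hasYOrder_iff_order {A : Ser F} {d : ℕ} :
    HasYOrder A d ↔ (restrictX A).order = d := by
  rw [PowerSeries.order_eq_nat]
  simp [HasYOrder]

theorem exists_hasYOrder {A : Ser F} {j : ℕ} (h : cf A 0 j ≠ 0) : ∃ d, HasYOrder A d := by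
  have hA : restrictX A ≠ 0 := fun h0 => h (by rw [← coeff_restrictX, h0, map_zero])
  refine ⟨(restrictX A).order.toNat, hasYOrder_iff_order.2 ?_⟩
  rw [PowerSeries.coe_toNat_order hA]

theorem HasYOrder.ne_zero {A : Ser F} {d : ℕ} (h : HasYOrder A d) : A ≠ 0 := by
  rintro rfl
  exact h.1 (cf_zero _ _)

theorem HasYOrder.unique {A : Ser F} {d e : ℕ} (hd : HasYOrder A d) (he : HasYOrder A e) :
    d = e := by
  rw [hasYOrder_iff_order] at hd he
  exact_mod_cast hd.symm.trans he

theorem HasYOrder.mul {A B : Ser F} {d e : ℕ} (hd : HasYOrder A d) (he : HasYOrder B e) :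
    HasYOrder (A * B) (d + e) := by
  rw [hasYOrder_iff_order] at *
  rw [map_mul, PowerSeries.order_mul, hd, he]
  push_cast; rfl

theorem HasYOrder.of_mul {A B : Ser F} {d : ℕ} (h : HasYOrder (A * B) d) :
    ∃ a b, HasYOrder A a ∧ HasYOrder B b ∧ a + b = d := by
  have hAB : restrictX (A * B) ≠ 0 := by
    intro h0
    rw [hasYOrder_iff_order, h0, PowerSeries.order_zero] at h
    exact absurd h (by simp)
  rw [map_mul] at hAB
  have key : ∀ C : Ser F, restrictX C ≠ 0 → ∃ a, HasYOrder C a := fun C hC => by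
    refine ⟨(restrictX C).order.toNat, hasYOrder_iff_order.2 ?_⟩
    rw [PowerSeries.coe_toNat_order hC]
  obtain ⟨a, ha⟩ := key A (left_ne_zero_of_mul hAB)
  obtain ⟨b, hb⟩ := key B (right_ne_zero_of_mul hAB)
  exact ⟨a, b, ha, hb, (ha.mul hb).unique h⟩

theorem HasYOrder.of_dvd {A B : Ser F} {d : ℕ} (h : HasYOrder B d) (hAB : A ∣ B) :
    ∃ a ≤ d, HasYOrder A a := by
  obtain ⟨C, rfl⟩ := hAB
  obtain ⟨a, b, ha, -, rfl⟩ := h.of_mul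
  exact ⟨a, by omega, ha⟩

theorem isUnit_iff_cf {A : Ser F} : IsUnit A ↔ cf A 0 0 ≠ 0 := by
  rw [MvPowerSeries.isUnit_iff_constantCoeff, isUnit_iff_ne_zero,
    ← coeff_zero_eq_constantCoeff_apply]
  simp [cf]

theorem isUnit_iff_hasYOrder {A : Ser F} : IsUnit A ↔ HasYOrder A 0 := by
  simp [isUnit_iff_cf, HasYOrder]

theorem HasYOrder.isUnit_iff {A : Ser F} {d : ℕ} (h : HasYOrder A d) : IsUnit A ↔ d = 0 := by
  rw [isUnit_iff_hasYOrder]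
  exact ⟨fun h0 => h.unique h0, fun h0 => h0 ▸ h⟩

theorem HasYOrder.associated {A B : Ser F} {d : ℕ} (h : HasYOrder A d) (hAB : Associated A B) :
    HasYOrder B d := by
  obtain ⟨u, rfl⟩ := hAB
  have hu : HasYOrder (u : Ser F) 0 := isUnit_iff_hasYOrder.1 u.isUnit
  have := h.mul hu
  rwa [add_zero] at this

theorem HasYOrder.associated_of_dvd {A B : Ser F} {d : ℕ} (hA : HasYOrder A d)
    (hB : HasYOrder B d) (hAB : A ∣ B) : Associated A B := by
  obtain ⟨C, rfl⟩ := hAB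
  obtain ⟨a, b, ha, hb, hab⟩ := hB.of_mul
  have : b = 0 := by have := ha.unique hA; omega
  subst this
  exact ⟨(isUnit_iff_hasYOrder.2 hb).unit, rfl⟩

theorem X0_pow_dvd_iff {A : Ser F} {k : ℕ} :
    (X 0 : Ser F) ^ k ∣ A ↔ ∀ i < k, ∀ j, cf A i j = 0 := by
  rw [X_pow_dvd_iff]
  refine ⟨fun h i hi j => h _ (by simpa using hi), fun h e he => ?_⟩
  rw [coeff_eq_cf]; exact h _ he _

theorem cf_X0_pow_mul (A : Ser F) (k i j : ℕ) : cf (X 0 ^ k * A) (k + i) j = cf A i j := by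
  have : (Finsupp.single 0 (k + i) + Finsupp.single 1 j : Fin 2 →₀ ℕ)
      = Finsupp.single 0 k + (Finsupp.single 0 i + Finsupp.single 1 j) := by
    rw [Finsupp.single_add, add_assoc]
  rw [cf, this, X_pow_eq, coeff_add_monomial_mul, one_mul, cf]

end Coefficients

/-! ### Division with remainder. -/

section Division

/-- Division with remainder of power series, with remainders in prescribed complements of the
ideal generated by the constant coefficient of the divisor. -/
theorem exists_div_rem {R : Type*} [CommRing R] (H : PowerSeries R) (W : ℕ → Set R)
    (hW : ∀ k r, ∃ q, ∃ w ∈ W k, r = q * PowerSeries.coeff 0 H + w) (g : PowerSeries R) :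
    ∃ q r, g = q * H + r ∧ ∀ k, PowerSeries.coeff k r ∈ W k := by
  choose qf wf hwf hqw using hW
  -- The coefficients of the quotient are found recursively: the `k`-th coefficient of `g - q H` is
  -- a quantity depending only on `q i` for `i < k`, minus `q k` times the constant coefficient of
  -- `H`, so `q k` is the quotient of that quantity.
  obtain ⟨q, hq⟩ : ∃ q : ℕ → R, ∀ k, q k = qf k (PowerSeries.coeff k g -
      ∑ i : Fin k, q i * PowerSeries.coeff (k - i) H) :=
    ⟨_, fun k => WellFounded.fix_eq (C := fun _ => R) Nat.lt_wfRel.wf (fun k ih =>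
      qf k (PowerSeries.coeff k g - ∑ i : Fin k, ih i i.2 * PowerSeries.coeff (k - i) H)) k⟩
  refine ⟨PowerSeries.mk q, g - PowerSeries.mk q * H, by ring, fun k => ?_⟩
  have : PowerSeries.coeff k (g - PowerSeries.mk q * H) =
      wf k (PowerSeries.coeff k g - ∑ i : Fin k, q i * PowerSeries.coeff (k - i) H) := by
    have h1 := hqw k (PowerSeries.coeff k g - ∑ i : Fin k, q i * PowerSeries.coeff (k - i) H)
    rw [← hq k] at h1
    rw [map_sub, PowerSeries.coeff_mul,
      Finset.Nat.sum_antidiagonal_eq_sum_range_succ_mk, Finset.sum_range_succ,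
      Finset.sum_range (fun i => PowerSeries.coeff i (PowerSeries.mk q) *
        PowerSeries.coeff (k - i) H)]
    simp only [PowerSeries.coeff_mk, Nat.sub_self]
    linear_combination h1
  rw [this]
  exact hwf _ _

variable {F : Type*} [Field F]

theorem exists_eq_X_pow_mul_unit {h : PowerSeries F} {d : ℕ} (hh : h.order = d) :
    ∃ v, IsUnit v ∧ h = PowerSeries.X ^ d * v := by
  refine ⟨PowerSeries.divXPowOrder h, ?_, ?_⟩
  · rw [PowerSeries.isUnit_iff_constantCoeff, isUnit_iff_ne_zero]
    intro h0
    rw [PowerSeries.constantCoeff_divXPowOrder_eq_zero_iff] at h0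
    rw [h0, PowerSeries.order_zero] at hh
    exact absurd hh (by simp)
  · conv_lhs => rw [← PowerSeries.X_pow_order_mul_divXPowOrder (f := h), hh]
    simp

theorem exists_eq_mul_add_of_order {h : PowerSeries F} {d : ℕ} (hh : h.order = d)
    (r : PowerSeries F) :
    ∃ q, ∃ w : Polynomial F, w.degree < d ∧ r = q * h + (w : PowerSeries F) := by
  obtain ⟨u, hu, rfl⟩ := exists_eq_X_pow_mul_unit hh
  obtain ⟨s, hs⟩ : (PowerSeries.X : PowerSeries F) ^ d ∣
      r - (PowerSeries.trunc d r : Polynomial F) := by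
    rw [PowerSeries.X_pow_dvd_iff]
    intro i hi
    simp [PowerSeries.coeff_trunc, hi]
  obtain ⟨v, hv⟩ := hu.exists_right_inv
  refine ⟨s * v, PowerSeries.trunc d r, PowerSeries.degree_trunc_lt r d, ?_⟩
  linear_combination hs - PowerSeries.X ^ d * s * hv

/-- Weierstrass division by a `y`-regular series. -/
theorem HasYOrder.exists_div_rem {Q : Ser F} {d : ℕ} (hQ : HasYOrder Q d) (A : Ser F) :
    ∃ B R : Ser F, A = B * Q + R ∧ ∀ i j, d ≤ j → cf R i j = 0 := by
  obtain ⟨q, r, hqr, hr⟩ := ToricNewton.exists_div_rem (iterSer Q)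
    (fun _ => {w | ∃ p : Polynomial F, p.degree < d ∧ w = p}) (fun k r => by
      rw [coeff_zero_iterSer]
      obtain ⟨q, w, hw, h⟩ := exists_eq_mul_add_of_order (hasYOrder_iff_order.1 hQ) r
      exact ⟨q, w, ⟨w, hw, rfl⟩, h⟩) (iterSer A)
  refine ⟨iterSer.symm q, iterSer.symm r, iterSer.injective (by simp [hqr]), fun i j hj => ?_⟩
  rw [← coeff_coeff_iterSer, RingEquiv.apply_symm_apply]
  obtain ⟨p, hp, h⟩ := hr i
  rw [h, Polynomial.coeff_coe]
  exact Polynomial.coeff_eq_zero_of_degree_lt (hp.trans_le (by exact_mod_cast hj))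

end Division

/-! ### Bézout weights and the exponents of given weight. -/

/-- Weights `n`, `m` together with Bézout coefficients `a`, `b`. -/
structure Bezout (n m a b : ℕ) : Prop where
  n_pos : 0 < n
  m_pos : 0 < m
  a_pos : 0 < a
  b_pos : 0 < b
  rel : b * n = a * m + 1

theorem Bezout.coprime {n m a b : ℕ} (h : Bezout n m a b) : Nat.Coprime n m := by
  refine Nat.Coprime.symm (Nat.isCoprime_iff_coprime.1 ⟨-a, b, ?_⟩)
  have := h.rel
  zify at this
  linear_combination this

/-- The matrix with rows `(n, m)` and `(a, b)` has determinant `1`; the linear combinations are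
those of its inverse. -/
theorem Bezout.ext_point {n m a b : ℕ} (h : Bezout n m a b) {i j i' j' : ℕ}
    (h1 : n * i + m * j = n * i' + m * j') (h2 : a * i + b * j = a * i' + b * j') :
    i = i' ∧ j = j' := by
  have := h.rel
  zify at *
  exact ⟨by linear_combination b * h1 - m * h2 - (i - i') * this,
    by linear_combination n * h2 - a * h1 - (j - j') * this⟩

section LineSum

/-- The exponents `(i, j)` of weight `n * i + m * j = w`. -/
def line (n m w : ℕ) : Finset (ℕ × ℕ) :=
  (Finset.range (w + 1) ×ˢ Finset.range (w + 1)).filter fun p => n * p.1 + m * p.2 = w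

theorem mem_line {n m w : ℕ} (hn : 0 < n) (hm : 0 < m) {p : ℕ × ℕ} :
    p ∈ line n m w ↔ n * p.1 + m * p.2 = w := by
  simp only [line, Finset.mem_filter, Finset.mem_product, Finset.mem_range, and_iff_right_iff_imp]
  intro h
  have h1 := Nat.le_mul_of_pos_left p.1 hn
  have h2 := Nat.le_mul_of_pos_left p.2 hm
  omega

theorem finsum_eq_sum_line {M : Type*} [AddCommMonoid M] {n m w : ℕ} (hn : 0 < n) (hm : 0 < m)
    (f : (Fin 2 →₀ ℕ) → M) (hf : ∀ e, n * e 0 + m * e 1 ≠ w → f e = 0) :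
    ∑ᶠ e, f e = ∑ p ∈ line n m w, f (Finsupp.single 0 p.1 + Finsupp.single 1 p.2) := by
  let g : (Fin 2 →₀ ℕ) ≃ ℕ × ℕ :=
    { toFun := fun e => (e 0, e 1)
      invFun := fun p => Finsupp.single 0 p.1 + Finsupp.single 1 p.2
      left_inv := fun e => exponent_eq e
      right_inv := fun p => by simp }
  rw [← finsum_comp_equiv g.symm]
  refine finsum_eq_sum_of_support_subset _ fun p hp => ?_
  rw [Finset.mem_coe, mem_line hn hm]
  by_contra hne
  refine hp (hf _ ?_)
  simpa [g] using hne

end LineSum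

/-! ### The monomial substitution into `F[z]⟦X⟧` and edge data. -/

section Weighted

variable {F : Type*} [Field F] {n m a b : ℕ}

theorem hasSubst_weighted (hn : 0 < n) (hm : 0 < m) (a b : ℕ) :
    HasSubst (![PowerSeries.X ^ n * PowerSeries.C (Polynomial.X ^ a),
      PowerSeries.X ^ m * PowerSeries.C (Polynomial.X ^ b)] :
        Fin 2 → MvPowerSeries Unit (Polynomial F)) := by
  refine hasSubst_of_constantCoeff_zero fun s => ?_
  fin_cases s
  · exact (map_mul (PowerSeries.constantCoeff (R := Polynomial F)) _ _).trans (by simp [hn.ne'])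
  · exact (map_mul (PowerSeries.constantCoeff (R := Polynomial F)) _ _).trans (by simp [hm.ne'])

/-- The monomial substitution `x = X ^ n * z ^ a`, `y = X ^ m * z ^ b`, as a map to power series
in `X` over `F[z]`. -/
noncomputable def weighted (F : Type*) [Field F] (h : Bezout n m a b) :
    Ser F →ₐ[F] PowerSeries (Polynomial F) :=
  substAlgHom (hasSubst_weighted h.n_pos h.m_pos a b)

theorem weighted_X0 (h : Bezout n m a b) :
    weighted F h (X 0) = PowerSeries.X ^ n * PowerSeries.C (Polynomial.X ^ a) := by
  rw [weighted, substAlgHom_X]; rfl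

theorem weighted_X1 (h : Bezout n m a b) :
    weighted F h (X 1) = PowerSeries.X ^ m * PowerSeries.C (Polynomial.X ^ b) := by
  rw [weighted, substAlgHom_X]; rfl

theorem weighted_C (h : Bezout n m a b) (r : F) :
    weighted F h (C r) = PowerSeries.C (Polynomial.C r) := by
  have := (weighted F h).commutes r
  rwa [MvPowerSeries.algebraMap_apply, PowerSeries.algebraMap_apply] at this

theorem coeff_weighted_eq_sum (h : Bezout n m a b) (A : Ser F) (w : ℕ) :
    PowerSeries.coeff w (weighted F h A) =
      ∑ p ∈ line n m w, Polynomial.monomial (a * p.1 + b * p.2) (cf A p.1 p.2) := by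
  have key : ∀ e : Fin 2 →₀ ℕ, PowerSeries.coeff w (e.prod fun s k =>
      ((![PowerSeries.X ^ n * PowerSeries.C (Polynomial.X ^ a),
        PowerSeries.X ^ m * PowerSeries.C (Polynomial.X ^ b)] :
        Fin 2 → PowerSeries (Polynomial F)) s) ^ k) =
      if n * e 0 + m * e 1 = w then Polynomial.X ^ (a * e 0 + b * e 1) else 0 := by
    intro e
    rw [Finsupp.prod_fintype _ _ (by simp), Fin.prod_univ_two]
    have : ((![PowerSeries.X ^ n * PowerSeries.C (Polynomial.X ^ a),
        PowerSeries.X ^ m * PowerSeries.C (Polynomial.X ^ b)] :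
        Fin 2 → PowerSeries (Polynomial F)) 0) ^ (e 0) *
        ((![PowerSeries.X ^ n * PowerSeries.C (Polynomial.X ^ a),
        PowerSeries.X ^ m * PowerSeries.C (Polynomial.X ^ b)] :
        Fin 2 → PowerSeries (Polynomial F)) 1) ^ (e 1) =
        PowerSeries.C (Polynomial.X ^ (a * e 0 + b * e 1)) *
          PowerSeries.X ^ (n * e 0 + m * e 1) := by
      simp only [Matrix.cons_val_zero, Matrix.cons_val_one, map_pow]
      ring
    rw [this, PowerSeries.coeff_C_mul, PowerSeries.coeff_X_pow]
    simp [eq_comm]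
  have := coeff_subst (hasSubst_weighted (F := F) h.n_pos h.m_pos a b) A (Finsupp.single () w)
  rw [← coe_substAlgHom (hasSubst_weighted h.n_pos h.m_pos a b)] at this
  refine this.trans ?_
  refine (finsum_congr fun e => congrArg (coeff e A • ·) (key e)).trans ?_
  rw [finsum_eq_sum_line (w := w) h.n_pos h.m_pos _ (fun e he => by simp [he])]
  refine Finset.sum_congr rfl fun p hp => ?_
  rw [mem_line h.n_pos h.m_pos] at hp
  simp [hp, cf, Polynomial.smul_X_eq_monomial]

/-- No cancellation occurs: by `Bezout.ext_point` distinct monomials in `x`, `y` go to distinct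
monomials in `X`, `z`. -/
theorem coeff_weighted (h : Bezout n m a b) (A : Ser F) (i j : ℕ) :
    (PowerSeries.coeff (n * i + m * j) (weighted F h A)).coeff (a * i + b * j) = cf A i j := by
  rw [coeff_weighted_eq_sum, Polynomial.finsetSum_coeff,
    Finset.sum_eq_single_of_mem (i, j) ((mem_line h.n_pos h.m_pos).2 rfl)]
  · simp
  · rintro ⟨i', j'⟩ hp hne
    rw [mem_line h.n_pos h.m_pos] at hp
    rw [Polynomial.coeff_monomial, if_neg]
    intro h2
    obtain ⟨rfl, rfl⟩ := h.ext_point hp h2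
    exact hne rfl

theorem exists_of_coeff_weighted_ne_zero (h : Bezout n m a b) {A : Ser F} {w t : ℕ}
    (hA : (PowerSeries.coeff w (weighted F h A)).coeff t ≠ 0) :
    ∃ i j, n * i + m * j = w ∧ a * i + b * j = t ∧ cf A i j ≠ 0 := by
  rw [coeff_weighted_eq_sum, Polynomial.finsetSum_coeff] at hA
  obtain ⟨⟨i, j⟩, hp, hne⟩ := Finset.exists_ne_zero_of_sum_ne_zero hA
  rw [mem_line h.n_pos h.m_pos] at hp
  rw [Polynomial.coeff_monomial] at hne
  split_ifs at hne with h2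
  · exact ⟨i, j, hp, h2, hne⟩
  · exact absurd rfl hne

theorem weighted_injective (h : Bezout n m a b) : Function.Injective (weighted F h) :=
  fun A B hAB => cf_ext fun i j => by rw [← coeff_weighted h, hAB, coeff_weighted]

theorem wOrder_le {A : Ser F} {i j : ℕ} (hA : cf A i j ≠ 0) : wOrder n m A ≤ n * i + m * j :=
  Nat.sInf_le ⟨(i, j), hA, rfl⟩

theorem exists_mem_face (n m : ℕ) {A : Ser F} (hA : A ≠ 0) : (face n m A).Nonempty := by
  obtain ⟨i, j, hij⟩ := exists_cf_ne_zero hA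
  obtain ⟨e, he, h⟩ := Nat.sInf_mem
    (s := (fun e : ℕ × ℕ => n * e.1 + m * e.2) '' supp A) ⟨_, (i, j), hij, rfl⟩
  exact ⟨e, he, h⟩

theorem le_wOrder {A : Ser F} (hA : A ≠ 0) {w : ℕ}
    (h : ∀ i j, cf A i j ≠ 0 → w ≤ n * i + m * j) : w ≤ wOrder n m A := by
  obtain ⟨⟨i, j⟩, he, h'⟩ := exists_mem_face n m hA
  exact h' ▸ h i j he

/-- The leading coefficient of `weighted F h A`. -/
noncomputable def leadPoly (h : Bezout n m a b) (A : Ser F) : Polynomial F :=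
  PowerSeries.coeff (wOrder n m A) (weighted F h A)

theorem coeff_weighted_of_lt (h : Bezout n m a b) (A : Ser F) {w : ℕ} (hw : w < wOrder n m A) :
    PowerSeries.coeff w (weighted F h A) = 0 := by
  ext t
  by_contra hne
  obtain ⟨i, j, rfl, -, hc⟩ := exists_of_coeff_weighted_ne_zero h hne
  exact absurd (wOrder_le (n := n) (m := m) hc) (by omega)

theorem leadPoly_ne_zero (h : Bezout n m a b) {A : Ser F} (hA : A ≠ 0) : leadPoly h A ≠ 0 := by
  obtain ⟨⟨i, j⟩, he, h'⟩ := exists_mem_face n m hA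
  intro h0
  have := coeff_weighted h A i j
  rw [show n * i + m * j = wOrder n m A from h'] at this
  rw [leadPoly] at h0
  rw [h0] at this
  exact he this.symm

theorem order_weighted (h : Bezout n m a b) {A : Ser F} (hA : A ≠ 0) :
    (weighted F h A).order = wOrder n m A := by
  rw [PowerSeries.order_eq_nat]
  exact ⟨leadPoly_ne_zero h hA, fun i hi => coeff_weighted_of_lt h A hi⟩

theorem exists_weighted_eq (h : Bezout n m a b) (A : Ser F) :
    ∃ L, weighted F h A = PowerSeries.X ^ wOrder n m A * L ∧
      PowerSeries.coeff 0 L = leadPoly h A := by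
  obtain ⟨L, hL⟩ := PowerSeries.X_pow_dvd_iff.2 fun i hi => coeff_weighted_of_lt h A hi
  refine ⟨L, hL, ?_⟩
  have := PowerSeries.coeff_X_pow_mul L (wOrder n m A) 0
  rw [zero_add, ← hL] at this
  exact this.symm

theorem wOrder_mul (h : Bezout n m a b) {A B : Ser F} (hA : A ≠ 0) (hB : B ≠ 0) :
    wOrder n m (A * B) = wOrder n m A + wOrder n m B := by
  have := order_weighted h (mul_ne_zero hA hB)
  rw [map_mul, PowerSeries.order_mul, order_weighted h hA, order_weighted h hB] at this
  exact_mod_cast this.symm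

theorem leadPoly_mul (h : Bezout n m a b) {A B : Ser F} (hA : A ≠ 0) (hB : B ≠ 0) :
    leadPoly h (A * B) = leadPoly h A * leadPoly h B := by
  obtain ⟨L, hL, hL0⟩ := exists_weighted_eq h A
  obtain ⟨M, hM, hM0⟩ := exists_weighted_eq h B
  rw [leadPoly, wOrder_mul h hA hB, map_mul, hL, hM,
    show PowerSeries.X ^ wOrder n m A * L * (PowerSeries.X ^ wOrder n m B * M) =
      PowerSeries.X ^ (wOrder n m A + wOrder n m B) * (L * M) by ring]
  have := PowerSeries.coeff_X_pow_mul (L * M) (wOrder n m A + wOrder n m B) 0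
  rw [zero_add] at this
  rw [this, ← hL0, ← hM0]
  simp

/-! ### The points of a face and the polynomial of an edge. -/

section Face

theorem edgeU_le {A : Ser F} {e : ℕ × ℕ} (he : e ∈ face n m A) : edgeU n m A ≤ e.1 :=
  Nat.sInf_le ⟨e, he, rfl⟩

theorem edgeV_le {A : Ser F} {e : ℕ × ℕ} (he : e ∈ face n m A) : edgeV n m A ≤ e.2 :=
  Nat.sInf_le ⟨e, he, rfl⟩

/-- The face points of least abscissa and of least ordinate differ by `(s, -r)` with `n s = m r`,
hence by a multiple of `(m, -n)` since `n` and `m` are coprime. This makes the division in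
`edgeDegree` exact, also when the face is a single point. -/
theorem exists_face_vertices (hn : 0 < n) (hm : 0 < m) (hnm : Nat.Coprime n m) {A : Ser F}
    (hA : A ≠ 0) :
    wOrder n m A = n * edgeU n m A + m * edgeV n m A + n * m * edgeDegree n m A ∧
      (edgeU n m A, edgeV n m A + n * edgeDegree n m A) ∈ face n m A ∧
      (edgeU n m A + m * edgeDegree n m A, edgeV n m A) ∈ face n m A := by
  obtain ⟨⟨u, j⟩, hu, hu'⟩ := Nat.sInf_mem ((exists_mem_face n m hA).image Prod.fst)
  obtain ⟨⟨i, v⟩, hv, hv'⟩ := Nat.sInf_mem ((exists_mem_face n m hA).image Prod.snd)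
  change u = edgeU n m A at hu'
  change v = edgeV n m A at hv'
  have hui := edgeU_le hv
  have hvj := edgeV_le hu
  rw [← hu'] at hui ⊢
  rw [← hv'] at hvj ⊢
  obtain ⟨s, rfl⟩ := Nat.exists_eq_add_of_le hui
  obtain ⟨r, rfl⟩ := Nat.exists_eq_add_of_le hvj
  have e1 : n * u + m * (v + r) = wOrder n m A := hu.2
  have e2 : n * (u + s) + m * v = wOrder n m A := hv.2
  have e3 : n * s = m * r := by
    have := e1.trans e2.symm
    rw [mul_add, mul_add] at this; omega
  obtain ⟨t, rfl⟩ : n ∣ r := hnm.dvd_of_dvd_mul_left ⟨s, e3.symm⟩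
  have hs : s = m * t := by
    apply Nat.eq_of_mul_eq_mul_left hn
    rw [e3]; ring
  subst hs
  have e4 : wOrder n m A = n * u + m * v + n * m * t := by rw [← e1]; ring
  have hd : edgeDegree n m A = t := by
    rw [edgeDegree, ← hu', ← hv', e4, Nat.add_sub_cancel_left]
    exact Nat.mul_div_cancel_left t (Nat.mul_pos hn hm)
  rw [hd]
  exact ⟨e4, hu, hv⟩

theorem exists_of_mem_face (hn : 0 < n) (hm : 0 < m) (hnm : Nat.Coprime n m) {A : Ser F}
    (hA : A ≠ 0) {e : ℕ × ℕ} (he : e ∈ face n m A) :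
    ∃ k ≤ edgeDegree n m A,
      e = (edgeU n m A + m * (edgeDegree n m A - k), edgeV n m A + n * k) := by
  obtain ⟨hw, -, -⟩ := exists_face_vertices hn hm hnm hA
  obtain ⟨i, j⟩ := e
  obtain ⟨s, hs⟩ := Nat.exists_eq_add_of_le (edgeU_le he)
  obtain ⟨r, hr⟩ := Nat.exists_eq_add_of_le (edgeV_le he)
  have e1 : n * i + m * j = wOrder n m A := he.2
  simp only at hs hr
  subst hs hr
  generalize edgeU n m A = u at *
  generalize edgeV n m A = v at *
  generalize edgeDegree n m A = d at *
  rw [hw] at e1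
  have e3 : n * s + m * r = n * m * d := by
    rw [mul_add, mul_add] at e1; omega
  obtain ⟨k, rfl⟩ : n ∣ r := hnm.dvd_of_dvd_mul_left
    ((Nat.dvd_add_right (Dvd.intro s rfl)).1 (e3 ▸ ⟨m * d, by ring⟩))
  have e4 : s + m * k = m * d := by
    apply Nat.eq_of_mul_eq_mul_left hn
    linarith
  have hk : k ≤ d := Nat.le_of_mul_le_mul_left (by omega) hm
  refine ⟨k, hk, ?_⟩
  rw [Nat.mul_sub]
  congr 2
  omega

theorem coeff_edgePoly (A : Ser F) (k : ℕ) : (edgePoly n m A).coeff k =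
    if k ≤ edgeDegree n m A then edgeCoeff n m A k else 0 := by
  simp only [edgePoly, Polynomial.finsetSum_coeff, Polynomial.coeff_monomial]
  rw [Finset.sum_ite_eq']
  simp

/-- Moving along the face by `(-m, n)` raises the second weight by `bn - am = 1`, so successive
points of the face give successive powers of `z`. -/
theorem leadPoly_eq (h : Bezout n m a b) {A : Ser F} (hA : A ≠ 0) :
    leadPoly h A = Polynomial.X ^ (a * (edgeU n m A + m * edgeDegree n m A) + b * edgeV n m A) *
      edgePoly n m A := by
  obtain ⟨hw, -, -⟩ := exists_face_vertices h.n_pos h.m_pos h.coprime hA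
  have hexp : ∀ k ≤ edgeDegree n m A,
      n * (edgeU n m A + m * (edgeDegree n m A - k)) + m * (edgeV n m A + n * k) = wOrder n m A ∧
      a * (edgeU n m A + m * (edgeDegree n m A - k)) + b * (edgeV n m A + n * k) =
        a * (edgeU n m A + m * edgeDegree n m A) + b * edgeV n m A + k := by
    intro k hk
    obtain ⟨r, hr⟩ := Nat.exists_eq_add_of_le hk
    rw [hw, hr, Nat.add_sub_cancel_left]
    refine ⟨by ring, ?_⟩
    linear_combination k * h.rel
  ext t
  rw [Polynomial.coeff_X_pow_mul', coeff_edgePoly]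
  have main : ∀ k ≤ edgeDegree n m A, t =
      a * (edgeU n m A + m * edgeDegree n m A) + b * edgeV n m A + k →
      (leadPoly h A).coeff t = edgeCoeff n m A k := by
    intro k hk ht
    obtain ⟨h1, h2⟩ := hexp k hk
    rw [leadPoly, ← h1, ht, ← h2, coeff_weighted, edgeCoeff]
  split_ifs with h1 h2
  · exact main _ h2 (by omega)
  · by_contra hne
    obtain ⟨i, j, hij, ht, hc⟩ := exists_of_coeff_weighted_ne_zero h hne
    obtain ⟨k, hk, he⟩ := exists_of_mem_face h.n_pos h.m_pos h.coprime hA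
      (e := (i, j)) ⟨hc, hij⟩
    rw [Prod.mk.injEq] at he
    rw [he.1, he.2, (hexp k hk).2] at ht
    omega
  · by_contra hne
    obtain ⟨i, j, hij, ht, hc⟩ := exists_of_coeff_weighted_ne_zero h hne
    obtain ⟨k, hk, he⟩ := exists_of_mem_face h.n_pos h.m_pos h.coprime hA
      (e := (i, j)) ⟨hc, hij⟩
    rw [Prod.mk.injEq] at he
    rw [he.1, he.2, (hexp k hk).2] at ht
    omega

variable (hn : 0 < n) (hm : 0 < m) (hnm : Nat.Coprime n m)
include hn hm hnm

theorem edgePoly_coeff_zero_ne_zero {A : Ser F} (hA : A ≠ 0) : (edgePoly n m A).coeff 0 ≠ 0 := by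
  rw [coeff_edgePoly, if_pos (Nat.zero_le _), edgeCoeff]
  rw [Nat.sub_zero, mul_zero, add_zero]
  exact (exists_face_vertices hn hm hnm hA).2.2.1

theorem edgePoly_ne_zero {A : Ser F} (hA : A ≠ 0) : edgePoly n m A ≠ 0 := fun h0 =>
  edgePoly_coeff_zero_ne_zero hn hm hnm hA (by rw [h0, Polynomial.coeff_zero])

theorem natDegree_edgePoly {A : Ser F} (hA : A ≠ 0) :
    (edgePoly n m A).natDegree = edgeDegree n m A := by
  refine Polynomial.natDegree_eq_of_le_of_coeff_ne_zero ?_ ?_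
  · rw [Polynomial.natDegree_le_iff_coeff_eq_zero]
    intro k hk
    rw [coeff_edgePoly, if_neg (by omega)]
  · rw [coeff_edgePoly, if_pos le_rfl, edgeCoeff]
    rw [Nat.sub_self, mul_zero, add_zero]
    exact (exists_face_vertices hn hm hnm hA).2.1.1

theorem isEdge_iff {A : Ser F} (hA : A ≠ 0) : IsEdge A n m ↔ 0 < edgeDegree n m A := by
  obtain ⟨-, h1, h2⟩ := exists_face_vertices hn hm hnm hA
  constructor
  · rintro ⟨-, -, -, e, he, f, hf, hne⟩
    by_contra h0
    obtain ⟨k, hk, rfl⟩ := exists_of_mem_face hn hm hnm hA he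
    obtain ⟨l, hl, rfl⟩ := exists_of_mem_face hn hm hnm hA hf
    obtain rfl : k = 0 := by omega
    obtain rfl : l = 0 := by omega
    exact hne rfl
  · intro hd
    refine ⟨hn, hm, hnm, _, h1, _, h2, fun he => ?_⟩
    rw [Prod.mk.injEq] at he
    have := Nat.mul_pos hn hd
    omega

end Face

theorem X_pow_mul_inj {p q : Polynomial F} {i j : ℕ} (hp : p.coeff 0 ≠ 0) (hq : q.coeff 0 ≠ 0)
    (h : Polynomial.X ^ i * p = Polynomial.X ^ j * q) : i = j ∧ p = q := by
  have hij : i = j := by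
    rcases lt_trichotomy i j with hlt | rfl | hlt
    · have := congrArg (Polynomial.coeff · i) h
      simp only [Polynomial.coeff_X_pow_mul', le_refl, if_true, Nat.sub_self, not_le.2 hlt,
        if_false] at this
      exact absurd this hp
    · rfl
    · have := congrArg (Polynomial.coeff · j) h
      simp only [Polynomial.coeff_X_pow_mul', le_refl, if_true, Nat.sub_self, not_le.2 hlt,
        if_false] at this
      exact absurd this.symm hq
  subst hij
  exact ⟨rfl, mul_left_cancel₀ (pow_ne_zero _ Polynomial.X_ne_zero) h⟩

/-- Both the weighted order and the leading coefficient behave well on products. Edge polynomials do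
not vanish at `0`, so they can be separated from the powers of `z`; the exponents `u`, `v` are then
recovered from their two weights. -/
theorem edge_mul (h : Bezout n m a b) {A B : Ser F} (hA : A ≠ 0) (hB : B ≠ 0) :
    edgePoly n m (A * B) = edgePoly n m A * edgePoly n m B ∧
      edgeDegree n m (A * B) = edgeDegree n m A + edgeDegree n m B ∧
      edgeU n m (A * B) = edgeU n m A + edgeU n m B ∧
      edgeV n m (A * B) = edgeV n m A + edgeV n m B := by
  have hAB := mul_ne_zero hA hB
  have h1 := leadPoly_mul h hA hB
  rw [leadPoly_eq h hA, leadPoly_eq h hB, leadPoly_eq h hAB, mul_mul_mul_comm, ← pow_add] at h1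
  obtain ⟨h2, h3⟩ := X_pow_mul_inj
    (edgePoly_coeff_zero_ne_zero h.n_pos h.m_pos h.coprime hAB)
    (by
      rw [Polynomial.mul_coeff_zero]
      exact mul_ne_zero (edgePoly_coeff_zero_ne_zero h.n_pos h.m_pos h.coprime hA)
        (edgePoly_coeff_zero_ne_zero h.n_pos h.m_pos h.coprime hB)) h1
  have h4 : edgeDegree n m (A * B) = edgeDegree n m A + edgeDegree n m B := by
    simp only [← natDegree_edgePoly h.n_pos h.m_pos h.coprime hA,
      ← natDegree_edgePoly h.n_pos h.m_pos h.coprime hB,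
      ← natDegree_edgePoly h.n_pos h.m_pos h.coprime hAB]
    rw [h3, Polynomial.natDegree_mul (edgePoly_ne_zero h.n_pos h.m_pos h.coprime hA)
      (edgePoly_ne_zero h.n_pos h.m_pos h.coprime hB)]
  have h5 := wOrder_mul h hA hB
  rw [(exists_face_vertices h.n_pos h.m_pos h.coprime hA).1,
    (exists_face_vertices h.n_pos h.m_pos h.coprime hB).1,
    (exists_face_vertices h.n_pos h.m_pos h.coprime hAB).1, h4] at h5
  rw [h4] at h2
  refine ⟨h3, h4, h.ext_point ?_ ?_⟩
  · linarith
  · linarith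

theorem wOrder_le_of_hasYOrder {A : Ser F} {d : ℕ} (hA : HasYOrder A d) : wOrder n m A ≤ m * d := by
  simpa using wOrder_le (n := n) (m := m) hA.1

/-- The point `(0, d)` bounds the weighted order by `m d`, and the upper vertex of the face already
contributes `m` times its height. -/
theorem edge_height_le (h : Bezout n m a b) {A : Ser F} {d : ℕ} (hA : HasYOrder A d) :
    edgeV n m A + n * edgeDegree n m A ≤ d := by
  have h1 := (exists_face_vertices h.n_pos h.m_pos h.coprime hA.ne_zero).2.1.2
  have h2 := wOrder_le_of_hasYOrder (n := n) (m := m) hA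
  simp only at h1
  exact Nat.le_of_mul_le_mul_left (by omega : m * _ ≤ _) h.m_pos

theorem isUnit_edge (h : Bezout n m a b) {A : Ser F} (hA : IsUnit A) :
    edgeDegree n m A = 0 ∧ edgeU n m A = 0 ∧ edgeV n m A = 0 := by
  obtain ⟨hw, -, -⟩ := exists_face_vertices h.n_pos h.m_pos h.coprime hA.ne_zero
  have := wOrder_le_of_hasYOrder (n := n) (m := m) (isUnit_iff_hasYOrder.1 hA)
  have h1 : n * edgeU n m A = 0 := by omega
  have h2 : m * edgeV n m A = 0 := by omega
  have h3 : n * m * edgeDegree n m A = 0 := by omega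
  have hn := h.n_pos.ne'
  have hm := h.m_pos.ne'
  simp_all

end Weighted

/-! ### Strict transforms and descent of divisibility. -/

section Toric

variable {F : Type*} [Field F] {n m a b : ℕ}

/-- The substitution `z = y + β`, from polynomials to power series. -/
noncomputable def shiftHom (β : F) : Polynomial F →+* PowerSeries F :=
  (Polynomial.coeToPowerSeries.ringHom).comp (Polynomial.taylorAlgHom β).toRingHom

theorem shiftHom_apply (β : F) (p : Polynomial F) :
    shiftHom β p = (Polynomial.taylor β p : Polynomial F) := rfl

theorem shiftHom_X_sub_C (β : F) : shiftHom β (Polynomial.X - Polynomial.C β) = PowerSeries.X := by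
  rw [shiftHom_apply, map_sub, Polynomial.taylor_X, Polynomial.taylor_C, add_sub_cancel_right,
    Polynomial.coe_X]

theorem isUnit_shiftHom {β : F} {p : Polynomial F} (hp : ¬ p.IsRoot β) :
    IsUnit (shiftHom β p) := by
  rw [PowerSeries.isUnit_iff_constantCoeff, ← PowerSeries.coeff_zero_eq_constantCoeff_apply,
    shiftHom_apply, Polynomial.coeff_coe, Polynomial.taylor_coeff_zero, isUnit_iff_ne_zero]
  exact hp

theorem isUnit_shiftHom_X_pow {β : F} (hβ : β ≠ 0) (k : ℕ) :
    IsUnit (shiftHom β (Polynomial.X ^ k)) := by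
  rw [map_pow]
  exact (isUnit_shiftHom (by simpa using hβ)).pow k

theorem order_shiftHom (β : F) {p : Polynomial F} (hp : p ≠ 0) :
    (shiftHom β p).order = p.rootMultiplicity β := by
  obtain ⟨q, hq, hdvd⟩ := Polynomial.exists_eq_pow_rootMultiplicity_mul_and_not_dvd p hp β
  have hu : IsUnit (shiftHom β q) := isUnit_shiftHom (by rwa [← Polynomial.dvd_iff_isRoot])
  conv_lhs => rw [hq]
  rw [map_mul, map_pow, shiftHom_X_sub_C, PowerSeries.order_mul, PowerSeries.order_X_pow,
    PowerSeries.order_zero_of_unit hu, add_zero]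

theorem iterSer_X0 : iterSer (X 0 : Ser F) = PowerSeries.X := by
  ext i j
  have h : (Finsupp.single 0 i + Finsupp.single 1 j : Fin 2 →₀ ℕ) = Finsupp.single 0 1 ↔
      i = 1 ∧ j = 0 := by
    constructor
    · intro h
      exact ⟨by simpa using DFunLike.congr_fun h 0, by simpa using DFunLike.congr_fun h 1⟩
    · rintro ⟨rfl, rfl⟩; simp
  rw [coeff_coeff_iterSer, cf, coeff_X, PowerSeries.coeff_X]
  simp only [h]
  by_cases hi : i = 1 <;> by_cases hj : j = 0 <;> simp [hi, hj, PowerSeries.coeff_one]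

theorem iterSer_X1 : iterSer (X 1 : Ser F) = PowerSeries.C PowerSeries.X := by
  ext i j
  have h : (Finsupp.single 0 i + Finsupp.single 1 j : Fin 2 →₀ ℕ) = Finsupp.single 1 1 ↔
      i = 0 ∧ j = 1 := by
    constructor
    · intro h
      exact ⟨by simpa using DFunLike.congr_fun h 0, by simpa using DFunLike.congr_fun h 1⟩
    · rintro ⟨rfl, rfl⟩; simp
  rw [coeff_coeff_iterSer, cf, coeff_X, PowerSeries.coeff_C]
  simp only [h]
  by_cases hi : i = 0 <;> by_cases hj : j = 1 <;> simp [hi, hj, PowerSeries.coeff_X]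

theorem iterSer_C (r : F) : iterSer (C r : Ser F) = PowerSeries.C (PowerSeries.C r) := by
  ext i j
  have h : (Finsupp.single 0 i + Finsupp.single 1 j : Fin 2 →₀ ℕ) = 0 ↔ i = 0 ∧ j = 0 := by
    constructor
    · intro h
      exact ⟨by simpa using DFunLike.congr_fun h 0, by simpa using DFunLike.congr_fun h 1⟩
    · rintro ⟨rfl, rfl⟩; simp
  rw [coeff_coeff_iterSer, cf, coeff_C, PowerSeries.coeff_C]
  simp only [h]
  by_cases hi : i = 0 <;> by_cases hj : j = 0 <;> simp [hi, hj, PowerSeries.coeff_C]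

theorem iterSer_shift (β : F) :
    iterSer (X 1 + C β : Ser F) = PowerSeries.C (shiftHom β Polynomial.X) := by
  rw [map_add, iterSer_X1, iterSer_C, ← map_add, shiftHom_apply, Polynomial.taylor_X,
    Polynomial.coe_add, Polynomial.coe_X, Polynomial.coe_C]

theorem prime_X0 : Prime (X 0 : Ser F) := by
  rw [← MulEquiv.prime_iff (iterSer (F := F)).toMulEquiv]
  show Prime (iterSer (X 0 : Ser F))
  rw [iterSer_X0]
  exact PowerSeries.X_prime

theorem isUnit_shift {β : F} (hβ : β ≠ 0) : IsUnit (X 1 + C β : Ser F) := by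
  rw [← MulEquiv.isUnit_map (iterSer (F := F)), iterSer_shift]
  have := (isUnit_shiftHom_X_pow hβ 1).map (PowerSeries.C (R := PowerSeries F))
  rwa [pow_one] at this

theorem hasSubst_toric (hn : 0 < n) (hm : 0 < m) (a b : ℕ) (β : F) :
    HasSubst (![X 0 ^ n * (X 1 + C β) ^ a, X 0 ^ m * (X 1 + C β) ^ b] : Fin 2 → Ser F) := by
  refine hasSubst_of_constantCoeff_zero fun s => ?_
  fin_cases s
  · simp [hn.ne']
  · simp [hm.ne']

/-- The toric substitution is the monomial one followed by `z = y + β` on coefficients, so strict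
transforms can be studied in `F[z]⟦X⟧`. -/
theorem iterSer_subst (h : Bezout n m a b) (β : F) (A : Ser F) :
    iterSer (subst (![X 0 ^ n * (X 1 + C β) ^ a, X 0 ^ m * (X 1 + C β) ^ b] : Fin 2 → Ser F) A) =
      PowerSeries.map (shiftHom β) (weighted F h A) := by
  ext w k
  have key : ∀ e : Fin 2 →₀ ℕ, coeff (Finsupp.single 0 w + Finsupp.single 1 k)
      (e.prod fun s t => ((![X 0 ^ n * (X 1 + C β) ^ a, X 0 ^ m * (X 1 + C β) ^ b] :
        Fin 2 → Ser F) s) ^ t) =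
      if n * e 0 + m * e 1 = w then
        PowerSeries.coeff k (shiftHom β (Polynomial.X ^ (a * e 0 + b * e 1))) else 0 := by
    intro e
    rw [Finsupp.prod_fintype _ _ (by simp), Fin.prod_univ_two]
    have : ((![X 0 ^ n * (X 1 + C β) ^ a, X 0 ^ m * (X 1 + C β) ^ b] :
        Fin 2 → Ser F) 0) ^ (e 0) * ((![X 0 ^ n * (X 1 + C β) ^ a, X 0 ^ m * (X 1 + C β) ^ b] :
        Fin 2 → Ser F) 1) ^ (e 1) =
        (X 1 + C β) ^ (a * e 0 + b * e 1) * X 0 ^ (n * e 0 + m * e 1) := by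
      simp only [Matrix.cons_val_zero, Matrix.cons_val_one]
      ring
    rw [this]
    change cf _ _ _ = _
    rw [← coeff_coeff_iterSer, map_mul, map_pow, map_pow, iterSer_shift, iterSer_X0, ← map_pow,
      ← map_pow, PowerSeries.coeff_C_mul, PowerSeries.coeff_X_pow]
    split_ifs with h1 h2 h2
    · rw [mul_one]
    · exact absurd h1.symm h2
    · exact absurd h2.symm h1
    · rw [mul_zero, map_zero]
  rw [coeff_coeff_iterSer, cf, coeff_subst (hasSubst_toric h.n_pos h.m_pos a b β)]
  refine (finsum_congr fun e => congrArg (coeff e A • ·) (key e)).trans ?_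
  rw [finsum_eq_sum_line (w := w) h.n_pos h.m_pos _ (fun e he => by simp [he]),
    PowerSeries.coeff_map, coeff_weighted_eq_sum, map_sum, map_sum]
  refine Finset.sum_congr rfl fun p hp => ?_
  rw [mem_line h.n_pos h.m_pos] at hp
  simp only [Finsupp.coe_add, Pi.add_apply, Finsupp.single_apply]
  simp [hp, ← Polynomial.C_mul_X_pow_eq_monomial, shiftHom_apply, cf,
    PowerSeries.coeff_C_mul]

/-- `S` is the strict transform of `A` under `x = x₁ ^ n * (y₁ + β) ^ a`,
`y = x₁ ^ m * (y₁ + β) ^ b`. -/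
def IsStrictTransform (n m a b : ℕ) (β : F) (A S : Ser F) : Prop :=
  X 0 ^ wOrder n m A * (X 1 + C β) ^ wOrder a b A * S =
    subst (![X 0 ^ n * (X 1 + C β) ^ a, X 0 ^ m * (X 1 + C β) ^ b] : Fin 2 → Ser F) A

theorem isStrictTransform_iff (h : Bezout n m a b) {β : F} {A S : Ser F} :
    IsStrictTransform n m a b β A S ↔
      PowerSeries.X ^ wOrder n m A * iterSer ((X 1 + C β) ^ wOrder a b A * S) =
        PowerSeries.map (shiftHom β) (weighted F h A) := by
  rw [← iterSer_subst, IsStrictTransform, ← iterSer.injective.eq_iff, mul_assoc, map_mul, map_pow,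
    iterSer_X0]

theorem exists_isStrictTransform (h : Bezout n m a b) {β : F} (hβ : β ≠ 0) (A : Ser F) :
    ∃ S, IsStrictTransform n m a b β A S := by
  obtain ⟨L, hL, -⟩ := exists_weighted_eq h A
  obtain ⟨v, hv⟩ := ((isUnit_shift hβ).pow (wOrder a b A)).exists_right_inv
  refine ⟨v * iterSer.symm (PowerSeries.map (shiftHom β) L), ?_⟩
  rw [isStrictTransform_iff h, ← mul_assoc, hv, one_mul, RingEquiv.apply_symm_apply, hL, map_mul,
    map_pow, PowerSeries.map_X]

theorem IsStrictTransform.unique {β : F} (hβ : β ≠ 0) {A S T : Ser F}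
    (hS : IsStrictTransform n m a b β A S) (hT : IsStrictTransform n m a b β A T) : S = T := by
  have h1 : (X 0 : Ser F) ^ wOrder n m A * (X 1 + C β) ^ wOrder a b A ≠ 0 :=
    mul_ne_zero (pow_ne_zero _ prime_X0.ne_zero) (pow_ne_zero _ (isUnit_shift hβ).ne_zero)
  exact mul_left_cancel₀ h1 (Eq.trans hS (Eq.symm hT))

/-- For `β ≠ 0` the series `y + β` is a unit; up to units only the power of `x` has to be divided
out. -/
theorem IsStrictTransform.associated_of_eq {β : F} (hβ : β ≠ 0)
    {A S T : Ser F} (hS : IsStrictTransform n m a b β A S)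
    (hT : Associated
      (subst (![X 0 ^ n * (X 1 + C β) ^ a, X 0 ^ m * (X 1 + C β) ^ b] : Fin 2 → Ser F) A)
      (X 0 ^ wOrder n m A * T)) : Associated S T := by
  rw [← show _ = _ from hS, mul_assoc] at hT
  obtain ⟨u, hu⟩ := hT
  refine ⟨((isUnit_shift hβ).pow (wOrder a b A)).unit * u,
    mul_left_cancel₀ (pow_ne_zero (wOrder n m A) (prime_X0 (F := F)).ne_zero) ?_⟩
  rw [← hu]
  push_cast
  simp only [IsUnit.unit_spec]
  ring

theorem IsStrictTransform.associated_subst {β : F} (hβ : β ≠ 0)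
    {A S : Ser F} (hS : IsStrictTransform n m a b β A S) :
    Associated (subst (![X 0 ^ n * (X 1 + C β) ^ a, X 0 ^ m * (X 1 + C β) ^ b] : Fin 2 → Ser F) A)
      (X 0 ^ wOrder n m A * S) := by
  rw [← show _ = _ from hS]
  have hu := (isUnit_shift hβ).pow (wOrder a b A)
  rw [mul_right_comm]
  exact Associated.symm ⟨hu.unit, rfl⟩

theorem IsStrictTransform.mul (h : Bezout n m a b) {β : F} (hβ : β ≠ 0) {A B S T V : Ser F}
    (hA : A ≠ 0) (hB : B ≠ 0) (hS : IsStrictTransform n m a b β A S)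
    (hT : IsStrictTransform n m a b β B T) (hV : IsStrictTransform n m a b β (A * B) V) :
    Associated V (S * T) := by
  refine hV.associated_of_eq hβ ?_
  rw [wOrder_mul h hA hB, subst_mul (hasSubst_toric h.n_pos h.m_pos a b β), pow_add,
    mul_mul_mul_comm]
  exact (hS.associated_subst hβ).mul_mul (hT.associated_subst hβ)

theorem IsStrictTransform.dvd (h : Bezout n m a b) {β : F} (hβ : β ≠ 0) {A B S T : Ser F}
    (hB : B ≠ 0) (hAB : A ∣ B) (hS : IsStrictTransform n m a b β A S)
    (hT : IsStrictTransform n m a b β B T) : S ∣ T := by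
  obtain ⟨D, rfl⟩ := hAB
  obtain ⟨V, hV⟩ := exists_isStrictTransform h hβ D
  exact (Dvd.intro V rfl).trans
    (hS.mul h hβ (left_ne_zero_of_mul hB) (right_ne_zero_of_mul hB) hV hT).symm.dvd

/-- On `x = 0` only the leading coefficient survives, and at `z = y + β` the powers of `z` in it are
units. -/
theorem IsStrictTransform.hasYOrder (h : Bezout n m a b) {β : F} (hβ : β ≠ 0) {A S : Ser F}
    (hA : A ≠ 0) (hS : IsStrictTransform n m a b β A S) :
    HasYOrder S ((edgePoly n m A).rootMultiplicity β) := by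
  obtain ⟨L, hL, hL0⟩ := exists_weighted_eq h A
  rw [isStrictTransform_iff h, hL, map_mul (PowerSeries.map _), map_pow (PowerSeries.map _),
    PowerSeries.map_X] at hS
  have h1 := mul_left_cancel₀ (pow_ne_zero _ PowerSeries.X_ne_zero) hS
  have h2 := congrArg (PowerSeries.coeff 0) h1
  rw [coeff_zero_iterSer, PowerSeries.coeff_map, hL0, leadPoly_eq h hA, map_mul, map_mul] at h2
  have hu := (((isUnit_shift hβ).pow (wOrder a b A)).map (restrictX (F := F)))
  have h3 := congrArg PowerSeries.order h2
  rw [PowerSeries.order_mul, PowerSeries.order_mul, PowerSeries.order_zero_of_unit hu,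
    PowerSeries.order_zero_of_unit (isUnit_shiftHom_X_pow hβ _), zero_add, zero_add,
    order_shiftHom β (edgePoly_ne_zero h.n_pos h.m_pos h.coprime hA)] at h3
  rwa [hasYOrder_iff_order]

theorem IsStrictTransform.pow_dvd (h : Bezout n m a b) {β : F} (hβ : β ≠ 0) {A S : Ser F} {e : ℕ}
    (hA : A ≠ 0) (hS : IsStrictTransform n m a b β A S) (he : HasYOrder S e) :
    (Polynomial.X - Polynomial.C β) ^ e ∣ edgePoly n m A ∧ e ≤ edgeDegree n m A := by
  obtain rfl := he.unique (hS.hasYOrder h hβ hA)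
  have h1 := Polynomial.pow_rootMultiplicity_dvd (edgePoly n m A) β
  refine ⟨h1, ?_⟩
  have h2 := Polynomial.natDegree_le_of_dvd h1 (edgePoly_ne_zero h.n_pos h.m_pos h.coprime hA)
  rwa [Polynomial.natDegree_pow, Polynomial.natDegree_X_sub_C, mul_one,
    natDegree_edgePoly h.n_pos h.m_pos h.coprime hA] at h2

/-- Divide `A` by `Q`, with a remainder `R` of degree less than `n e` in `y`. If `R ≠ 0`, then `H`
divides its transform, which thus has `y`-order at least `e`; so the edge polynomial of `R` has
degree at least `e`, and `R` has a point of height at least `n e`, a contradiction. -/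
theorem IsStrictTransform.dvd_of_dvd (h : Bezout n m a b) {β : F} (hβ : β ≠ 0)
    {Q H A S : Ser F} {e : ℕ} (hQ : HasYOrder Q (n * e)) (hH : HasYOrder H e)
    (hQH : IsStrictTransform n m a b β Q H) (hS : IsStrictTransform n m a b β A S)
    (hdvd : H ∣ S) : Q ∣ A := by
  obtain ⟨B, R, rfl, hR⟩ := hQ.exists_div_rem A
  by_cases hR0 : R = 0
  · rw [hR0, add_zero]; exact Dvd.intro_left B rfl
  exfalso
  obtain ⟨V, hV⟩ := exists_isStrictTransform h hβ R
  have hs := hasSubst_toric h.n_pos h.m_pos a b β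
  have h1 : H ∣ X 0 ^ wOrder n m R * V := by
    refine Dvd.dvd.trans ?_ (hV.associated_subst hβ).dvd
    have h2 := (hdvd.mul_left (X 0 ^ wOrder n m (B * Q + R))).trans
      (hS.associated_subst hβ).symm.dvd
    rw [subst_add hs, subst_mul hs] at h2
    exact (dvd_add_right (((Dvd.intro_left _ rfl).trans
      (hQH.associated_subst hβ).symm.dvd).mul_left _)).1 h2
  obtain ⟨D, hD⟩ := h1
  -- Since `H` is `y`-regular, the prime `x` does not divide it, so the power of `x` can be
  -- cancelled and `H` divides `V` itself.
  have h3 : ¬ (X 0 : Ser F) ∣ H := fun h0 => by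
    rw [← pow_one (X 0 : Ser F), X0_pow_dvd_iff] at h0
    exact hH.1 (h0 0 one_pos _)
  obtain ⟨D', rfl⟩ := prime_X0.pow_dvd_of_dvd_mul_left _ h3 (hD ▸ Dvd.intro _ rfl)
  rw [mul_left_comm] at hD
  have h4 := mul_left_cancel₀ (pow_ne_zero _ prime_X0.ne_zero) hD
  have he'' := hV.hasYOrder h hβ hR0
  obtain ⟨k, hk, hk'⟩ := he''.of_dvd (h4 ▸ Dvd.intro D' rfl : H ∣ V)
  have h6 := (hV.pow_dvd h hβ hR0 he'').2
  have h7 := (exists_face_vertices h.n_pos h.m_pos h.coprime hR0).2.1.1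
  have h8 : ¬ n * e ≤ edgeV n m R + n * edgeDegree n m R := fun hle => h7 (hR _ _ hle)
  have h9 : n * k ≤ n * edgeDegree n m R := Nat.mul_le_mul_left n (hk.trans h6)
  rw [hk'.unique hH] at h9
  omega

end Toric

/-! ### Lifting series through a toric substitution. -/

section Lift

variable {F : Type*} [Field F] {n m a b : ℕ}

theorem exists_weighted_eq_of_support (h : Bezout n m a b) (M : PowerSeries (Polynomial F))
    (hM : ∀ w t, (PowerSeries.coeff w M).coeff t ≠ 0 → ∃ i j, n * i + m * j = w ∧ a * i + b * j = t) :
    ∃ Q : Ser F, weighted F h Q = M := by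
  refine ⟨ofCf fun i j => (PowerSeries.coeff (n * i + m * j) M).coeff (a * i + b * j), ?_⟩
  ext w t
  by_cases hp : ∃ i j, n * i + m * j = w ∧ a * i + b * j = t
  · obtain ⟨i, j, rfl, rfl⟩ := hp
    rw [coeff_weighted, cf_ofCf]
  · rw [not_not.1 (mt (hM w t) hp)]
    by_contra hne
    obtain ⟨i, j, h1, h2, -⟩ := exists_of_coeff_weighted_ne_zero h hne
    exact hp ⟨i, j, h1, h2⟩

/-- Every integer from `(n - 1)(m - 1)` on has the form `n i + m j`, in particular `n m + w`. The `e
- 1` remaining multiples of `n m` can be distributed between `i` and `j`, which yields `e` points of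
the same weight whose second weights are consecutive. -/
theorem Bezout.exists_interval (h : Bezout n m a b) (e w : ℕ) :
    ∃ κ, ∀ t < e, ∃ i j, n * i + m * j = n * m * e + w ∧ a * i + b * j = κ + t := by
  rcases Nat.eq_zero_or_pos e with rfl | he
  · exact ⟨0, fun t ht => absurd ht (by omega)⟩
  obtain ⟨i₀, j₀, h₀⟩ := Nat.exists_add_mul_eq_of_gcd_dvd_of_mul_pred_le n m (n * m + w)
    (by rw [h.coprime]; exact one_dvd _)
    ((Nat.mul_le_mul (Nat.pred_le n) (Nat.pred_le m)).trans (Nat.le_add_right _ _))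
  obtain ⟨e, rfl⟩ : ∃ k, e = k + 1 := ⟨e - 1, by omega⟩
  refine ⟨a * (i₀ + m * e) + b * j₀, fun t ht => ?_⟩
  obtain ⟨s, rfl⟩ := Nat.exists_eq_add_of_le (Nat.lt_succ_iff.1 ht)
  refine ⟨i₀ + m * s, j₀ + n * t, ?_, ?_⟩
  · linear_combination h₀
  · linear_combination t * h.rel

/-- A series `M` over `F[z]` is sought whose image under `z = y + β` is a unit times `H`, and such
that `X^(nme) M` only involves monomials coming from `x`, `y`. At each level above the lowest,
`Bezout.exists_interval` leaves `e` free consecutive powers of `z`, exactly what division by a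
series of `y`-order `e` requires. -/
theorem exists_isStrictTransform_associated (h : Bezout n m a b) {β : F} (hβ : β ≠ 0) {H : Ser F}
    {e : ℕ} (hH : HasYOrder H e) : ∃ Q S : Ser F, HasYOrder Q (n * e) ∧
      IsStrictTransform n m a b β Q S ∧ Associated S H := by
  choose κ hκ using h.exists_interval e
  have hord := hasYOrder_iff_order.1 hH
  -- The lowest level is prescribed: it is that of `(y^n - β x^m)^e`, after removal of `X^(nme)`.
  set g : Polynomial F := Polynomial.X ^ (a * m * e) * (Polynomial.X - Polynomial.C β) ^ e with hg
  have hg0 : g ≠ 0 := mul_ne_zero (pow_ne_zero _ Polynomial.X_ne_zero)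
    (pow_ne_zero _ (Polynomial.X_sub_C_ne_zero β))
  -- the constant coefficient of the quotient
  obtain ⟨q₀, hq₀, hq₀u⟩ : ∃ q₀, shiftHom β g = q₀ * restrictX H ∧ IsUnit q₀ := by
    obtain ⟨v, hvu, hv⟩ := exists_eq_X_pow_mul_unit hord
    obtain ⟨v', hv'⟩ := hvu.exists_right_inv
    refine ⟨shiftHom β (Polynomial.X ^ (a * m * e)) * v', ?_,
      (isUnit_shiftHom_X_pow hβ _).mul (IsUnit.of_mul_eq_one_right v hv')⟩
    rw [hg, map_mul, map_pow _ (Polynomial.X - _), shiftHom_X_sub_C, hv]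
    linear_combination -shiftHom β (Polynomial.X ^ (a * m * e)) * PowerSeries.X ^ e * hv'
  obtain ⟨G, hG⟩ : PowerSeries.X ∣
      PowerSeries.C (shiftHom β g) - PowerSeries.C q₀ * iterSer H := by
    rw [PowerSeries.X_dvd_iff, map_sub, map_mul PowerSeries.constantCoeff, PowerSeries.constantCoeff_C,
      PowerSeries.constantCoeff_C, ← PowerSeries.coeff_zero_eq_constantCoeff_apply,
      coeff_zero_iterSer, hq₀, sub_self]
  -- Up to the unit `z^κ`, remainders are polynomials of degree less than `e`, a complement of the
  -- ideal generated by `H(0, y)`. One factor `X` has been taken out of `G`, hence the shift to `κ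
  -- (k + 1)`.
  obtain ⟨q, r, hqr, hr⟩ := ToricNewton.exists_div_rem (iterSer H)
    (fun k => {w | ∃ p : Polynomial F, p.degree < e ∧
      w = shiftHom β (Polynomial.X ^ κ (k + 1) * p)}) (fun k r => by
      rw [coeff_zero_iterSer]
      obtain ⟨v, hv⟩ := (isUnit_shiftHom_X_pow hβ (κ (k + 1))).exists_right_inv
      obtain ⟨q, w, hw, hqw⟩ := exists_eq_mul_add_of_order hord (v * r)
      refine ⟨shiftHom β (Polynomial.X ^ κ (k + 1)) * q, _,
        ⟨Polynomial.taylor (-β) w, by rwa [Polynomial.degree_taylor], rfl⟩, ?_⟩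
      rw [map_mul, shiftHom_apply β (Polynomial.taylor _ _), Polynomial.taylor_taylor,
        add_neg_cancel, Polynomial.taylor_zero]
      linear_combination shiftHom β (Polynomial.X ^ κ (k + 1)) * hqw - r * hv) G
  choose f hf hrf using hr
  set M : PowerSeries (Polynomial F) := PowerSeries.C g - PowerSeries.X *
    PowerSeries.mk fun k => Polynomial.X ^ κ (k + 1) * f k with hM
  have hM0 : PowerSeries.coeff 0 M = g := by simp [hM]
  have hMs : ∀ k, PowerSeries.coeff (k + 1) M = -(Polynomial.X ^ κ (k + 1) * f k) := fun k => by
    simp [hM, PowerSeries.coeff_succ_X_mul]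
  have hτM : PowerSeries.map (shiftHom β) M =
      (PowerSeries.C q₀ + PowerSeries.X * q) * iterSer H := by
    have h1 : PowerSeries.map (shiftHom β)
        (PowerSeries.mk fun k => Polynomial.X ^ κ (k + 1) * f k) = r := by
      ext1 k
      rw [PowerSeries.coeff_map, PowerSeries.coeff_mk]
      exact (hrf k).symm
    rw [hM, map_sub, map_mul (PowerSeries.map _), PowerSeries.map_X, PowerSeries.map_C, h1]
    linear_combination hG + PowerSeries.X * hqr
  -- Admissible support: the lowest level uses the points `(m l, n s)` with `l + s = e`, the higher
  -- ones the intervals starting at `κ`.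
  obtain ⟨Q, hQ⟩ := exists_weighted_eq_of_support h (PowerSeries.X ^ (n * m * e) * M) (by
    intro w t hwt
    rw [PowerSeries.coeff_X_pow_mul'] at hwt
    split_ifs at hwt with hw
    swap
    · exact absurd rfl hwt
    obtain ⟨k, rfl⟩ := Nat.exists_eq_add_of_le hw
    rw [Nat.add_sub_cancel_left] at hwt
    rcases k with _ | k
    · rw [hM0, hg, Polynomial.coeff_X_pow_mul'] at hwt
      split_ifs at hwt with ht
      swap
      · exact absurd rfl hwt
      obtain ⟨s, rfl⟩ := Nat.exists_eq_add_of_le ht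
      rw [Nat.add_sub_cancel_left] at hwt
      have hs : s ≤ e := by
        have := Polynomial.le_natDegree_of_ne_zero hwt
        rwa [Polynomial.natDegree_pow, Polynomial.natDegree_X_sub_C, mul_one] at this
      obtain ⟨l, rfl⟩ := Nat.exists_eq_add_of_le hs
      exact ⟨m * l, n * s, by ring, by linear_combination s * h.rel⟩
    · rw [hMs, Polynomial.coeff_neg, neg_ne_zero, Polynomial.coeff_X_pow_mul'] at hwt
      split_ifs at hwt with ht
      swap
      · exact absurd rfl hwt
      obtain ⟨s, rfl⟩ := Nat.exists_eq_add_of_le ht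
      rw [Nat.add_sub_cancel_left] at hwt
      refine hκ (k + 1) s ?_
      have := (Polynomial.le_degree_of_ne_zero hwt).trans_lt (hf k)
      exact_mod_cast this)
  have hM_ne : M ≠ 0 := fun h0 => hg0 (by rw [← hM0, h0, map_zero])
  have hQ0 : Q ≠ 0 := by
    rintro rfl
    rw [map_zero] at hQ
    exact mul_ne_zero (pow_ne_zero _ PowerSeries.X_ne_zero) hM_ne hQ.symm
  have hw : wOrder n m Q = n * m * e := by
    have h1 := order_weighted h hQ0
    rw [hQ, PowerSeries.order_mul, PowerSeries.order_X_pow,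
      (PowerSeries.order_eq_nat (n := 0)).2 ⟨hM0 ▸ hg0, fun i hi => absurd hi (by omega)⟩,
      Nat.cast_zero, add_zero] at h1
    exact_mod_cast h1.symm
  obtain ⟨S, hS⟩ := exists_isStrictTransform h hβ Q
  refine ⟨Q, S, ⟨?_, fun j hj => ?_⟩, hS, ?_⟩
  · rw [← coeff_weighted h, hQ, mul_zero, zero_add, mul_zero, zero_add,
      show m * (n * e) = 0 + n * m * e by ring, PowerSeries.coeff_X_pow_mul, hM0, hg,
      show b * (n * e) = e + a * m * e by linear_combination e * h.rel, Polynomial.coeff_X_pow_mul]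
    have : ((Polynomial.X - Polynomial.C β) ^ e).coeff e = 1 := by
      have := (Polynomial.monic_X_sub_C β).pow e
      rw [Polynomial.Monic, Polynomial.leadingCoeff, Polynomial.natDegree_pow,
        Polynomial.natDegree_X_sub_C, mul_one] at this
      exact this
    rw [this]
    exact one_ne_zero
  · by_contra hne
    have h1 := wOrder_le (n := n) (m := m) hne
    rw [hw, mul_zero, zero_add, show n * m * e = m * (n * e) by ring] at h1
    exact absurd (Nat.le_of_mul_le_mul_left h1 h.m_pos) (by omega)
  · refine hS.associated_of_eq hβ ?_
    have hu : IsUnit (iterSer.symm (PowerSeries.C q₀ + PowerSeries.X * q) : Ser F) := by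
      rw [MulEquiv.isUnit_map (iterSer (F := F)).symm, PowerSeries.isUnit_iff_constantCoeff]
      simpa using hq₀u
    refine Associated.symm ⟨hu.unit, iterSer.injective ?_⟩
    rw [iterSer_subst h, hQ, map_mul (PowerSeries.map _), map_pow (PowerSeries.map _),
      PowerSeries.map_X, hτM, hw, map_mul, map_mul, map_pow, iterSer_X0, IsUnit.unit_spec,
      RingEquiv.apply_symm_apply]
    ring

/-- A factor of `H` of `y`-order `k > 0` lifts to a series of order `n k`, which divides `G` by
descent and so is associated to it: `N = n k`. Thus every non-unit factor of `H` has the full order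
`e`, which excludes a proper factorization. -/
theorem irreducible_strictTransform (h : Bezout n m a b) {β : F} (hβ : β ≠ 0) {G H : Ser F}
    {N e : ℕ} (hG : Irreducible G) (hN : HasYOrder G N) (hS : IsStrictTransform n m a b β G H)
    (he : HasYOrder H e) (he0 : 0 < e) : N = n * e ∧ Irreducible H := by
  have key : ∀ B : Ser F, B ∣ H → ∀ k, HasYOrder B k → 0 < k → N = n * k := by
    intro B hB k hk hk0
    obtain ⟨Q, S, hQ, hQS, hSB⟩ := exists_isStrictTransform_associated h hβ hk
    have hQG := hQS.dvd_of_dvd h hβ hQ (hk.associated hSB.symm) hS (hSB.dvd.trans hB)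
    have hQu : ¬ IsUnit Q := by
      rw [hQ.isUnit_iff]
      exact (Nat.mul_pos h.n_pos hk0).ne'
    have h1 := hG.dvd_iff.1 hQG
    exact hN.unique (hQ.associated (h1.resolve_left hQu).symm)
  have hNe := key H dvd_rfl e he he0
  refine ⟨hNe, by rw [he.isUnit_iff]; omega, ?_⟩
  rintro B D rfl
  obtain ⟨k, l, hk, hl, rfl⟩ := he.of_mul
  rw [hk.isUnit_iff, hl.isUnit_iff]
  by_contra! hkl
  have h1 := key B (Dvd.intro D rfl) k hk (by omega)
  rw [h1] at hNe
  have := Nat.eq_of_mul_eq_mul_left h.n_pos hNe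
  omega

/-- Divisibility passes to strict transforms, primality is used there, and
`IsStrictTransform.dvd_of_dvd` brings the result back. -/
theorem prime_of_strictTransform (h : Bezout n m a b) {β : F} (hβ : β ≠ 0) {Q H : Ser F}
    {e : ℕ} (hQ : HasYOrder Q (n * e)) (hH : HasYOrder H e)
    (hQH : IsStrictTransform n m a b β Q H) (hp : Prime H) : Prime Q := by
  have he : e ≠ 0 := fun h0 => hp.not_isUnit (hH.isUnit_iff.2 h0)
  refine ⟨hQ.ne_zero, by rw [hQ.isUnit_iff]; exact mul_ne_zero h.n_pos.ne' he, ?_⟩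
  intro A B hAB
  by_cases hA : A = 0
  · exact Or.inl (hA ▸ dvd_zero _)
  by_cases hB : B = 0
  · exact Or.inr (hB ▸ dvd_zero _)
  obtain ⟨S, hS⟩ := exists_isStrictTransform h hβ A
  obtain ⟨T, hT⟩ := exists_isStrictTransform h hβ B
  obtain ⟨V, hV⟩ := exists_isStrictTransform h hβ (A * B)
  have h1 := (hQH.dvd h hβ (mul_ne_zero hA hB) hAB hV).trans (hS.mul h hβ hA hB hT hV).dvd
  exact (hp.dvd_or_dvd h1).imp (hQH.dvd_of_dvd h hβ hQ hH hS) (hQH.dvd_of_dvd h hβ hQ hH hT)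

theorem not_sq_dvd_of_strictTransform (h : Bezout n m a b) {β : F} (hβ : β ≠ 0) {Q H A S : Ser F}
    (hA : A ≠ 0) (hQH : IsStrictTransform n m a b β Q H)
    (hS : IsStrictTransform n m a b β A S) (hH : ¬ H * H ∣ S) : ¬ Q * Q ∣ A := by
  intro hQA
  have hQ := left_ne_zero_of_mul (ne_zero_of_dvd_ne_zero hA hQA)
  obtain ⟨V, hV⟩ := exists_isStrictTransform h hβ (Q * Q)
  exact hH ((hQH.mul h hβ hQ hQ hQH hV).symm.dvd.trans (hV.dvd h hβ hA hQA hS))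

end Lift

/-! ### Initial forms; series with a single edge; the first edge. -/

section Edges

variable {F : Type*} [Field F] {n m a b : ℕ}

theorem cf_initialForm (n m : ℕ) (A : Ser F) (i j : ℕ) :
    cf (initialForm n m A) i j = if n * i + m * j = wOrder n m A then cf A i j else 0 := by
  change (if _ then coeff _ A else 0) = _
  simp [cf]

theorem weighted_initialForm (h : Bezout n m a b) (A : Ser F) :
    weighted F h (initialForm n m A) =
      PowerSeries.X ^ wOrder n m A * PowerSeries.C (leadPoly h A) := by
  ext1 w
  rw [mul_comm, PowerSeries.coeff_C_mul, PowerSeries.coeff_X_pow, coeff_weighted_eq_sum]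
  split_ifs with hw
  · rw [mul_one, leadPoly, coeff_weighted_eq_sum, hw]
    refine Finset.sum_congr rfl fun p hp => ?_
    rw [mem_line h.n_pos h.m_pos] at hp
    rw [cf_initialForm, if_pos hp]
  · rw [mul_zero]
    refine Finset.sum_eq_zero fun p hp => ?_
    rw [mem_line h.n_pos h.m_pos] at hp
    rw [cf_initialForm, if_neg (hp ▸ hw), Polynomial.monomial_zero_right]

theorem weighted_edgeForm (h : Bezout n m a b) (A : Ser F) :
    weighted F h (edgeForm n m A) = PowerSeries.X ^ (n * m * edgeDegree n m A) *
      PowerSeries.C (Polynomial.X ^ (a * m * edgeDegree n m A) * edgePoly n m A) := by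
  rw [edgeForm, edgePoly, map_sum, map_mul, map_sum, Finset.mul_sum, Finset.mul_sum]
  refine Finset.sum_congr rfl fun k hk => ?_
  obtain ⟨r, hr⟩ := Nat.exists_eq_add_of_le (Nat.lt_succ_iff.1 (Finset.mem_range.1 hk))
  rw [map_mul, map_mul, map_pow, map_pow, map_pow, map_pow, weighted_X0, weighted_X1, weighted_C,
    ← Polynomial.C_mul_X_pow_eq_monomial, hr, Nat.add_sub_cancel_left, map_mul]
  simp only [mul_pow, ← map_pow, ← pow_mul]
  rw [show b * n * k = a * m * k + k by rw [h.rel]; ring]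
  simp only [pow_add, mul_add, map_mul]
  rw [show n * m * r = n * (m * r) by ring, show n * m * k = m * (n * k) by ring,
    show a * m * r = a * (m * r) by ring]
  simp only [pow_mul]
  ring

theorem initialForm_eq_smul_edgeForm (h : Bezout n m a b) {Q S : Ser F} (hQ : Q ≠ 0)
    (hu : edgeU n m Q = 0) (hv : edgeV n m Q = 0)
    (hd : edgeDegree n m Q = edgeDegree n m S) {r : F}
    (hE : edgePoly n m Q = Polynomial.C r * edgePoly n m S) :
    initialForm n m Q = C r * edgeForm n m S := by
  refine weighted_injective h ?_
  rw [map_mul, weighted_C, weighted_initialForm, weighted_edgeForm, leadPoly_eq h hQ, hE, hu, hv,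
    (exists_face_vertices h.n_pos h.m_pos h.coprime hQ).1, hu, hv, hd]
  simp only [map_mul, mul_zero, add_zero, zero_add]
  rw [mul_assoc a m]
  ring

/-- The height bound is attained, so the face starts at `(0, n e)` and there is no room left for `u`
and `v`: it runs from axis to axis. -/
theorem edge_of_hasYOrder (h : Bezout n m a b) {G : Ser F} {e : ℕ} (hG : HasYOrder G (n * e))
    (he : e ≤ edgeDegree n m G) :
    edgeDegree n m G = e ∧ edgeU n m G = 0 ∧ edgeV n m G = 0 := by
  have h1 := edge_height_le h hG
  have h2 := wOrder_le_of_hasYOrder (n := n) (m := m) hG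
  rw [(exists_face_vertices h.n_pos h.m_pos h.coprime hG.ne_zero).1] at h2
  have h3 := Nat.mul_le_mul_left n he
  have h4 : edgeDegree n m G = e := Nat.eq_of_mul_eq_mul_left h.n_pos (by omega)
  rw [h4] at h1 h2
  have h5 : n * edgeU n m G = 0 := by
    have : m * (n * e) = n * m * e := by ring
    omega
  exact ⟨h4, (Nat.mul_eq_zero.1 h5).resolve_left h.n_pos.ne', by omega⟩

theorem coprime_ratio_unique {n m n' m' : ℕ} (hn : 0 < n)
    (h : Nat.Coprime n m) (h' : Nat.Coprime n' m') (he : n * m' = n' * m) : n = n' ∧ m = m' := by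
  have h1 : n ∣ n' := h.dvd_of_dvd_mul_right (he ▸ Dvd.intro _ rfl)
  have h2 : n' ∣ n := h'.dvd_of_dvd_mul_right (he ▸ Dvd.intro _ rfl)
  obtain rfl := Nat.dvd_antisymm h1 h2
  exact ⟨rfl, (Nat.eq_of_mul_eq_mul_left hn he).symm⟩

/-- A series with an edge joining `(0, n * e)` to `(m * e, 0)` has no other edge. -/
theorem edge_unique (h : Bezout n m a b) {G : Ser F} {e : ℕ} (hG : HasYOrder G (n * e))
    (he : e ≤ edgeDegree n m G) {n' m' : ℕ} (hE : IsEdge G n' m') : n = n' ∧ m = m' := by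
  obtain ⟨hd, hu, hv⟩ := edge_of_hasYOrder h hG he
  obtain ⟨hw, h1, h2⟩ := exists_face_vertices h.n_pos h.m_pos h.coprime hG.ne_zero
  rw [hd, hu, hv] at hw h1 h2
  simp only [zero_add, mul_zero] at hw h1 h2
  have w1 := wOrder_le (n := n') (m := m') (show cf G 0 (n * e) ≠ 0 from h1.1)
  have w2 := wOrder_le (n := n') (m := m') (show cf G (m * e) 0 ≠ 0 from h2.1)
  rw [mul_zero, zero_add] at w1
  rw [mul_zero, add_zero] at w2
  obtain ⟨hn', hm', hc', ⟨p, hp, q, hq, hpq⟩⟩ := hE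
  have hf : ∀ x ∈ face n' m' G, n * m * e ≤ n * x.1 + m * x.2 ∧
      n' * x.1 + m' * x.2 ≤ m' * (n * e) ∧ n' * x.1 + m' * x.2 ≤ n' * (m * e) := fun x hx =>
    ⟨hw ▸ wOrder_le hx.1, hx.2 ▸ w1, hx.2 ▸ w2⟩
  have hn := h.n_pos
  have hm := h.m_pos
  refine coprime_ratio_unique hn h.coprime hc' ?_
  -- The support lies above the segment from `(0, n e)` to `(m e, 0)`. A supporting line of another
  -- slope meets it in a single endpoint, against the two points required of an edge.
  rcases lt_trichotomy (n * m') (n' * m) with hlt | heq | hgt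
  · exfalso
    have key : ∀ x ∈ face n' m' G, x = (0, n * e) := by
      rintro ⟨i, j⟩ hx
      obtain ⟨x1, x2, -⟩ := hf _ hx
      simp only at x1 x2
      have hi : i = 0 := by
        by_contra hi
        have hi : 0 < i := Nat.pos_of_ne_zero hi
        have := Nat.mul_lt_mul_of_pos_right hlt hi
        have e1 := Nat.mul_le_mul_left m' x1
        have e2 := Nat.mul_le_mul_left m x2
        nlinarith
      subst hi
      have e1 : n * e ≤ j := Nat.le_of_mul_le_mul_left (by linarith : m * (n * e) ≤ m * j) hm
      have e2 : j ≤ n * e := Nat.le_of_mul_le_mul_left (by omega : m' * j ≤ m' * (n * e)) hm'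
      rw [le_antisymm e2 e1]
    exact hpq ((key p hp).trans (key q hq).symm)
  · exact heq
  · exfalso
    have key : ∀ x ∈ face n' m' G, x = (m * e, 0) := by
      rintro ⟨i, j⟩ hx
      obtain ⟨x1, -, x2⟩ := hf _ hx
      simp only at x1 x2
      have hj : j = 0 := by
        by_contra hj
        have hj : 0 < j := Nat.pos_of_ne_zero hj
        have := Nat.mul_lt_mul_of_pos_right hgt hj
        have e1 := Nat.mul_le_mul_left n' x1
        have e2 := Nat.mul_le_mul_left n x2
        nlinarith
      subst hj
      have e1 : m * e ≤ i := Nat.le_of_mul_le_mul_left (by linarith : n * (m * e) ≤ n * i) hn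
      have e2 : i ≤ m * e := Nat.le_of_mul_le_mul_left (by omega : n' * i ≤ n' * (m * e)) hn'
      rw [le_antisymm e2 e1]
    exact hpq ((key p hp).trans (key q hq).symm)

/-- The steepest edge of a series that is regular in both variables. -/
theorem exists_first_edge {G : Ser F} {N i₀ : ℕ} (hG : HasYOrder G N) (hN : 0 < N)
    (hi₀ : cf G i₀ 0 ≠ 0) : ∃ n m, IsEdge G n m ∧ wOrder n m G = m * N := by
  -- The edge at `(0, N)` is found by minimizing the slope `i / (N - j)` over support points with `j
  -- < N`; the factor `N!` clears all denominators.
  let f : ℕ × ℕ → ℕ := fun p => p.1 * (N.factorial / (N - p.2))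
  obtain ⟨⟨i₁, j₁⟩, ⟨hs, hj⟩, hmin⟩ := (measure f).wf.has_min
    {p : ℕ × ℕ | cf G p.1 p.2 ≠ 0 ∧ p.2 < N} ⟨(i₀, 0), hi₀, hN⟩
  simp only at hs hj
  have hmin' : ∀ i j, cf G i j ≠ 0 → j < N → i₁ * (N - j) ≤ i * (N - j₁) := by
    intro i j hij hjN
    have h1 : f (i₁, j₁) ≤ f (i, j) := not_lt.1 (hmin (i, j) ⟨hij, hjN⟩)
    have hd : ∀ k < N, N.factorial / (N - k) * (N - k) = N.factorial := fun k hk =>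
      Nat.div_mul_cancel (Nat.dvd_factorial (by omega) (Nat.sub_le _ _))
    have h2 := Nat.mul_le_mul_right ((N - j₁) * (N - j)) h1
    refine Nat.le_of_mul_le_mul_left ?_ N.factorial_pos
    calc N.factorial * (i₁ * (N - j)) = f (i₁, j₁) * ((N - j₁) * (N - j)) := by
          rw [← hd j₁ hj]; simp only [f]; ring
      _ ≤ f (i, j) * ((N - j₁) * (N - j)) := h2
      _ = N.factorial * (i * (N - j₁)) := by rw [← hd j hjN]; simp only [f]; ring
  have hi₁ : 0 < i₁ := by
    rw [Nat.pos_iff_ne_zero]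
    rintro rfl
    exact hs (hG.2 _ hj)
  have hN₁ : 0 < N - j₁ := by omega
  obtain ⟨m, n, hmn, hm, hn⟩ := Nat.exists_coprime i₁ (N - j₁)
  set g := Nat.gcd i₁ (N - j₁) with hg
  have hgpos : 0 < g := Nat.gcd_pos_of_pos_left _ hi₁
  have hmpos : 0 < m := Nat.pos_of_mul_pos_right (hm ▸ hi₁)
  have hnpos : 0 < n := Nat.pos_of_mul_pos_right (hn ▸ hN₁)
  have hw : wOrder n m G = m * N := by
    refine le_antisymm (wOrder_le_of_hasYOrder hG) (le_wOrder hG.ne_zero fun i j hij => ?_)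
    rcases Nat.lt_or_ge j N with hjN | hjN
    · have h1 := hmin' i j hij hjN
      rw [hm, hn] at h1
      have h2 : m * (N - j) ≤ n * i :=
        Nat.le_of_mul_le_mul_left (by linarith : g * (m * (N - j)) ≤ g * (n * i)) hgpos
      obtain ⟨s, rfl⟩ := Nat.exists_eq_add_of_le hjN.le
      rw [Nat.add_sub_cancel_left] at h2
      linarith
    · have := Nat.mul_le_mul_left m hjN
      omega
  refine ⟨n, m, ⟨hnpos, hmpos, hmn.symm, (0, N), ⟨hG.1, by simp [hw]⟩, (i₁, j₁), ⟨hs, ?_⟩, ?_⟩, hw⟩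
  · rw [hw]
    obtain ⟨s, hs⟩ := Nat.exists_eq_add_of_le hj.le
    rw [hs, Nat.add_sub_cancel_left] at hn
    simp only
    rw [hs, hm, hn]
    ring
  · intro he
    rw [Prod.mk.injEq] at he
    omega

end Edges

/-! ### Edges whose form is a power of `y - r x^m`. -/

section Binomial

variable {F : Type*} [Field F] {m a b : ℕ}

theorem weighted_binomial (h : Bezout 1 m a b) (β r : F) (e : ℕ) :
    weighted F h (C β * (X 1 - C r * X 0 ^ m) ^ e) = PowerSeries.X ^ (m * e) *
      PowerSeries.C (Polynomial.X ^ (a * m * e) *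
        (Polynomial.C β * (Polynomial.X - Polynomial.C r) ^ e)) := by
  have hb : b = a * m + 1 := by have := h.rel; rwa [mul_one] at this
  have h1 : weighted F h (X 1 - C r * X 0 ^ m) = PowerSeries.X ^ m *
      PowerSeries.C (Polynomial.X ^ (a * m) * (Polynomial.X - Polynomial.C r)) := by
    rw [map_sub, map_mul, map_pow, weighted_X0, weighted_X1, weighted_C, hb, pow_one, mul_pow,
      ← map_pow, ← pow_mul, pow_succ, map_mul, map_mul, map_sub]
    ring
  rw [map_mul, map_pow, h1, weighted_C, mul_pow, ← map_pow, mul_pow, ← pow_mul, ← pow_mul, map_mul,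
    map_mul, map_mul]
  ring

theorem edge_of_initialForm_binomial (h : Bezout 1 m a b) {A : Ser F} {β r : F} {e : ℕ}
    (hA : IsEdge A 1 m) (hA0 : A ≠ 0) (hβ : β ≠ 0)
    (hin : initialForm 1 m A = C β * (X 1 - C r * X 0 ^ m) ^ e) :
    r ≠ 0 ∧ edgePoly 1 m A = Polynomial.C β * (Polynomial.X - Polynomial.C r) ^ e ∧
      edgeDegree 1 m A = e ∧ edgeU 1 m A = 0 ∧ edgeV 1 m A = 0 := by
  have h1 := congrArg (weighted F h) hin
  rw [weighted_initialForm, weighted_binomial] at h1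
  have hβ' : Polynomial.C β ≠ 0 := Polynomial.C_ne_zero.2 hβ
  have hne : Polynomial.X ^ (a * m * e) *
        (Polynomial.C β * (Polynomial.X - Polynomial.C r) ^ e) ≠ 0 :=
    mul_ne_zero (pow_ne_zero _ Polynomial.X_ne_zero)
      (mul_ne_zero hβ' (pow_ne_zero _ (Polynomial.X_sub_C_ne_zero r)))
  have hord : ∀ (k : ℕ) (p : Polynomial F), p ≠ 0 →
      (PowerSeries.X ^ k * PowerSeries.C p : PowerSeries (Polynomial F)).order = k := by
    intro k p hp
    rw [PowerSeries.order_mul, PowerSeries.order_X_pow,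
      (PowerSeries.order_eq_nat (φ := PowerSeries.C p) (n := 0)).2
        ⟨by simpa using hp, fun i hi => absurd hi (by omega)⟩]
    simp
  have hw : wOrder 1 m A = m * e := by
    have h2 := congrArg PowerSeries.order h1
    rw [hord _ _ (leadPoly_ne_zero h hA0), hord _ _ hne] at h2
    exact_mod_cast h2
  rw [hw] at h1
  have h3 := PowerSeries.C_injective
    (mul_left_cancel₀ (pow_ne_zero _ PowerSeries.X_ne_zero) h1)
  rw [leadPoly_eq h hA0] at h3
  have hd := (isEdge_iff h.n_pos h.m_pos h.coprime hA0).1 hA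
  -- For `r = 0` the initial form would be a monomial, and the face would not be an edge.
  have hr : r ≠ 0 := by
    rintro rfl
    rw [map_zero, sub_zero, mul_left_comm, ← pow_add, mul_comm (Polynomial.C β)] at h3
    have h4 := (X_pow_mul_inj (edgePoly_coeff_zero_ne_zero h.n_pos h.m_pos h.coprime hA0)
      (by simpa using hβ) h3).2
    rw [← natDegree_edgePoly h.n_pos h.m_pos h.coprime hA0, h4, Polynomial.natDegree_C] at hd
    exact absurd hd (by omega)
  have hE := (X_pow_mul_inj (edgePoly_coeff_zero_ne_zero h.n_pos h.m_pos h.coprime hA0)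
    (by
      rw [Polynomial.coeff_zero_eq_eval_zero]
      simpa using ⟨hβ, fun h0 => absurd h0 hr⟩) h3).2
  have hde : edgeDegree 1 m A = e := by
    rw [← natDegree_edgePoly h.n_pos h.m_pos h.coprime hA0, hE, Polynomial.natDegree_C_mul hβ,
      Polynomial.natDegree_pow, Polynomial.natDegree_X_sub_C, mul_one]
  have h5 := (exists_face_vertices h.n_pos h.m_pos h.coprime hA0).1
  rw [hw, hde, one_mul, one_mul] at h5
  have h6 : m * edgeV 1 m A = 0 := by omega
  exact ⟨hr, hE, hde, by omega, (Nat.mul_eq_zero.1 h6).resolve_left h.m_pos.ne'⟩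

theorem initialForm_eq_binomial (h : Bezout 1 m a b) {A : Ser F} (hA0 : A ≠ 0) {β r : F} {e : ℕ}
    (hE : edgePoly 1 m A = Polynomial.C β * (Polynomial.X - Polynomial.C r) ^ e)
    (hd : edgeDegree 1 m A = e) (hu : edgeU 1 m A = 0) (hv : edgeV 1 m A = 0) :
    initialForm 1 m A = C β * (X 1 - C r * X 0 ^ m) ^ e := by
  refine weighted_injective h ?_
  rw [weighted_initialForm, weighted_binomial, leadPoly_eq h hA0, hE,
    (exists_face_vertices h.n_pos h.m_pos h.coprime hA0).1, hd, hu, hv]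
  simp [mul_assoc]

end Binomial

/-! ### The change of variables `y ↦ y + r x^m`. -/

section Translation

variable {F : Type*} [Field F] {m : ℕ}

theorem cf_X0_pow_mul_X1_pow (s t i j : ℕ) :
    cf (X 0 ^ s * X 1 ^ t : Ser F) i j = if i = s ∧ j = t then 1 else 0 := by
  rw [← coeff_coeff_iterSer, map_mul, map_pow, map_pow, iterSer_X0, iterSer_X1, ← map_pow,
    mul_comm, PowerSeries.coeff_C_mul, PowerSeries.coeff_X_pow]
  by_cases h1 : i = s <;> by_cases h2 : j = t <;> simp [h1, h2, PowerSeries.coeff_X_pow]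

theorem cf_X0_pow_mul_binomial (r : F) (i j w k : ℕ) :
    cf (X 0 ^ i * (X 1 + C r * X 0 ^ m) ^ j) w k =
      if i + m * j = w + m * k ∧ k ≤ j then r ^ (j - k) * (j.choose k : F) else 0 := by
  have h1 : (X 0 ^ i * (X 1 + C r * X 0 ^ m) ^ j : Ser F) = ∑ t ∈ Finset.range (j + 1),
      C (r ^ (j - t) * (j.choose t : F)) * (X 0 ^ (i + m * (j - t)) * X 1 ^ t) := by
    rw [add_pow, Finset.mul_sum]
    refine Finset.sum_congr rfl fun t _ => ?_
    rw [mul_pow, ← pow_mul, map_mul, map_pow, map_natCast, pow_add]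
    ring
  have h2 : ∀ (s : Finset ℕ) (f : ℕ → Ser F), cf (∑ t ∈ s, f t) w k = ∑ t ∈ s, cf (f t) w k :=
    fun s f => map_sum (coeff _) f s
  rw [h1, h2]
  simp only [cf_C_mul, cf_X0_pow_mul_X1_pow]
  split_ifs with h
  · obtain ⟨h3, h4⟩ := h
    rw [Finset.sum_eq_single_of_mem k (Finset.mem_range.2 (by omega))]
    · rw [if_pos, mul_one]
      refine ⟨?_, rfl⟩
      rw [Nat.mul_sub]
      have := Nat.mul_le_mul_left m h4
      omega
    · intro t _ htk
      rw [if_neg (fun h => htk h.2.symm), mul_zero]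
  · refine Finset.sum_eq_zero fun t ht => ?_
    rw [if_neg, mul_zero]
    rintro ⟨rfl, rfl⟩
    have h4 : k ≤ j := Nat.lt_succ_iff.1 (Finset.mem_range.1 ht)
    refine h ⟨?_, h4⟩
    rw [Nat.mul_sub]
    have := Nat.mul_le_mul_left m h4
    omega

theorem hasSubst_translation (hm : 0 < m) (r : F) :
    HasSubst (![X 0, X 1 + C r * X 0 ^ m] : Fin 2 → Ser F) := by
  refine hasSubst_of_constantCoeff_zero fun s => ?_
  fin_cases s
  · simp
  · simp [hm.ne']

/-- The substitution is homogeneous for the weights `(1, m)`, so a coefficient depends only on the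
finitely many exponents of its own weight. -/
theorem cf_translation (hm : 0 < m) (r : F) (A : Ser F) (w k : ℕ) :
    cf (subst (![X 0, X 1 + C r * X 0 ^ m] : Fin 2 → Ser F) A) w k =
      ∑ p ∈ line 1 m (w + m * k),
        cf A p.1 p.2 * if k ≤ p.2 then r ^ (p.2 - k) * (p.2.choose k : F) else 0 := by
  have key : ∀ e : Fin 2 →₀ ℕ, coeff (Finsupp.single 0 w + Finsupp.single 1 k)
      (e.prod fun s t => ((![X 0, X 1 + C r * X 0 ^ m] : Fin 2 → Ser F) s) ^ t) =
      if e 0 + m * e 1 = w + m * k ∧ k ≤ e 1 then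
        r ^ (e 1 - k) * ((e 1).choose k : F) else 0 := by
    intro e
    rw [Finsupp.prod_fintype _ _ (by simp), Fin.prod_univ_two]
    exact cf_X0_pow_mul_binomial r (e 0) (e 1) w k
  rw [cf, coeff_subst (hasSubst_translation hm r)]
  refine (finsum_congr fun e => congrArg (coeff e A • ·) (key e)).trans ?_
  rw [finsum_eq_sum_line (n := 1) (m := m) (w := w + m * k) one_pos hm _ (fun e he => by
    rw [one_mul] at he; simp [he])]
  refine Finset.sum_congr rfl fun p hp => ?_
  rw [mem_line one_pos hm, one_mul] at hp
  simp [hp, cf]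

theorem translation_neg (hm : 0 < m) (r : F) (A : Ser F) :
    subst (![X 0, X 1 + C (-r) * X 0 ^ m] : Fin 2 → Ser F)
      (subst (![X 0, X 1 + C r * X 0 ^ m] : Fin 2 → Ser F) A) = A := by
  have h1 := hasSubst_translation hm r
  have h2 := hasSubst_translation hm (-r)
  rw [subst_comp_subst_apply h1 h2]
  have : (fun s => subst (![X 0, X 1 + C (-r) * X 0 ^ m] : Fin 2 → Ser F)
      ((![X 0, X 1 + C r * X 0 ^ m] : Fin 2 → Ser F) s)) = X := by
    funext s
    fin_cases s
    · exact subst_X h2 0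
    · change subst _ (X 1 + C r * X 0 ^ m : Ser F) = X 1
      rw [subst_add h2, subst_mul h2, subst_pow h2, subst_X h2, subst_X h2, subst_C]
      simp
  rw [this, subst_self]
  rfl

/-- The automorphism `y ↦ y + r * x ^ m`. -/
noncomputable def translationEquiv (hm : 0 < m) (r : F) : Ser F ≃+* Ser F :=
  RingEquiv.ofRingHom (substAlgHom (R := F) (hasSubst_translation hm r)).toRingHom
    (substAlgHom (R := F) (hasSubst_translation hm (-r))).toRingHom
    (by
      ext1 A
      simp only [RingHom.comp_apply, AlgHom.toRingHom_eq_coe, RingHom.coe_coe, substAlgHom_apply,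
        RingHom.id_apply]
      have := translation_neg hm (-r) A
      rwa [neg_neg] at this)
    (by
      ext1 A
      simp only [RingHom.comp_apply, AlgHom.toRingHom_eq_coe, RingHom.coe_coe, substAlgHom_apply,
        RingHom.id_apply]
      exact translation_neg hm r A)

theorem translationEquiv_apply (hm : 0 < m) (r : F) (A : Ser F) :
    translationEquiv hm r A = subst (![X 0, X 1 + C r * X 0 ^ m] : Fin 2 → Ser F) A := by
  rw [← substAlgHom_apply (hasSubst_translation hm r)]
  rfl

theorem cf_translation_zero_left (hm : 0 < m) (r : F) (A : Ser F) (k : ℕ) :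
    cf (translationEquiv hm r A) 0 k = cf A 0 k := by
  rw [translationEquiv_apply, cf_translation hm, Finset.sum_eq_single_of_mem (0, k)]
  · simp
  · rw [mem_line one_pos hm]; simp
  · rintro ⟨i, j⟩ hp hne
    rw [mem_line one_pos hm] at hp
    simp only at hp ⊢
    rw [if_neg, mul_zero]
    intro hk
    have := Nat.mul_le_mul_left m hk
    have hi : i = 0 := by omega
    subst hi
    rw [Nat.eq_of_mul_eq_mul_left hm (by omega : m * j = m * k)] at hne
    exact hne rfl

theorem hasYOrder_translation_iff (hm : 0 < m) (r : F) {A : Ser F} {d : ℕ} :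
    HasYOrder (translationEquiv hm r A) d ↔ HasYOrder A d := by
  simp only [HasYOrder, cf_translation_zero_left]

end Translation

/-! ### Special pencils and their stability under the steps. -/

section Special

variable {K : Type*} [Field K]

/-- The intrinsic properties of a special pencil: it is `y`-regular, the coefficients of
`x ^ i * y ^ j` with `i < c` do not depend on `T`, and the coefficient of `x ^ c` is a polynomial
of degree one in `T`. -/
structure Special (S : Ser (RatFunc K)) (c : ℕ) : Prop where
  c_pos : 0 < c
  regular : ∃ N, HasYOrder S N
  const : ∀ i < c, ∀ j, cf S i j ∈ (algebraMap K (RatFunc K)).range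
  vertex : ∃ k₀ k₁ : K, k₁ ≠ 0 ∧
    cf S c 0 = algebraMap K (RatFunc K) k₀ + RatFunc.X * algebraMap K (RatFunc K) k₁

theorem add_X_mul_notMem_range {k₀ k₁ : K} (hk : k₁ ≠ 0) :
    algebraMap K (RatFunc K) k₀ + RatFunc.X * algebraMap K (RatFunc K) k₁ ∉
      (algebraMap K (RatFunc K)).range := by
  rintro ⟨k, h⟩
  rw [RatFunc.algebraMap_eq_C, ← RatFunc.algebraMap_X, ← RatFunc.algebraMap_C,
    ← RatFunc.algebraMap_C, ← RatFunc.algebraMap_C, ← map_mul, ← map_add] at h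
  have h1 := congrArg (Polynomial.coeff · 1) (RatFunc.algebraMap_injective K h)
  simp only [Polynomial.coeff_C_succ, Polynomial.coeff_add, Polynomial.coeff_X_mul,
    Polynomial.coeff_C_zero, zero_add] at h1
  exact hk h1.symm

theorem special_pencil {p U : Ser K} {c : ℕ} (hp : ¬ (X 0 ∣ p)) (hc : 0 < c) (hU : IsUnit U) :
    Special (pencil p U c) c := by
  have hmap : ∀ (A : Ser K) i j, cf (MvPowerSeries.map (algebraMap K (RatFunc K)) A) i j =
      algebraMap K (RatFunc K) (cf A i j) := fun A i j => by simp [cf]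
  have hP : pencil p U c = MvPowerSeries.map (algebraMap K (RatFunc K)) p - X 0 ^ c *
      (C (RatFunc.X : RatFunc K) * MvPowerSeries.map (algebraMap K (RatFunc K)) U) := by
    rw [pencil]; ring
  have hconst : ∀ i < c, ∀ j, cf (pencil p U c) i j = algebraMap K (RatFunc K) (cf p i j) := by
    intro i hi j
    rw [hP, cf_sub, hmap, X0_pow_dvd_iff.1 (Dvd.intro _ rfl) i hi j, sub_zero]
  refine ⟨hc, ?_, fun i hi j => ⟨_, (hconst i hi j).symm⟩, cf p c 0, -cf U 0 0,
    neg_ne_zero.2 (isUnit_iff_cf.1 hU), ?_⟩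
  · rw [← pow_one (X 0 : Ser K), X0_pow_dvd_iff] at hp
    push Not at hp
    obtain ⟨i, hi, j, hj⟩ := hp
    obtain rfl : i = 0 := by omega
    refine exists_hasYOrder (j := j) ?_
    rw [hconst 0 hc]
    simpa using hj
  · have := cf_X0_pow_mul
      (C (RatFunc.X : RatFunc K) * MvPowerSeries.map (algebraMap K (RatFunc K)) U) c 0 0
    rw [add_zero] at this
    rw [hP, cf_sub, hmap, this, cf_C_mul, hmap, map_neg]
    ring

variable {S : Ser (RatFunc K)} {c n m a b : ℕ}

theorem Special.ne_zero (hS : Special S c) : S ≠ 0 := by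
  obtain ⟨N, hN⟩ := hS.regular
  exact hN.ne_zero

theorem Special.vertex_notMem (hS : Special S c) :
    cf S c 0 ∉ (algebraMap K (RatFunc K)).range := by
  obtain ⟨k₀, k₁, hk, h⟩ := hS.vertex
  rw [h]
  exact add_X_mul_notMem_range hk

theorem Special.vertex_ne_zero (hS : Special S c) : cf S c 0 ≠ 0 := fun h0 =>
  hS.vertex_notMem (by rw [h0]; exact zero_mem _)

theorem Special.wOrder_le (hS : Special S c) : wOrder n m S ≤ n * c := by
  simpa using ToricNewton.wOrder_le (n := n) (m := m) hS.vertex_ne_zero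

/-- A vertex on the axis that depends on `T` has abscissa at least `c`. As `(c, 0)` is in the
support, the supporting line must pass through it. -/
theorem Special.isDicritical_iff (hS : Special S c) :
    IsDicritical S n m ↔ IsEdge S n m ∧ wOrder n m S = n * c := by
  refine and_congr_right fun hE => ⟨?_, fun h => ⟨c, ⟨hS.vertex_ne_zero, by simp [h]⟩,
    fun ⟨k, hk⟩ => hS.vertex_notMem ⟨k, hk⟩⟩⟩
  rintro ⟨i, hi, hi'⟩
  have h1 : c ≤ i := by
    by_contra! hlt
    obtain ⟨k, hk⟩ := hS.const i hlt 0
    exact hi' ⟨k, hk⟩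
  have h2 := hi.2
  simp only [mul_zero, add_zero] at h2
  refine le_antisymm hS.wOrder_le ?_
  rw [← h2]
  exact Nat.mul_le_mul_left n h1

/-- Both lines pass through `(c, 0)`. The upper vertex of either edge lies on or above the other
line, which compares the slopes in both directions. -/
theorem Special.dicritical_unique (hS : Special S c) {n' m' : ℕ} (h : IsDicritical S n m)
    (h' : IsDicritical S n' m') : n = n' ∧ m = m' := by
  have key : ∀ {n m n' m' : ℕ}, IsDicritical S n m → IsDicritical S n' m' →
      n' * m ≤ n * m' := by
    intro n m n' m' h h'
    rw [hS.isDicritical_iff] at h h'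
    obtain ⟨⟨hn, hm, hnm, hface⟩, hw⟩ := h
    have hd := (isEdge_iff hn hm hnm hS.ne_zero).1 ⟨hn, hm, hnm, hface⟩
    obtain ⟨-, h1, -⟩ := exists_face_vertices hn hm hnm hS.ne_zero
    have h2 := ToricNewton.wOrder_le (n := n') (m := m') h1.1
    have h3 := h1.2
    rw [h'.2] at h2
    simp only at h2 h3
    rw [hw] at h3
    have hj : 0 < edgeV n m S + n * edgeDegree n m S :=
      Nat.add_pos_right _ (Nat.mul_pos hn hd)
    generalize edgeV n m S + n * edgeDegree n m S = j at *
    generalize edgeU n m S = i at *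
    refine Nat.le_of_mul_le_mul_right ?_ hj
    have h4 := Nat.mul_le_mul_left n h2
    nlinarith
  exact coprime_ratio_unique h.1.n_pos h.1.coprime h'.1.coprime
    (le_antisymm (key h' h) (key h h'))

theorem Special.wOrder_lt (hS : Special S c) (hE : IsEdge S n m) (hnd : ¬ IsDicritical S n m) :
    wOrder n m S < n * c :=
  lt_of_le_of_ne hS.wOrder_le fun h => hnd (hS.isDicritical_iff.2 ⟨hE, h⟩)

theorem exists_map_eq {P : Polynomial (RatFunc K)}
    (hP : ∀ t, P.coeff t ∈ (algebraMap K (RatFunc K)).range) :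
    ∃ p : Polynomial K, p.map (algebraMap K (RatFunc K)) = P :=
  (Polynomial.mem_lifts P).1 ((Polynomial.lifts_iff_coeff_lifts P).2 hP)

/-- A point of the face satisfies `n i ≤ ω < n c`, so it lies in a column whose coefficients are in
`K`. -/
theorem Special.exists_edgePoly_eq_map (hS : Special S c) (hE : IsEdge S n m)
    (hnd : ¬ IsDicritical S n m) :
    ∃ p : Polynomial K, p.map (algebraMap K (RatFunc K)) = edgePoly n m S := by
  refine exists_map_eq fun t => ?_
  rw [coeff_edgePoly]
  split_ifs with ht
  swap
  · exact zero_mem _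
  refine hS.const _ ?_ _
  have h1 := hS.wOrder_lt hE hnd
  rw [(exists_face_vertices hE.n_pos hE.m_pos hE.coprime hS.ne_zero).1] at h1
  obtain ⟨s, hs⟩ := Nat.exists_eq_add_of_le ht
  rw [hs, Nat.add_sub_cancel_left]
  rw [hs] at h1
  refine Nat.lt_of_mul_lt_mul_left (a := n) ?_
  nlinarith [Nat.zero_le (m * edgeV n m S), Nat.zero_le (n * m * t)]

theorem Special.exists_root [IsAlgClosed K] (hS : Special S c) (h : Bezout n m a b)
    (hE : IsEdge S n m) (hnd : ¬ IsDicritical S n m) {G : Ser (RatFunc K)} (hG : G ∣ S)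
    (hd : 0 < edgeDegree n m G) :
    ∃ α : K, (edgePoly n m G).IsRoot (algebraMap K (RatFunc K) α) := by
  obtain ⟨p, hp⟩ := hS.exists_edgePoly_eq_map hE hnd
  have hS0 := hS.ne_zero
  have hG0 : G ≠ 0 := ne_zero_of_dvd_ne_zero hS0 hG
  have hES := edgePoly_ne_zero h.n_pos h.m_pos h.coprime hS0
  have hdvd : edgePoly n m G ∣ edgePoly n m S := by
    obtain ⟨B, rfl⟩ := hG
    exact ⟨_, (edge_mul h hG0 (right_ne_zero_of_mul hS0)).1⟩
  have hsp : (edgePoly n m G).Splits := by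
    refine Polynomial.Splits.of_dvd ?_ hES hdvd
    rw [← hp]
    exact (IsAlgClosed.splits p).map _
  obtain ⟨β, hβ⟩ := hsp.exists_eval_eq_zero (by
    rw [Polynomial.degree_eq_natDegree (edgePoly_ne_zero h.n_pos h.m_pos h.coprime hG0),
      natDegree_edgePoly h.n_pos h.m_pos h.coprime hG0]
    exact_mod_cast hd.ne')
  have hβ' : (p.map (algebraMap K (RatFunc K))).IsRoot β := by
    rw [hp]
    exact Polynomial.IsRoot.dvd hβ hdvd
  have hp0 : p ≠ 0 := by
    rintro rfl
    rw [Polynomial.map_zero] at hp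
    exact hES hp.symm
  obtain ⟨α, rfl⟩ := (IsAlgClosed.splits p).mem_range_of_isRoot hp0 hβ'
  exact ⟨α, hβ⟩

theorem root_ne_zero (h : Bezout n m a b) {G : Ser (RatFunc K)} (hG : G ≠ 0) {α : K}
    (hα : (edgePoly n m G).IsRoot (algebraMap K (RatFunc K) α)) :
    algebraMap K (RatFunc K) α ≠ 0 := by
  intro h0
  rw [h0, Polynomial.IsRoot, ← Polynomial.coeff_zero_eq_eval_zero] at hα
  exact edgePoly_coeff_zero_ne_zero h.n_pos h.m_pos h.coprime hG hα

/-- As a polynomial in `T` over `K[s]` this is linear with leading coefficient the unit `k`, hence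
irreducible in `K[T][s]`; Gauss's lemma carries this to `K(T)[s]`. -/
theorem irreducible_map_add_C {p : Polynomial K} {k : K} (hk : k ≠ 0) (hp : 0 < p.natDegree) :
    Irreducible (p.map (algebraMap K (RatFunc K)) +
      Polynomial.C (RatFunc.X * algebraMap K (RatFunc K) k)) := by
  set f : Polynomial (Polynomial K) := p.map Polynomial.C +
    Polynomial.C (Polynomial.X * Polynomial.C k) with hf
  have h1 : Irreducible f := by
    rw [← MulEquiv.irreducible_iff (Polynomial.Bivariate.swap (R := K))]
    have : Polynomial.Bivariate.swap f =
        Polynomial.C (Polynomial.C k) * Polynomial.X + Polynomial.C p := by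
      rw [hf, map_add, Polynomial.Bivariate.swap_map_C, Polynomial.Bivariate.swap_C,
        Polynomial.map_mul, Polynomial.map_X, Polynomial.map_C]
      ring
    rw [this]
    exact Polynomial.irreducible_C_mul_X_add_C (Polynomial.C_ne_zero.2 hk)
      (IsUnit.isRelPrime_left (Polynomial.isUnit_C.2 (isUnit_iff_ne_zero.2 hk)))
  have h2 : f.natDegree = p.natDegree := by
    rw [hf, Polynomial.natDegree_add_C, Polynomial.natDegree_map_eq_of_injective
      Polynomial.C_injective]
  have h3 := (h1.isPrimitive (by rw [h2]; exact hp.ne')).irreducible_iff_irreducible_map_fraction_map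
    (K := RatFunc K) |>.1 h1
  convert h3 using 1
  rw [hf, Polynomial.map_add, Polynomial.map_map, Polynomial.map_C,
    map_mul (algebraMap (Polynomial K) (RatFunc K)), RatFunc.algebraMap_X,
    RatFunc.algebraMap_C, RatFunc.algebraMap_eq_C]
  congr 2

/-- The constant coefficient of the edge polynomial sits at `(c, 0)` and has degree one in `T`; all
other coefficients come from columns `i < c`, so lie in `K`. -/
theorem Special.dicritical_edge (hS : Special S c) (h : IsDicritical S n m) :
    Irreducible (edgePoly n m S) ∧ edgeV n m S = 0 := by
  have hE := h.1
  have hw := (hS.isDicritical_iff.1 h).2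
  have hS0 := hS.ne_zero
  have hv : edgeV n m S = 0 := Nat.le_zero.1
    (edgeV_le (e := (c, 0)) ⟨hS.vertex_ne_zero, by simp [hw]⟩)
  refine ⟨?_, hv⟩
  have hu : edgeU n m S + m * edgeDegree n m S = c := by
    rw [(exists_face_vertices hE.n_pos hE.m_pos hE.coprime hS0).1, hv] at hw
    exact Nat.eq_of_mul_eq_mul_left hE.n_pos (by linarith)
  obtain ⟨k₀, k₁, hk, hk'⟩ := hS.vertex
  have hd := (isEdge_iff hE.n_pos hE.m_pos hE.coprime hS0).1 hE
  obtain ⟨p, hp⟩ := exists_map_eq (P := edgePoly n m S -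
      Polynomial.C (RatFunc.X * algebraMap K (RatFunc K) k₁)) (fun t => by
    rw [Polynomial.coeff_sub, coeff_edgePoly, Polynomial.coeff_C]
    rcases Nat.eq_zero_or_pos t with rfl | ht
    · rw [if_pos (Nat.zero_le _), if_pos rfl, edgeCoeff, Nat.sub_zero, hu, hv, mul_zero, add_zero,
        hk', add_sub_cancel_right]
      exact ⟨_, rfl⟩
    · rw [if_neg ht.ne', sub_zero]
      split_ifs with htd
      swap
      · exact zero_mem _
      refine hS.const _ ?_ _
      have := Nat.mul_lt_mul_of_pos_left (show edgeDegree n m S - t < edgeDegree n m S by omega)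
        hE.m_pos
      omega)
  have hE' : edgePoly n m S = p.map (algebraMap K (RatFunc K)) +
      Polynomial.C (RatFunc.X * algebraMap K (RatFunc K) k₁) := by rw [hp]; ring
  rw [hE']
  refine irreducible_map_add_C hk ?_
  have h1 := natDegree_edgePoly hE.n_pos hE.m_pos hE.coprime hS0
  rw [hE', Polynomial.natDegree_add_C, Polynomial.natDegree_map] at h1
  rwa [h1]

/-- The coefficient at `(w, k)` receives contributions from columns to the left, with factors in
`K`, and from column `w` only at `(w, k)` itself, with factor `1`. -/
theorem Special.translation (hS : Special S c) (hm : 0 < m) (A : K) :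
    Special (translationEquiv hm (algebraMap K (RatFunc K) A) S) c := by
  have hterm : ∀ (p : ℕ × ℕ) k, p.1 < c → (cf S p.1 p.2 * if k ≤ p.2 then
      algebraMap K (RatFunc K) A ^ (p.2 - k) * (p.2.choose k : RatFunc K) else 0) ∈
        (algebraMap K (RatFunc K)).range := by
    intro p k hp
    refine mul_mem (hS.const _ hp _) ?_
    split_ifs
    · have hA : algebraMap K (RatFunc K) A ∈ (algebraMap K (RatFunc K)).range := ⟨A, rfl⟩
      exact mul_mem (pow_mem hA _) (natCast_mem _ _)
    · exact zero_mem _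
  have hterm' : ∀ (p : ℕ × ℕ) w k, p ∈ line 1 m (w + m * k) → (w < c ∨ w = c ∧ p ≠ (c, k)) →
      (cf S p.1 p.2 * if k ≤ p.2 then
      algebraMap K (RatFunc K) A ^ (p.2 - k) * (p.2.choose k : RatFunc K) else 0) ∈
        (algebraMap K (RatFunc K)).range := by
    intro p w k hp hw
    by_cases hk : k ≤ p.2
    · refine hterm p k ?_
      rw [mem_line one_pos hm, one_mul] at hp
      have h1 := Nat.mul_le_mul_left m hk
      rcases hw with hw | ⟨rfl, hw⟩
      · omega
      · refine lt_of_le_of_ne (by omega) fun h2 => hw ?_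
        have h3 : m * p.2 = m * k := by omega
        exact Prod.ext h2 (Nat.eq_of_mul_eq_mul_left hm h3)
    · rw [if_neg hk, mul_zero]
      exact zero_mem _
  refine ⟨hS.c_pos, ?_, fun i hi j => ?_, ?_⟩
  · obtain ⟨N, hN⟩ := hS.regular
    exact ⟨N, (hasYOrder_translation_iff hm _).2 hN⟩
  · rw [translationEquiv_apply, cf_translation hm]
    exact sum_mem fun p hp => hterm' p i j hp (Or.inl hi)
  · obtain ⟨k₀, k₁, hk, hk'⟩ := hS.vertex
    have hmem : (c, 0) ∈ line 1 m (c + m * 0) := by rw [mem_line one_pos hm]; simp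
    rw [translationEquiv_apply, cf_translation hm, ← Finset.add_sum_erase _ _ hmem]
    have hsum : ∑ p ∈ (line 1 m (c + m * 0)).erase (c, 0), (cf S p.1 p.2 * if 0 ≤ p.2 then
        algebraMap K (RatFunc K) A ^ (p.2 - 0) * (p.2.choose 0 : RatFunc K) else 0) ∈
        (algebraMap K (RatFunc K)).range :=
      sum_mem fun p hp => hterm' p c 0 (Finset.mem_of_mem_erase hp)
        (Or.inr ⟨rfl, Finset.ne_of_mem_erase hp⟩)
    obtain ⟨k, hk''⟩ := hsum
    refine ⟨k₀ + k, k₁, hk, ?_⟩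
    rw [← hk'']
    simp only [hk', le_refl, if_true, Nat.sub_self, pow_zero, Nat.choose_self, Nat.cast_one,
      mul_one, map_add]
    ring

/-- The coefficient of `X^w` in `weighted` involves only columns `i ≤ w / n`. So `T` is absent for
`w < n c`, and for `w = n c` it enters only through the image `z^(ac)` of `x^c`, a unit at `z = y +
α`. Dividing by `X^ω` moves `n c` to `n c - ω`. -/
theorem Special.strictTransform (hS : Special S c) (h : Bezout n m a b)
    (hw : wOrder n m S < n * c) {α : K} (hα : algebraMap K (RatFunc K) α ≠ 0)
    {S' : Ser (RatFunc K)}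
    (hS' : IsStrictTransform n m a b (algebraMap K (RatFunc K) α) S S') :
    Special S' (n * c - wOrder n m S) := by
  have hα' : α ≠ 0 := fun h0 => hα (by rw [h0, map_zero])
  have hcoef : ∀ w, shiftHom (algebraMap K (RatFunc K) α) (Polynomial.X ^ wOrder a b S) *
      PowerSeries.coeff w (iterSer S') = shiftHom (algebraMap K (RatFunc K) α)
        (PowerSeries.coeff (wOrder n m S + w) (weighted (RatFunc K) h S)) := by
    intro w
    rw [isStrictTransform_iff h] at hS'
    rw [← PowerSeries.coeff_map, ← hS', add_comm, PowerSeries.coeff_X_pow_mul, map_mul iterSer,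
      map_pow iterSer, iterSer_shift, ← map_pow PowerSeries.C, PowerSeries.coeff_C_mul,
      map_pow (shiftHom _)]
  have hmap : ∀ p : Polynomial K, shiftHom (algebraMap K (RatFunc K) α)
      (p.map (algebraMap K (RatFunc K))) =
        PowerSeries.map (algebraMap K (RatFunc K)) (shiftHom α p) := by
    intro p
    rw [shiftHom_apply, shiftHom_apply, ← Polynomial.map_taylor, Polynomial.polynomial_map_coe]
  obtain ⟨v, hv⟩ := (isUnit_shiftHom_X_pow hα' (wOrder a b S)).exists_left_inv
  have hv' : PowerSeries.map (algebraMap K (RatFunc K)) v *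
      shiftHom (algebraMap K (RatFunc K) α) (Polynomial.X ^ wOrder a b S) = 1 := by
    have h1 := hmap (Polynomial.X ^ wOrder a b S)
    rw [Polynomial.map_pow, Polynomial.map_X] at h1
    rw [h1, ← map_mul, hv, map_one]
  have hcoef' : ∀ w, PowerSeries.coeff w (iterSer S') =
      PowerSeries.map (algebraMap K (RatFunc K)) v * shiftHom (algebraMap K (RatFunc K) α)
        (PowerSeries.coeff (wOrder n m S + w) (weighted (RatFunc K) h S)) := by
    intro w
    rw [← hcoef, ← mul_assoc, hv', one_mul]
  refine ⟨by omega, ⟨_, hS'.hasYOrder h hα hS.ne_zero⟩, fun w hw' j => ?_, ?_⟩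
  · obtain ⟨p, hp⟩ := exists_map_eq
      (P := PowerSeries.coeff (wOrder n m S + w) (weighted (RatFunc K) h S)) (fun t => by
        by_cases h0 : (PowerSeries.coeff (wOrder n m S + w) (weighted (RatFunc K) h S)).coeff t = 0
        · rw [h0]; exact zero_mem _
        obtain ⟨i, j, h1, rfl, -⟩ := exists_of_coeff_weighted_ne_zero h h0
        rw [← h1, coeff_weighted]
        exact hS.const i (Nat.lt_of_mul_lt_mul_left (a := n) (by omega)) j)
    rw [← coeff_coeff_iterSer, hcoef', ← hp, hmap, ← map_mul, PowerSeries.coeff_map]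
    exact ⟨_, rfl⟩
  · obtain ⟨k₀, k₁, hk, hk'⟩ := hS.vertex
    have hwc : wOrder n m S + (n * c - wOrder n m S) = n * c := by omega
    -- Once `T k₁ z^(ac)` is removed, what remains of this level is defined over `K`.
    obtain ⟨p, hp⟩ := exists_map_eq (P := PowerSeries.coeff (n * c) (weighted (RatFunc K) h S) -
        Polynomial.C RatFunc.X * (Polynomial.monomial (a * c) k₁).map (algebraMap K (RatFunc K)))
      (fun t => by
        rw [Polynomial.coeff_sub, Polynomial.coeff_C_mul, Polynomial.map_monomial,
          Polynomial.coeff_monomial]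
        by_cases ht : a * c = t
        · subst ht
          have h1 := coeff_weighted h S c 0
          rw [mul_zero, mul_zero, add_zero, add_zero, hk'] at h1
          rw [h1, if_pos rfl, add_sub_cancel_right]
          exact ⟨_, rfl⟩
        · rw [if_neg ht, mul_zero, sub_zero]
          by_cases h0 : (PowerSeries.coeff (n * c) (weighted (RatFunc K) h S)).coeff t = 0
          · rw [h0]; exact zero_mem _
          obtain ⟨i, j, h1, rfl, -⟩ := exists_of_coeff_weighted_ne_zero h h0
          rw [← h1, coeff_weighted]
          refine hS.const i (lt_of_le_of_ne
            (Nat.le_of_mul_le_mul_left (by omega : n * i ≤ n * c) h.n_pos) ?_) j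
          rintro rfl
          have h2 : m * j = 0 := by omega
          rw [(Nat.mul_eq_zero.1 h2).resolve_left h.m_pos.ne', mul_zero, add_zero] at ht
          exact ht rfl)
    have hp' : PowerSeries.coeff (n * c) (weighted (RatFunc K) h S) =
        p.map (algebraMap K (RatFunc K)) + Polynomial.C RatFunc.X *
          (Polynomial.monomial (a * c) k₁).map (algebraMap K (RatFunc K)) := by rw [hp]; ring
    refine ⟨PowerSeries.coeff 0 (v * shiftHom α p),
      PowerSeries.coeff 0 (v * shiftHom α (Polynomial.monomial (a * c) k₁)), ?_, ?_⟩
    · have hvu : IsUnit (v * shiftHom α (Polynomial.monomial (a * c) k₁)) := by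
        refine (IsUnit.of_mul_eq_one _ hv).mul ?_
        exact isUnit_shiftHom (by simp [Polynomial.IsRoot, hk, hα'])
      rw [PowerSeries.coeff_zero_eq_constantCoeff_apply]
      exact (PowerSeries.isUnit_iff_constantCoeff.1 hvu).ne_zero
    · rw [← coeff_coeff_iterSer, hcoef', hwc, hp', map_add (shiftHom _),
        map_mul (shiftHom _), hmap, hmap, shiftHom_apply _ (Polynomial.C _), Polynomial.taylor_C,
        Polynomial.coe_C, mul_add, mul_left_comm, ← map_mul (PowerSeries.map _),
        ← map_mul (PowerSeries.map _), map_add (PowerSeries.coeff 0), PowerSeries.coeff_C_mul,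
        PowerSeries.coeff_map, PowerSeries.coeff_map]

end Special

/-! ### Irreducible factors and their edges. -/

section Factors

variable {F : Type*} [Field F] {n m a b : ℕ}

theorem exists_irreducible_dvd {p : Ser F → Prop} (hp : ∀ A B, A ≠ 0 → B ≠ 0 → p (A * B) → p A ∨ p B)
    (hu : ∀ A, IsUnit A → ¬ p A) {A : Ser F} {N : ℕ} (hA : HasYOrder A N) (hpA : p A) :
    ∃ G, Irreducible G ∧ G ∣ A ∧ p G := by
  induction N using Nat.strong_induction_on generalizing A with
  | _ N ih =>
    by_cases hirr : Irreducible A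
    · exact ⟨A, hirr, dvd_rfl, hpA⟩
    rw [irreducible_iff] at hirr
    push Not at hirr
    obtain ⟨B, D, rfl, hB, hD⟩ := hirr fun h => hu A h hpA
    obtain ⟨k, l, hk, hl, rfl⟩ := hA.of_mul
    rw [hk.isUnit_iff] at hB
    rw [hl.isUnit_iff] at hD
    rcases hp B D hk.ne_zero hl.ne_zero hpA with h | h
    · obtain ⟨G, h1, h2, h3⟩ := ih k (by omega) hk h
      exact ⟨G, h1, h2.mul_right D, h3⟩
    · obtain ⟨G, h1, h2, h3⟩ := ih l (by omega) hl h
      exact ⟨G, h1, h2.mul_left B, h3⟩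

theorem exists_irreducible_dvd_of_not_isUnit {A : Ser F} {N : ℕ} (hA : HasYOrder A N)
    (hu : ¬ IsUnit A) : ∃ G, Irreducible G ∧ G ∣ A := by
  obtain ⟨G, h1, h2, -⟩ := exists_irreducible_dvd (p := fun A => ¬ IsUnit A)
    (fun A B _ _ h => by
      by_contra! h'
      exact h (h'.1.mul h'.2)) (fun A hA h => h hA) hA hu
  exact ⟨G, h1, h2⟩

theorem exists_irreducible_dvd_of_edge (h : Bezout n m a b) {A : Ser F} {N : ℕ}
    (hA : HasYOrder A N) (hd : 0 < edgeDegree n m A) :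
    ∃ G, Irreducible G ∧ G ∣ A ∧ 0 < edgeDegree n m G :=
  exists_irreducible_dvd (p := fun A => 0 < edgeDegree n m A)
    (fun A B hA hB hAB => by
      rw [(edge_mul h hA hB).2.1] at hAB
      omega) (fun A hA => by rw [(isUnit_edge h hA).1]; exact lt_irrefl _) hA hd

theorem edgePoly_dvd (h : Bezout n m a b) {A B : Ser F} (hB : B ≠ 0) (hAB : A ∣ B) :
    edgePoly n m A ∣ edgePoly n m B := by
  obtain ⟨D, rfl⟩ := hAB
  rw [(edge_mul h (left_ne_zero_of_mul hB) (right_ne_zero_of_mul hB)).1]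
  exact dvd_mul_right _ _

theorem edgePoly_associated (h : Bezout n m a b) {A B : Ser F} (hB : B ≠ 0) (hAB : Associated A B) :
    Associated (edgePoly n m A) (edgePoly n m B) :=
  associated_of_dvd_dvd (edgePoly_dvd h hB hAB.dvd)
    (edgePoly_dvd h (hAB.ne_zero_iff.2 hB) hAB.symm.dvd)

theorem edgeDegree_le_of_dvd (h : Bezout n m a b) {A B : Ser F} (hB : B ≠ 0) (hAB : A ∣ B) :
    edgeDegree n m A ≤ edgeDegree n m B := by
  obtain ⟨D, rfl⟩ := hAB
  rw [(edge_mul h (left_ne_zero_of_mul hB) (right_ne_zero_of_mul hB)).2.1]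
  omega

/-- Modulo `Q` the two factors may be replaced by Weierstrass remainders. Nonzero remainders have
edge polynomials of degree less than that of `Q`, while the irreducible edge polynomial of `Q` would
divide the product of theirs. -/
theorem prime_of_irreducible_edgePoly (h : Bezout n m a b) {Q : Ser F}
    (hQ : HasYOrder Q (n * edgeDegree n m Q)) (hE : Irreducible (edgePoly n m Q)) : Prime Q := by
  have hd : 0 < edgeDegree n m Q := by
    rw [← natDegree_edgePoly h.n_pos h.m_pos h.coprime hQ.ne_zero]
    exact hE.natDegree_pos
  refine ⟨hQ.ne_zero, by rw [hQ.isUnit_iff]; exact (Nat.mul_pos h.n_pos hd).ne', ?_⟩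
  intro A B hAB
  obtain ⟨A', R, rfl, hR⟩ := hQ.exists_div_rem A
  obtain ⟨B', R', rfl, hR'⟩ := hQ.exists_div_rem B
  have h1 : Q ∣ R * R' := by
    have : R * R' = (A' * Q + R) * (B' * Q + R') - Q * (A' * (B' * Q + R') + R * B') := by ring
    rw [this]
    exact dvd_sub hAB (dvd_mul_right _ _)
  have key : ∀ R : Ser F, R ≠ 0 → (∀ i j, n * edgeDegree n m Q ≤ j → cf R i j = 0) →
      ¬ edgePoly n m Q ∣ edgePoly n m R := by
    intro R hR0 hR hdvd
    have h2 := Polynomial.natDegree_le_of_dvd hdvd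
      (edgePoly_ne_zero h.n_pos h.m_pos h.coprime hR0)
    rw [natDegree_edgePoly h.n_pos h.m_pos h.coprime hQ.ne_zero,
      natDegree_edgePoly h.n_pos h.m_pos h.coprime hR0] at h2
    have h3 := Nat.mul_le_mul_left n h2
    exact (exists_face_vertices h.n_pos h.m_pos h.coprime hR0).2.1.1 (hR _ _ (by omega))
  by_cases hR0 : R = 0
  · exact Or.inl (by rw [hR0, add_zero]; exact dvd_mul_left _ _)
  by_cases hR'0 : R' = 0
  · exact Or.inr (by rw [hR'0, add_zero]; exact dvd_mul_left _ _)
  exfalso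
  have h2 := edgePoly_dvd h (mul_ne_zero hR0 hR'0) h1
  rw [(edge_mul h hR0 hR'0).1] at h2
  rcases hE.prime.dvd_or_dvd h2 with h3 | h3
  · exact key R hR0 hR h3
  · exact key R' hR'0 hR' h3

theorem wOrder_C_mul (n m : ℕ) {r : F} (hr : r ≠ 0) (A : Ser F) :
    wOrder n m (C r * A) = wOrder n m A := by
  have : supp (C r * A) = supp A := by
    ext e
    simp [supp, hr]
  rw [wOrder, wOrder, this]

theorem initialForm_C_mul (n m : ℕ) {r : F} (hr : r ≠ 0) (A : Ser F) :
    initialForm n m (C r * A) = C r * initialForm n m A := by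
  refine cf_ext fun i j => ?_
  rw [cf_C_mul, cf_initialForm, cf_initialForm, wOrder_C_mul n m hr, cf_C_mul]
  split_ifs <;> simp

theorem isUnit_C {r : F} (hr : r ≠ 0) : IsUnit (C r : Ser F) :=
  (isUnit_iff_ne_zero.2 hr).map _

theorem exists_cf_zero_right_ne_zero_of_dvd {G S : Ser F} (hGS : G ∣ S) {c : ℕ}
    (hc : cf S c 0 ≠ 0) : ∃ i, cf G i 0 ≠ 0 := by
  obtain ⟨B, rfl⟩ := hGS
  by_contra! h0
  refine hc ?_
  rw [cf_mul]
  exact Finset.sum_eq_zero fun p _ => Finset.sum_eq_zero fun q hq => by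
    rw [Finset.HasAntidiagonal.mem_antidiagonal] at hq
    rw [show q.1 = 0 by omega, h0, zero_mul]

end Factors

/-! ### Translations and toric steps treated uniformly. -/

section Steps

variable {K : Type*} [Field K] {bz : ℕ → ℕ → ℕ × ℕ}

theorem IsBezoutChoice.bezout (hbz : IsBezoutChoice bz) {n m : ℕ} (hn : 0 < n) (hm : 0 < m)
    (hnm : Nat.Coprime n m) : Bezout n m (bz n m).1 (bz n m).2 :=
  ⟨hn, hm, (hbz n m hn hm hnm).1, (hbz n m hn hm hnm).2.1, (hbz n m hn hm hnm).2.2⟩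

/-- The steps for which strict transforms behave well. -/
def Step.Valid (bz : ℕ → ℕ → ℕ × ℕ) : Step K → Prop
  | .translation m _ => 0 < m
  | .toric n m α => Bezout n m (bz n m).1 (bz n m).2 ∧ algebraMap K (RatFunc K) α ≠ 0

theorem transform_translation_iff {m : ℕ} (hm : 0 < m) {A : K} {P S : Ser (RatFunc K)} :
    Transform bz (.translation m A) P S ↔
      S = translationEquiv hm (algebraMap K (RatFunc K) A) P := by
  rw [translationEquiv_apply]; rfl

theorem transform_toric_iff {n m : ℕ} {α : K} {P S : Ser (RatFunc K)} :
    Transform bz (.toric n m α) P S ↔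
      IsStrictTransform n m (bz n m).1 (bz n m).2 (algebraMap K (RatFunc K) α) P S := Iff.rfl

theorem Step.Valid.exists_transform {s : Step K} (hs : s.Valid bz) (A : Ser (RatFunc K)) :
    ∃ S, Transform bz s A S := by
  cases s with
  | translation m A => exact ⟨_, rfl⟩
  | toric n m α => exact exists_isStrictTransform hs.1 hs.2 A

theorem Step.Valid.transform_unique {s : Step K} (hs : s.Valid bz) {A S T : Ser (RatFunc K)}
    (hS : Transform bz s A S) (hT : Transform bz s A T) : S = T := by
  cases s with
  | translation m A => exact Eq.trans hS (Eq.symm hT)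
  | toric n m α => exact IsStrictTransform.unique hs.2 hS hT

theorem Step.Valid.transform_dvd {s : Step K} (hs : s.Valid bz) {A B S T : Ser (RatFunc K)}
    (hB : B ≠ 0) (hAB : A ∣ B) (hS : Transform bz s A S) (hT : Transform bz s B T) : S ∣ T := by
  cases s with
  | translation m r =>
    rw [transform_translation_iff hs] at hS hT
    rw [hS, hT]
    exact map_dvd _ hAB
  | toric n m α => exact IsStrictTransform.dvd hs.1 hs.2 hB hAB hS hT

theorem Step.Valid.transform_associated {s : Step K} (hs : s.Valid bz)
    {A B S T : Ser (RatFunc K)} (hB : B ≠ 0) (hAB : Associated A B) (hS : Transform bz s A S)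
    (hT : Transform bz s B T) : Associated S T :=
  associated_of_dvd_dvd (hs.transform_dvd hB hAB.dvd hS hT)
    (hs.transform_dvd (hAB.ne_zero_iff.2 hB) hAB.symm.dvd hT hS)

theorem Step.Valid.dvd_of_dvd {s : Step K} (hs : s.Valid bz) {Q H A S : Ser (RatFunc K)} {e : ℕ}
    (hQ : HasYOrder Q (s.vRatio * e)) (hH : HasYOrder H e) (hQH : Transform bz s Q H)
    (hS : Transform bz s A S) (hdvd : H ∣ S) : Q ∣ A := by
  cases s with
  | translation m r =>
    rw [transform_translation_iff hs] at hQH hS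
    rw [hQH, hS] at hdvd
    have := map_dvd (translationEquiv hs (algebraMap K (RatFunc K) r)).symm hdvd
    rwa [RingEquiv.symm_apply_apply, RingEquiv.symm_apply_apply] at this
  | toric n m α => exact IsStrictTransform.dvd_of_dvd hs.1 hs.2 hQ hH hQH hS hdvd

theorem Step.Valid.prime {s : Step K} (hs : s.Valid bz) {Q H : Ser (RatFunc K)} {e : ℕ}
    (hQ : HasYOrder Q (s.vRatio * e)) (hH : HasYOrder H e) (hQH : Transform bz s Q H)
    (hp : Prime H) : Prime Q := by
  cases s with
  | translation m r =>
    rw [transform_translation_iff hs] at hQH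
    rw [hQH] at hp
    exact (MulEquiv.prime_iff
      (translationEquiv hs (algebraMap K (RatFunc K) r)).toMulEquiv).1 hp
  | toric n m α => exact prime_of_strictTransform hs.1 hs.2 hQ hH hQH hp

theorem Step.Valid.not_sq_dvd {s : Step K} (hs : s.Valid bz) {Q H A S : Ser (RatFunc K)}
    (hA : A ≠ 0) (hQH : Transform bz s Q H) (hS : Transform bz s A S) (hH : ¬ H * H ∣ S) :
    ¬ Q * Q ∣ A := by
  cases s with
  | translation m r =>
    rw [transform_translation_iff hs] at hQH hS
    rw [hQH, hS, ← map_mul] at hH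
    exact fun h0 => hH (map_dvd _ h0)
  | toric n m α => exact not_sq_dvd_of_strictTransform hs.1 hs.2 hA hQH hS hH

theorem Step.Valid.exists_lift {s : Step K} (hs : s.Valid bz) {H : Ser (RatFunc K)} {e : ℕ}
    (hH : HasYOrder H e) :
    ∃ Q S, HasYOrder Q (s.vRatio * e) ∧ Transform bz s Q S ∧ Associated S H := by
  cases s with
  | translation m r =>
    refine ⟨(translationEquiv hs (algebraMap K (RatFunc K) r)).symm H, H, ?_, ?_, .refl _⟩
    · change HasYOrder _ (1 * e)
      rw [one_mul, ← hasYOrder_translation_iff hs (algebraMap K (RatFunc K) r),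
        RingEquiv.apply_symm_apply]
      exact hH
    · rw [transform_translation_iff hs, RingEquiv.apply_symm_apply]
  | toric n m α => exact exists_isStrictTransform_associated hs.1 hs.2 hH

theorem Step.Valid.transform_C_mul {s : Step K} (hs : s.Valid bz) {A S : Ser (RatFunc K)}
    {r : RatFunc K} (hr : r ≠ 0) (hS : Transform bz s A S) :
    Transform bz s (C r * A) (C r * S) := by
  cases s with
  | translation m q =>
    have h1 := hasSubst_translation hs (algebraMap K (RatFunc K) q)
    change _ = subst _ _
    rw [subst_mul h1, subst_C, show S = _ from hS]
  | toric n m α =>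
    rw [transform_toric_iff] at hS ⊢
    have h1 := hasSubst_toric hs.1.n_pos hs.1.m_pos (bz n m).1 (bz n m).2
      (algebraMap K (RatFunc K) α)
    rw [IsStrictTransform, wOrder_C_mul _ _ hr, wOrder_C_mul _ _ hr, subst_mul h1, subst_C,
      ← show _ = _ from hS, mul_left_comm]

theorem Transforms.C_mul {path : List (Step K)} (hs : ∀ s ∈ path, s.Valid bz)
    {A S : Ser (RatFunc K)} {r : RatFunc K} (hr : r ≠ 0) (hS : Transforms bz path A S) :
    Transforms bz path (C r * A) (C r * S) := by
  induction path generalizing A with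
  | nil => exact congrArg (C r * ·) hS
  | cons s σ ih =>
    obtain ⟨A₁, h1, h2⟩ := hS
    exact ⟨_, (hs s (by simp)).transform_C_mul hr h1, ih (fun t ht => hs t (by simp [ht])) h2⟩

theorem Transforms.unique {path : List (Step K)} (hs : ∀ s ∈ path, s.Valid bz)
    {A S T : Ser (RatFunc K)} (hS : Transforms bz path A S) (hT : Transforms bz path A T) :
    S = T := by
  induction path generalizing A with
  | nil => exact Eq.trans hS (Eq.symm hT)
  | cons s σ ih =>
    obtain ⟨A₁, h1, h2⟩ := hS
    obtain ⟨A₂, h3, h4⟩ := hT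
    obtain rfl := (hs s (by simp)).transform_unique h1 h3
    exact ih (fun t ht => hs t (by simp [ht])) h2 h4

end Steps

/-! ### Series that require a translation. -/

section NeedsTranslation

variable {K : Type*} [Field K] {bz : ℕ → ℕ → ℕ × ℕ} {S : Ser (RatFunc K)} {c m : ℕ} {A : K}

/-- The shape of a series that needs a preliminary translation. -/
theorem NeedsTranslation.shape {a b : ℕ} (h : Bezout 1 m a b) (hS : S ≠ 0)
    (hT : NeedsTranslation S m A) : ∃ (β : RatFunc K) (e : ℕ), 0 < e ∧ β ≠ 0 ∧
      algebraMap K (RatFunc K) A ≠ 0 ∧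
      edgePoly 1 m S = Polynomial.C β *
        (Polynomial.X - Polynomial.C (algebraMap K (RatFunc K) A)) ^ e ∧
      edgeDegree 1 m S = e ∧ edgeU 1 m S = 0 ∧ edgeV 1 m S = 0 ∧ wOrder 1 m S = m * e ∧
      HasYOrder S e ∧ cf S (m * e) 0 ≠ 0 := by
  obtain ⟨hE, β, e, hβ, hin⟩ := hT
  obtain ⟨hr, hEp, hd, hu, hv⟩ := edge_of_initialForm_binomial h hE hS hβ hin
  obtain ⟨hw, h1, h2⟩ := exists_face_vertices h.n_pos h.m_pos h.coprime hS
  have he := (isEdge_iff h.n_pos h.m_pos h.coprime hS).1 hE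
  rw [hd, hu, hv] at hw h1 h2
  simp only [zero_add, mul_zero, one_mul] at hw h1 h2
  refine ⟨β, e, hd ▸ he, hβ, hr, hEp, hd, hu, hv, hw, ⟨h1.1, fun j hj => ?_⟩, h2.1⟩
  by_contra hne
  have := wOrder_le (n := 1) (m := m) hne
  rw [hw, mul_zero, zero_add] at this
  exact absurd (Nat.le_of_mul_le_mul_left this h.m_pos) (by omega)

theorem NeedsTranslation.edge_unique (hbz : IsBezoutChoice bz) (hS : S ≠ 0)
    (hT : NeedsTranslation S m A) {n' m' : ℕ} (hE : IsEdge S n' m') : 1 = n' ∧ m = m' := by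
  have h := hbz.bezout hT.1.n_pos hT.1.m_pos hT.1.coprime
  obtain ⟨β, e, he, -, -, -, hd, -, -, -, hN, -⟩ := hT.shape h hS
  exact ToricNewton.edge_unique h (by rwa [one_mul]) hd.ge hE

theorem NeedsTranslation.unique (hbz : IsBezoutChoice bz) (hS : S ≠ 0)
    (hT : NeedsTranslation S m A) {m' : ℕ} {A' : K} (hT' : NeedsTranslation S m' A') :
    m = m' ∧ A = A' := by
  obtain ⟨-, rfl⟩ := hT.edge_unique hbz hS hT'.1
  refine ⟨rfl, ?_⟩
  have h := hbz.bezout hT.1.n_pos hT.1.m_pos hT.1.coprime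
  obtain ⟨β, e, he, hβ, -, hE, -⟩ := hT.shape h hS
  obtain ⟨β', e', he', hβ', -, hE', -⟩ := hT'.shape h hS
  have h1 := congrArg (Polynomial.eval (algebraMap K (RatFunc K) A)) (hE.symm.trans hE')
  simp only [Polynomial.eval_mul, Polynomial.eval_C, Polynomial.eval_pow, Polynomial.eval_sub,
    Polynomial.eval_X, sub_self, zero_pow he.ne', mul_zero] at h1
  have h2 := pow_eq_zero_iff he'.ne' |>.1 ((mul_eq_zero.1 h1.symm).resolve_left hβ')
  exact (algebraMap K (RatFunc K)).injective (sub_eq_zero.1 h2)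

/-- If the edge ended at `(c, 0)`, the coefficient there would be `β (-A)^e`. But `β` is the
coefficient of `y^e`, in column `0 < c`, so this would lie in `K`. -/
theorem NeedsTranslation.wOrder_lt (hbz : IsBezoutChoice bz) (hS : Special S c)
    (hT : NeedsTranslation S m A) : wOrder 1 m S < c := by
  have h := hbz.bezout hT.1.n_pos hT.1.m_pos hT.1.coprime
  obtain ⟨β, e, he, hβ, -, hE, hd, hu, hv, hw, hN, h0⟩ := hT.shape h hS.ne_zero
  have h1 := hS.wOrder_le (n := 1) (m := m)
  rw [one_mul] at h1
  refine lt_of_le_of_ne h1 fun hc => hS.vertex_notMem ?_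
  have h2 := congrArg (Polynomial.coeff · 0) hE
  have h3 := congrArg (Polynomial.coeff · e) hE
  simp only [coeff_edgePoly, Nat.zero_le, if_true, hd, le_refl, edgeCoeff, hu, hv, Nat.sub_self,
    Nat.sub_zero, mul_zero, zero_add, add_zero, one_mul, ← hw, hc, Polynomial.coeff_C_mul] at h2 h3
  have h4 : ((Polynomial.X - Polynomial.C (algebraMap K (RatFunc K) A)) ^ e).coeff e = 1 := by
    have := (Polynomial.monic_X_sub_C (algebraMap K (RatFunc K) A)).pow e
    rw [Polynomial.Monic, Polynomial.leadingCoeff, Polynomial.natDegree_pow,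
      Polynomial.natDegree_X_sub_C, mul_one] at this
    exact this
  rw [h4, mul_one] at h3
  rw [h2, ← h3]
  refine mul_mem (hS.const 0 hS.c_pos e) ?_
  rw [Polynomial.coeff_zero_eq_eval_zero]
  simp only [Polynomial.eval_pow, Polynomial.eval_sub, Polynomial.eval_X, Polynomial.eval_C,
    zero_sub]
  have hA : algebraMap K (RatFunc K) A ∈ (algebraMap K (RatFunc K)).range := ⟨A, rfl⟩
  exact pow_mem (neg_mem hA) e

theorem NeedsTranslation.not_isDicritical (hbz : IsBezoutChoice bz) (hS : Special S c)
    (hT : NeedsTranslation S m A) {n' m' : ℕ} : ¬ IsDicritical S n' m' := by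
  intro hd
  obtain ⟨rfl, rfl⟩ := hT.edge_unique hbz hS.ne_zero hd.1
  have h1 := (hS.isDicritical_iff.1 hd).2
  have h2 := hT.wOrder_lt hbz hS
  omega

/-- After the translation, the series on `y = 0` is `S(x, A x^m)`; its term of degree `ω` is the
initial form at `(1, A)`, which vanishes. This measures the progress made by a translation. -/
theorem NeedsTranslation.cf_translation_eq_zero (hbz : IsBezoutChoice bz) (hS : S ≠ 0)
    (hT : NeedsTranslation S m A) {i : ℕ} (hi : i ≤ wOrder 1 m S) :
    cf (translationEquiv hT.1.m_pos (algebraMap K (RatFunc K) A) S) i 0 = 0 := by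
  have h := hbz.bezout hT.1.n_pos hT.1.m_pos hT.1.coprime
  rw [translationEquiv_apply, cf_translation hT.1.m_pos]
  simp only [Nat.zero_le, if_true, Nat.sub_zero, Nat.choose_zero_right, Nat.cast_one, mul_one,
    mul_zero, add_zero]
  rcases hi.lt_or_eq with hi | rfl
  · refine Finset.sum_eq_zero fun p hp => ?_
    rw [mem_line one_pos hT.1.m_pos] at hp
    by_contra hne
    have := wOrder_le (n := 1) (m := m) (left_ne_zero_of_mul hne)
    omega
  · obtain ⟨β, e, he, hβ, hr, hE, -⟩ := hT.shape h hS
    have h1 : (leadPoly h S).eval (algebraMap K (RatFunc K) A) = 0 := by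
      rw [leadPoly_eq h hS, hE]
      simp [he.ne']
    rw [leadPoly, coeff_weighted_eq_sum, Polynomial.eval_finsetSum] at h1
    simp only [Polynomial.eval_monomial] at h1
    have h2 : algebraMap K (RatFunc K) A ^ ((bz 1 m).1 * wOrder 1 m S) *
        ∑ p ∈ line 1 m (wOrder 1 m S), cf S p.1 p.2 * algebraMap K (RatFunc K) A ^ p.2 = 0 := by
      rw [← h1, Finset.mul_sum]
      refine Finset.sum_congr rfl fun p hp => ?_
      rw [mem_line one_pos hT.1.m_pos] at hp
      have h3 := h.rel
      rw [mul_one] at h3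
      rw [h3, ← hp]
      ring
    exact (mul_eq_zero.1 h2).resolve_left (pow_ne_zero _ hr)

end NeedsTranslation

/-! ### Factors attached to dicritical edges along paths. -/

section Paths

variable {K : Type*} [Field K] {bz : ℕ → ℕ → ℕ × ℕ}

theorem Allowed.valid (hbz : IsBezoutChoice bz) {S : Ser (RatFunc K)} (hS : S ≠ 0) {s : Step K}
    (hs : Allowed S s) : s.Valid bz := by
  cases s with
  | translation m A => exact hs.1.m_pos
  | toric n m α =>
    have h := hbz.bezout hs.2.1.n_pos hs.2.1.m_pos hs.2.1.coprime
    exact ⟨h, root_ne_zero h hS hs.2.2.2⟩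

theorem Special.transform (hbz : IsBezoutChoice bz) {S S₁ : Ser (RatFunc K)} {c : ℕ}
    (hS : Special S c) {s : Step K} (hs : Allowed S s) (hS₁ : Transform bz s S S₁) :
    ∃ c₁, Special S₁ c₁ := by
  have hv := hs.valid hbz hS.ne_zero
  cases s with
  | translation m A =>
    rw [transform_translation_iff hv] at hS₁
    exact ⟨c, hS₁ ▸ hS.translation hv A⟩
  | toric n m α =>
    exact ⟨_, hS.strictTransform hv.1 (hS.wOrder_lt hs.2.1 hs.2.2.1) hv.2 hS₁⟩

theorem Reaches.unique (hbz : IsBezoutChoice bz) {path : List (Step K)}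
    {S S' S'' : Ser (RatFunc K)} {c : ℕ} (hS : Special S c) (h' : Reaches bz path S S')
    (h'' : Reaches bz path S S'') : S' = S'' := by
  induction path generalizing S c with
  | nil => exact Eq.trans h' (Eq.symm h'')
  | cons s σ ih =>
    obtain ⟨P, h1, h2, h3⟩ := h'
    obtain ⟨P', -, h2', h3'⟩ := h''
    obtain rfl := (h1.valid hbz hS.ne_zero).transform_unique h2 h2'
    obtain ⟨c₁, hc⟩ := hS.transform hbz h1 h2
    exact ih hc h3 h3'

theorem Reaches.valid (hbz : IsBezoutChoice bz) {path : List (Step K)}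
    {S S' : Ser (RatFunc K)} {c : ℕ} (hS : Special S c) (h' : Reaches bz path S S') :
    (∀ s ∈ path, s.Valid bz) ∧ ∃ c', Special S' c' := by
  induction path generalizing S c with
  | nil => exact ⟨by simp, c, by rwa [show S' = S from h']⟩
  | cons s σ ih =>
    obtain ⟨P, h1, h2, h3⟩ := h'
    obtain ⟨c₁, hc⟩ := hS.transform hbz h1 h2
    obtain ⟨h4, h5⟩ := ih hc h3
    refine ⟨fun t ht => ?_, h5⟩
    rcases List.mem_cons.1 ht with rfl | ht
    · exact h1.valid hbz hS.ne_zero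
    · exact h4 t ht

/-- `Attached bz path S n m Q`: the strict transforms of the factor `Q` of `S` along the path end
in a prime factor whose only edge is `(n, m)` and which carries all of `q_ℓ`. -/
def Attached (bz : ℕ → ℕ → ℕ × ℕ) :
    List (Step K) → Ser (RatFunc K) → ℕ → ℕ → Ser (RatFunc K) → Prop
  | [], S, n, m, Q => Prime Q ∧ Q ∣ S ∧ ¬ Q * Q ∣ S ∧ HasYOrder Q (n * edgeDegree n m S) ∧
      Associated (edgePoly n m Q) (edgePoly n m S)
  | s :: σ, S, n, m, Q => ∃ S₁ Q₁ e, Transform bz s S S₁ ∧ Transform bz s Q Q₁ ∧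
      HasYOrder Q (s.vRatio * e) ∧ HasYOrder Q₁ e ∧ Attached bz σ S₁ n m Q₁

variable {path : List (Step K)} {S S' Q : Ser (RatFunc K)} {c n m : ℕ}

theorem Attached.of_associated (hbz : IsBezoutChoice bz) (hS : Special S c)
    (hr : Reaches bz path S S') (hd : IsDicritical S' n m) (hQ : Attached bz path S n m Q)
    {R : Ser (RatFunc K)} (hQR : Associated Q R) : Attached bz path S n m R := by
  induction path generalizing S c Q R with
  | nil =>
    obtain ⟨h1, h2, h3, h4, h5⟩ := hQ
    have hE : IsEdge S n m := by
      have := hd.1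
      rwa [show S' = S from hr] at this
    have h := hbz.bezout hE.n_pos hE.m_pos hE.coprime
    refine ⟨hQR.prime h1, hQR.dvd_iff_dvd_left.1 h2,
      fun h0 => h3 ((hQR.mul_mul hQR).dvd_iff_dvd_left.2 h0), h4.associated hQR,
      (edgePoly_associated h h4.ne_zero hQR.symm).trans h5⟩
  | cons s σ ih =>
    obtain ⟨P, a1, a2, a3⟩ := hr
    obtain ⟨S₁, Q₁, e, h1, h2, h3, h4, h5⟩ := hQ
    have hv := a1.valid hbz hS.ne_zero
    obtain rfl := hv.transform_unique a2 h1
    obtain ⟨c₁, hc⟩ := hS.transform hbz a1 a2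
    obtain ⟨R₁, hR₁⟩ := hv.exists_transform R
    have h6 := hv.transform_associated (hQR.ne_zero_iff.1 h3.ne_zero) hQR h2 hR₁
    exact ⟨_, R₁, e, h1, hR₁, h3.associated hQR, h4.associated h6, ih hc a3 h5 h6⟩

theorem Attached.factor (hbz : IsBezoutChoice bz) (hS : Special S c)
    (hr : Reaches bz path S S') (hQ : Attached bz path S n m Q) :
    Prime Q ∧ Q ∣ S ∧ ¬ Q * Q ∣ S ∧
      HasYOrder Q (edgeDegree n m S' * ((path.map Step.vRatio).prod * n)) ∧
      ∃ Q', Transforms bz path Q Q' ∧ Attached bz [] S' n m Q' := by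
  induction path generalizing S c Q with
  | nil =>
    obtain rfl : S' = S := hr
    obtain ⟨h1, h2, h3, h4, h5⟩ := hQ
    refine ⟨h1, h2, h3, ?_, Q, rfl, h1, h2, h3, h4, h5⟩
    rwa [List.map_nil, List.prod_nil, one_mul, mul_comm]
  | cons s σ ih =>
    obtain ⟨P, a1, a2, a3⟩ := hr
    obtain ⟨S₁, Q₁, e, h1, h2, h3, h4, h5⟩ := hQ
    have hv := a1.valid hbz hS.ne_zero
    obtain rfl := hv.transform_unique a2 h1
    obtain ⟨c₁, hc⟩ := hS.transform hbz a1 a2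
    obtain ⟨g1, g2, g3, g4, Q', g5, g6⟩ := ih hc a3 h5
    refine ⟨hv.prime h3 h4 h2 g1, hv.dvd_of_dvd h3 h4 h2 h1 g2,
      hv.not_sq_dvd hS.ne_zero h2 h1 g3, ?_, Q', ⟨Q₁, h2, g5⟩, g6⟩
    rw [h4.unique g4] at h3
    rw [List.map_cons, List.prod_cons]
    convert h3 using 1
    ring

/-- At the end of the path, two non-associated primes that each carry the whole edge polynomial
would have a product dividing `S` with twice its edge degree. Descent transports the conclusion
back. -/
theorem Attached.unique_factor (hbz : IsBezoutChoice bz) (hS : Special S c)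
    (hr : Reaches bz path S S') (hd : IsDicritical S' n m) (hQ : Attached bz path S n m Q)
    {R : Ser (RatFunc K)} (hR : Attached bz path S n m R) : Associated Q R := by
  induction path generalizing S c Q R with
  | nil =>
    obtain ⟨h1, h2, h3, h4, h5⟩ := hQ
    obtain ⟨g1, g2, g3, g4, g5⟩ := hR
    have hE : IsEdge S n m := by
      have := hd.1
      rwa [show S' = S from hr] at this
    have h := hbz.bezout hE.n_pos hE.m_pos hE.coprime
    by_contra hne
    obtain ⟨D, rfl⟩ := h2
    have hRD : R ∣ D := (g1.dvd_or_dvd g2).resolve_left fun h0 =>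
      hne (h1.irreducible.associated_of_dvd g1.irreducible (by
        exact (g1.irreducible.dvd_symm h1.irreducible h0)))
    have h6 := edgeDegree_le_of_dvd h hS.ne_zero (mul_dvd_mul_left Q hRD)
    rw [(edge_mul h h4.ne_zero g4.ne_zero).2.1] at h6
    have hd' : ∀ T : Ser (RatFunc K), T ≠ 0 → Associated (edgePoly n m T) (edgePoly n m (Q * D)) →
        edgeDegree n m T = edgeDegree n m (Q * D) := fun T hT hTS => by
      rw [← natDegree_edgePoly h.n_pos h.m_pos h.coprime hT,
        ← natDegree_edgePoly h.n_pos h.m_pos h.coprime hS.ne_zero]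
      exact Polynomial.natDegree_eq_of_degree_eq (Polynomial.degree_eq_degree_of_associated hTS)
    rw [hd' Q h4.ne_zero h5, hd' R g4.ne_zero g5] at h6
    have := (isEdge_iff h.n_pos h.m_pos h.coprime hS.ne_zero).1 hE
    omega
  | cons s σ ih =>
    obtain ⟨P, a1, a2, a3⟩ := hr
    obtain ⟨S₁, Q₁, e, h1, h2, h3, h4, h5⟩ := hQ
    obtain ⟨S₂, R₁, e', g1, g2, g3, g4, g5⟩ := hR
    have hv := a1.valid hbz hS.ne_zero
    obtain rfl := hv.transform_unique a2 h1
    obtain rfl := hv.transform_unique a2 g1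
    obtain ⟨c₁, hc⟩ := hS.transform hbz a1 a2
    have h6 := ih hc a3 h5 g5
    exact associated_of_dvd_dvd (hv.dvd_of_dvd h3 h4 h2 g2 h6.dvd)
      (hv.dvd_of_dvd g3 g4 g2 h2 h6.symm.dvd)

/-- A factor that continues through a toric step has the edge of that step as its only edge. It
would have to be the dicritical edge, which the process does not use for steps. -/
theorem Attached.not_cons (hbz : IsBezoutChoice bz) (hS : Special S c) (hd : IsDicritical S n m)
    (hQ : Attached bz [] S n m Q) {s : Step K} (hs : Allowed S s) {σ : List (Step K)} {n' m' : ℕ}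
    (hQ' : Attached bz (s :: σ) S n' m' Q) : False := by
  cases s with
  | translation l A => exact NeedsTranslation.not_isDicritical hbz hS hs hd
  | toric k l α =>
    obtain ⟨S₁, Q₁, e, h1, h2, h3, h4, h5⟩ := hQ'
    obtain ⟨-, -, -, g4, g5⟩ := hQ
    have hv := hs.valid hbz hS.ne_zero
    have h := hbz.bezout hd.1.n_pos hd.1.m_pos hd.1.coprime
    have h6 := (IsStrictTransform.pow_dvd hv.1 hv.2 h3.ne_zero h2 h4).2
    have hE : IsEdge Q n m := by
      rw [isEdge_iff h.n_pos h.m_pos h.coprime h3.ne_zero,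
        ← natDegree_edgePoly h.n_pos h.m_pos h.coprime h3.ne_zero,
        Polynomial.natDegree_eq_of_degree_eq (Polynomial.degree_eq_degree_of_associated g5),
        natDegree_edgePoly h.n_pos h.m_pos h.coprime hS.ne_zero]
      exact (isEdge_iff h.n_pos h.m_pos h.coprime hS.ne_zero).1 hd.1
    obtain ⟨rfl, rfl⟩ := edge_unique hv.1 h3 h6 hE
    exact hs.2.2.1 hd

/-- The orders `n e` and `e` force `Q` to have a single edge, with polynomial a constant times `(s -
α)^e`. Any other edge or root would give a unit as transform. -/
theorem toric_unique {a b a' b' n' m' e e' : ℕ} (h : Bezout n m a b) (h' : Bezout n' m' a' b')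
    {α α' : K} (hα : algebraMap K (RatFunc K) α ≠ 0) (hα' : algebraMap K (RatFunc K) α' ≠ 0)
    {Q₁ Q₂ : Ser (RatFunc K)} (hQ₁ : IsStrictTransform n m a b (algebraMap K (RatFunc K) α) Q Q₁)
    (hQ₂ : IsStrictTransform n' m' a' b' (algebraMap K (RatFunc K) α') Q Q₂)
    (he : HasYOrder Q (n * e)) (he₁ : HasYOrder Q₁ e) (he₂ : HasYOrder Q₂ e') (he0 : 0 < e') :
    n = n' ∧ m = m' ∧ α = α' := by
  obtain ⟨h1, h2⟩ := hQ₁.pow_dvd h hα he.ne_zero he₁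
  obtain ⟨h3, h4⟩ := hQ₂.pow_dvd h' hα' he.ne_zero he₂
  have hE : IsEdge Q n' m' :=
    (isEdge_iff h'.n_pos h'.m_pos h'.coprime he.ne_zero).2 (he0.trans_le h4)
  obtain ⟨rfl, rfl⟩ := edge_unique h he h2 hE
  refine ⟨rfl, rfl, ?_⟩
  obtain ⟨hd, -, -⟩ := edge_of_hasYOrder h he h2
  obtain ⟨q, hq⟩ := h1
  have hE0 := edgePoly_ne_zero h.n_pos h.m_pos h.coprime he.ne_zero
  have hq0 : q ≠ 0 := by
    rintro rfl
    rw [mul_zero] at hq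
    exact hE0 hq
  have hqd : q.natDegree = 0 := by
    have h5 := natDegree_edgePoly h.n_pos h.m_pos h.coprime he.ne_zero
    rw [hq, Polynomial.natDegree_mul (pow_ne_zero _ (Polynomial.X_sub_C_ne_zero _)) hq0,
      Polynomial.natDegree_pow, Polynomial.natDegree_X_sub_C, mul_one, hd] at h5
    omega
  rw [Polynomial.eq_C_of_natDegree_eq_zero hqd] at hq hq0
  have h6 := (dvd_pow_self _ he0.ne').trans h3
  rw [Polynomial.dvd_iff_isRoot, hq, Polynomial.IsRoot, Polynomial.eval_mul, Polynomial.eval_C,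
    Polynomial.eval_pow, Polynomial.eval_sub, Polynomial.eval_X, Polynomial.eval_C] at h6
  have h7 := (mul_eq_zero.1 h6).resolve_right (Polynomial.C_ne_zero.1 hq0)
  exact (algebraMap K (RatFunc K)).injective (sub_eq_zero.1 (pow_eq_zero_iff
    (fun h0 => by rw [h0, pow_zero] at h7; exact one_ne_zero h7) |>.1 h7)).symm

theorem Attached.path_unique (hbz : IsBezoutChoice bz) {path' : List (Step K)}
    {S'' : Ser (RatFunc K)} {n' m' : ℕ} (hS : Special S c) (hr : Reaches bz path S S')
    (hd : IsDicritical S' n m) (hQ : Attached bz path S n m Q) (hr' : Reaches bz path' S S'')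
    (hd' : IsDicritical S'' n' m') (hQ' : Attached bz path' S n' m' Q) :
    path = path' ∧ n = n' ∧ m = m' := by
  induction path generalizing S c Q path' with
  | nil =>
    obtain rfl : S' = S := hr
    cases path' with
    | nil =>
      obtain rfl : S'' = S' := hr'
      exact ⟨rfl, hS.dicritical_unique hd hd'⟩
    | cons s σ =>
      obtain ⟨P, a1, -, -⟩ := hr'
      exact (Attached.not_cons hbz hS hd hQ a1 hQ').elim
  | cons s σ ih =>
    cases path' with
    | nil =>
      obtain rfl : S'' = S := hr'
      obtain ⟨P, a1, -, -⟩ := hr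
      exact (Attached.not_cons hbz hS hd' hQ' a1 hQ).elim
    | cons s' σ' =>
      obtain ⟨P, a1, a2, a3⟩ := hr
      obtain ⟨P', b1, b2, b3⟩ := hr'
      obtain ⟨S₁, Q₁, e, h1, h2, h3, h4, h5⟩ := hQ
      obtain ⟨S₂, Q₂, e', g1, g2, g3, g4, g5⟩ := hQ'
      have hv := a1.valid hbz hS.ne_zero
      have hv' := b1.valid hbz hS.ne_zero
      obtain rfl := hv.transform_unique a2 h1
      obtain rfl := hv'.transform_unique b2 g1
      obtain ⟨c₁, hc⟩ := hS.transform hbz a1 a2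
      obtain ⟨c₂, hc'⟩ := hS.transform hbz b1 b2
      have hss : s = s' := by
        cases s with
        | translation k A =>
          cases s' with
          | translation k' A' =>
            obtain ⟨rfl, rfl⟩ := NeedsTranslation.unique hbz hS.ne_zero a1 b1
            rfl
          | toric k' l' α' => exact absurd ⟨k, A, a1⟩ b1.1
        | toric k l α =>
          cases s' with
          | translation k' A' => exact absurd ⟨k', A', b1⟩ a1.1
          | toric k' l' α' =>
            have he' : 0 < e' := Nat.pos_of_ne_zero fun h0 =>
              (Attached.factor hbz hc' b3 g5).1.not_isUnit (g4.isUnit_iff.2 h0)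
            obtain ⟨rfl, rfl, rfl⟩ := toric_unique hv.1 hv'.1 hv.2 hv'.2 h2 g2 h3 h4 g4 he'
            rfl
      subst hss
      obtain rfl := hv.transform_unique a2 b2
      obtain rfl := hv.transform_unique h2 g2
      obtain ⟨rfl, h6⟩ := ih hc a3 h5 b3 g5
      exact ⟨rfl, h6⟩

/-- The edge polynomial of `G` divides an irreducible one and is not a unit, so `G` takes all of it.
The condition on the weighted order puts the upper end of the edge at `(0, N)`, so `u = 0`, while `v
= 0` is inherited from `S`. -/
theorem Special.attached_of_first_edge {a b : ℕ} (h : Bezout n m a b) (hS : Special S c)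
    (hd : IsDicritical S n m) {G : Ser (RatFunc K)} (hG : G ∣ S) {N : ℕ} (hN : HasYOrder G N)
    (hw : wOrder n m G = m * N) (hdeg : 0 < edgeDegree n m G) : Attached bz [] S n m G := by
  obtain ⟨hirr, hv⟩ := hS.dicritical_edge hd
  have hS0 := hS.ne_zero
  have hE := edgePoly_dvd h hS0 hG
  have hass : Associated (edgePoly n m G) (edgePoly n m S) := by
    refine ((hirr.dvd_iff.1 hE).resolve_left fun hu => ?_).symm
    have := Polynomial.natDegree_eq_zero_of_isUnit hu
    rw [natDegree_edgePoly h.n_pos h.m_pos h.coprime hN.ne_zero] at this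
    omega
  have hdd : edgeDegree n m G = edgeDegree n m S := by
    rw [← natDegree_edgePoly h.n_pos h.m_pos h.coprime hN.ne_zero,
      ← natDegree_edgePoly h.n_pos h.m_pos h.coprime hS0]
    exact Polynomial.natDegree_eq_of_degree_eq (Polynomial.degree_eq_degree_of_associated hass)
  have hv' : edgeV n m G = 0 := by
    obtain ⟨D, rfl⟩ := hG
    rw [(edge_mul h hN.ne_zero (right_ne_zero_of_mul hS0)).2.2.2] at hv
    omega
  have hu' : edgeU n m G = 0 := Nat.le_zero.1 (edgeU_le (e := (0, N)) ⟨hN.1, by simp [hw]⟩)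
  have hNd : N = n * edgeDegree n m G := by
    have h1 := (exists_face_vertices h.n_pos h.m_pos h.coprime hN.ne_zero).1
    rw [hw, hu', hv', mul_zero, mul_zero, zero_add, zero_add] at h1
    refine Nat.eq_of_mul_eq_mul_left h.m_pos (h1.trans ?_)
    ring
  rw [hNd] at hN
  refine ⟨prime_of_irreducible_edgePoly h hN (hass.symm.irreducible hirr), hG, fun hsq => ?_,
    hdd ▸ hN, hass⟩
  have h2 := edgeDegree_le_of_dvd h hS0 hsq
  rw [(edge_mul h hN.ne_zero hN.ne_zero).2.1] at h2
  omega

theorem Special.exists_first_edge (hS : Special S c) {G : Ser (RatFunc K)} (hG : G ∣ S)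
    (hu : ¬ IsUnit G) : ∃ N n m, HasYOrder G N ∧ IsEdge G n m ∧ wOrder n m G = m * N := by
  obtain ⟨M, hM⟩ := hS.regular
  obtain ⟨N, -, hN⟩ := hM.of_dvd hG
  obtain ⟨i, hi⟩ := exists_cf_zero_right_ne_zero_of_dvd hG hS.vertex_ne_zero
  rw [hN.isUnit_iff] at hu
  obtain ⟨n, m, h1, h2⟩ := ToricNewton.exists_first_edge hN (Nat.pos_of_ne_zero hu) hi
  exact ⟨N, n, m, hN, h1, h2⟩

theorem IsEdge.of_dvd (hbz : IsBezoutChoice bz) {G : Ser (RatFunc K)} (hS : S ≠ 0) (hG : G ∣ S)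
    (hE : IsEdge G n m) : IsEdge S n m := by
  have h := hbz.bezout hE.n_pos hE.m_pos hE.coprime
  have hG0 := ne_zero_of_dvd_ne_zero hS hG
  rw [isEdge_iff h.n_pos h.m_pos h.coprime hG0] at hE
  exact (isEdge_iff h.n_pos h.m_pos h.coprime hS).2
    (hE.trans_le (edgeDegree_le_of_dvd h hS hG))

/-- An irreducible factor with an edge that is not dicritical comes from an irreducible factor of
a strict transform. -/
theorem Special.exists_strictTransform [IsAlgClosed K] {a b : ℕ} (h : Bezout n m a b)
    (hS : Special S c) (hE : IsEdge S n m) (hnd : ¬ IsDicritical S n m) {G : Ser (RatFunc K)}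
    (hG : G ∣ S) (hirr : Irreducible G) (hd : 0 < edgeDegree n m G) :
    ∃ (α : K) (e : ℕ) (H : Ser (RatFunc K)), algebraMap K (RatFunc K) α ≠ 0 ∧
      (edgePoly n m S).IsRoot (algebraMap K (RatFunc K) α) ∧
      IsStrictTransform n m a b (algebraMap K (RatFunc K) α) G H ∧
      HasYOrder G (n * e) ∧ HasYOrder H e ∧ 0 < e ∧ Irreducible H := by
  have hS0 := hS.ne_zero
  have hG0 := ne_zero_of_dvd_ne_zero hS0 hG
  obtain ⟨M, hM⟩ := hS.regular
  obtain ⟨N, -, hN⟩ := hM.of_dvd hG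
  obtain ⟨α, hα⟩ := hS.exists_root h hE hnd hG hd
  have hα0 := root_ne_zero h hG0 hα
  obtain ⟨H, hH⟩ := exists_isStrictTransform h hα0 G
  have hHe := hH.hasYOrder h hα0 hG0
  have he := (Polynomial.rootMultiplicity_pos
    (edgePoly_ne_zero h.n_pos h.m_pos h.coprime hG0)).2 hα
  obtain ⟨rfl, hHirr⟩ := irreducible_strictTransform h hα0 hirr hN hH hHe he
  exact ⟨α, _, H, hα0, hα.dvd (edgePoly_dvd h hS0 hG), hH, hN, hHe, he, hHirr⟩

/-- At the end of the path, take an irreducible factor having the dicritical edge. If its first edge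
were not dicritical, it would be its only edge, a contradiction; so it is the dicritical one. The
factor is then lifted through the steps. -/
theorem exists_attached [IsAlgClosed K] (hbz : IsBezoutChoice bz) (hS : Special S c)
    (hr : Reaches bz path S S') (hd : IsDicritical S' n m) : ∃ Q, Attached bz path S n m Q := by
  induction path generalizing S c with
  | nil =>
    obtain rfl : S' = S := hr
    have h := hbz.bezout hd.1.n_pos hd.1.m_pos hd.1.coprime
    have hS0 := hS.ne_zero
    obtain ⟨M, hM⟩ := hS.regular
    obtain ⟨G, hirr, hG, hdeg⟩ := exists_irreducible_dvd_of_edge h hM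
      ((isEdge_iff h.n_pos h.m_pos h.coprime hS0).1 hd.1)
    have hG0 := ne_zero_of_dvd_ne_zero hS0 hG
    obtain ⟨N, n', m', hN, hE, hw⟩ := hS.exists_first_edge hG hirr.not_isUnit
    have h' := hbz.bezout hE.n_pos hE.m_pos hE.coprime
    have hdeg' := (isEdge_iff h'.n_pos h'.m_pos h'.coprime hG0).1 hE
    have hES := hE.of_dvd hbz hS0 hG
    have hd' : IsDicritical S' n' m' := by
      by_contra hnd
      obtain ⟨α, e, H, hα0, -, hH, hGe, hHe, -, -⟩ :=
        hS.exists_strictTransform h' hES hnd hG hirr hdeg'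
      obtain ⟨rfl, rfl⟩ := edge_unique h' hGe (hH.pow_dvd h' hα0 hG0 hHe).2
        ((isEdge_iff h.n_pos h.m_pos h.coprime hG0).2 hdeg)
      exact hnd hd
    obtain ⟨rfl, rfl⟩ := hS.dicritical_unique hd hd'
    exact ⟨G, hS.attached_of_first_edge h hd hG hN hw hdeg⟩
  | cons s σ ih =>
    obtain ⟨P, a1, a2, a3⟩ := hr
    obtain ⟨c₁, hc⟩ := hS.transform hbz a1 a2
    obtain ⟨Q₁, hQ₁⟩ := ih hc a3
    have hv := a1.valid hbz hS.ne_zero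
    have hN := (Attached.factor hbz hc a3 hQ₁).2.2.2.1
    obtain ⟨Q, R, h1, h2, h3⟩ := hv.exists_lift hN
    exact ⟨Q, P, R, _, a2, h2, h1, hN.associated h3.symm, hQ₁.of_associated hbz hc a3 hd h3.symm⟩

/-- Toric steps lower the order in `y`. -/
theorem strictTransform_hasYOrder_lt {a b : ℕ} (h : Bezout n m a b) {N e : ℕ}
    (hN : HasYOrder S N) (hE : IsEdge S n m) (hT : ¬ ∃ m' A, NeedsTranslation S m' A) {α : K}
    (hα : algebraMap K (RatFunc K) α ≠ 0)
    (hS' : IsStrictTransform n m a b (algebraMap K (RatFunc K) α) S S') (he : HasYOrder S' e) :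
    e < N := by
  obtain ⟨h1, h2⟩ := hS'.pow_dvd h hα hN.ne_zero he
  have h3 := edge_height_le h hN
  have h4 := Nat.le_mul_of_pos_left (edgeDegree n m S) h.n_pos
  refine lt_of_le_of_ne (by omega) ?_
  -- Equality forces `n = 1` and an edge polynomial proportional to `(s - α)^e` with `u = v = 0`:
  -- exactly the case where a translation is due.
  rintro rfl
  have hd := (isEdge_iff h.n_pos h.m_pos h.coprime hN.ne_zero).1 hE
  have h5 : edgeDegree n m S = e := by omega
  have h6 : n = 1 := by
    have h7 : n * edgeDegree n m S ≤ 1 * edgeDegree n m S := by omega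
    have h8 := Nat.le_of_mul_le_mul_right h7 hd
    have := h.n_pos
    omega
  subst h6
  obtain ⟨-, hu, hv⟩ := edge_of_hasYOrder h (e := e) (by rwa [one_mul]) h2
  obtain ⟨q, hq⟩ := h1
  have hE0 := edgePoly_ne_zero h.n_pos h.m_pos h.coprime hN.ne_zero
  have hq0 : q ≠ 0 := by
    rintro rfl
    rw [mul_zero] at hq
    exact hE0 hq
  have hqd : q.natDegree = 0 := by
    have h5' := natDegree_edgePoly h.n_pos h.m_pos h.coprime hN.ne_zero
    rw [hq, Polynomial.natDegree_mul (pow_ne_zero _ (Polynomial.X_sub_C_ne_zero _)) hq0,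
      Polynomial.natDegree_pow, Polynomial.natDegree_X_sub_C, mul_one, h5] at h5'
    omega
  rw [Polynomial.eq_C_of_natDegree_eq_zero hqd] at hq hq0
  rw [mul_comm] at hq
  exact hT ⟨m, α, hE, _, e, Polynomial.C_ne_zero.1 hq0,
    initialForm_eq_binomial h hN.ne_zero hq h5 hu hv⟩

theorem exists_attached_of_not_translation [IsAlgClosed K] (hbz : IsBezoutChoice bz) {N c : ℕ} {S : Ser (RatFunc K)}
    (ihN : ∀ N' < N, ∀ (k c : ℕ) (S : Ser (RatFunc K)), Special S c → HasYOrder S N' →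
      (∀ i, i + k < c → cf S i 0 = 0) → ∀ G, Irreducible G → G ∣ S →
      ∃ path S' n m, Reaches bz path S S' ∧ IsDicritical S' n m ∧ Attached bz path S n m G)
    (hS : Special S c) (hN : HasYOrder S N) (hT : ¬ ∃ m A, NeedsTranslation S m A)
    (G : Ser (RatFunc K)) (hirr : Irreducible G) (hG : G ∣ S) :
    ∃ path S' n m, Reaches bz path S S' ∧ IsDicritical S' n m ∧ Attached bz path S n m G := by
  have hS0 := hS.ne_zero
  have hG0 := ne_zero_of_dvd_ne_zero hS0 hG
  obtain ⟨d, n, m, hGd, hE, hw⟩ := hS.exists_first_edge hG hirr.not_isUnit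
  have h := hbz.bezout hE.n_pos hE.m_pos hE.coprime
  have hdeg := (isEdge_iff h.n_pos h.m_pos h.coprime hG0).1 hE
  have hES := hE.of_dvd hbz hS0 hG
  by_cases hd : IsDicritical S n m
  · exact ⟨[], S, n, m, rfl, hd, hS.attached_of_first_edge h hd hG hGd hw hdeg⟩
  obtain ⟨α, e, H, hα0, hroot, hH, hGe, hHe, -, hHirr⟩ :=
    hS.exists_strictTransform h hES hd hG hirr hdeg
  obtain ⟨S₁, hS₁⟩ := exists_isStrictTransform h hα0 S
  have hs : Allowed S (.toric n m α) := ⟨hT, hES, hd, hroot⟩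
  obtain ⟨c₁, hc⟩ := hS.transform hbz hs hS₁
  obtain ⟨N₁, hN₁⟩ := hc.regular
  -- After a drop of the `y`-order the translation counter is reset: with `k = c₁` the vanishing
  -- condition is vacuous.
  obtain ⟨path, S', n', m', h1, h2, h3⟩ := ihN N₁
    (strictTransform_hasYOrder_lt h hN hES hT hα0 hS₁ hN₁) c₁ c₁ S₁ hc hN₁
    (fun i hi => absurd hi (by omega)) H hHirr (hH.dvd h hα0 hS0 hG hS₁)
  exact ⟨.toric n m α :: path, S', n', m', ⟨S₁, hs, hS₁, h1⟩, h2,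
    ⟨S₁, H, e, hS₁, hH, hGe, hHe, h3⟩⟩

/-- Double induction: toric steps lower `N`, translations keep `N` and `c` but lower `k`, which
bounds the gap between `c` and the order of `S(x, 0)`. -/
theorem exists_attached_of_irreducible [IsAlgClosed K] (hbz : IsBezoutChoice bz) (N : ℕ) :
    ∀ (k c : ℕ) (S : Ser (RatFunc K)), Special S c → HasYOrder S N →
      (∀ i, i + k < c → cf S i 0 = 0) → ∀ G, Irreducible G → G ∣ S →
      ∃ path S' n m, Reaches bz path S S' ∧ IsDicritical S' n m ∧ Attached bz path S n m G := by
  induction N using Nat.strong_induction_on with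
  | _ N ihN =>
  intro k
  induction k with
  | zero =>
    intro c S hS hN h0 G hirr hG
    by_cases hT : ∃ m A, NeedsTranslation S m A
    · obtain ⟨m, A, hT⟩ := hT
      exfalso
      have h := hbz.bezout hT.1.n_pos hT.1.m_pos hT.1.coprime
      obtain ⟨β, e, -, -, -, -, -, -, -, hw, -, hne⟩ := hT.shape h hS.ne_zero
      exact hne (h0 _ (hw ▸ hT.wOrder_lt hbz hS))
    · exact exists_attached_of_not_translation hbz ihN hS hN hT G hirr hG
  | succ k ihk =>
    intro c S hS hN h0 G hirr hG
    by_cases hT : ∃ m A, NeedsTranslation S m A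
    · obtain ⟨m, A, hT⟩ := hT
      have h := hbz.bezout hT.1.n_pos hT.1.m_pos hT.1.coprime
      obtain ⟨β, e, -, -, -, -, -, -, -, hw, -, hne⟩ := hT.shape h hS.ne_zero
      have hle : c ≤ m * e + (k + 1) := by
        by_contra! hlt
        exact hne (h0 _ hlt)
      have hm := hT.1.m_pos
      obtain ⟨d, -, hGd⟩ := hN.of_dvd hG
      -- The coefficient at `(m e, 0)` is nonzero, so `c ≤ m e + k + 1`; the translation kills the
      -- axis coefficients up to degree `m e`, which gains one.
      obtain ⟨path, S', n', m', h1, h2, h3⟩ := ihk c _ (hS.translation hm A)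
        ((hasYOrder_translation_iff hm _).2 hN) (fun i hi =>
          hT.cf_translation_eq_zero hbz hS.ne_zero (by omega))
        (translationEquiv hm (algebraMap K (RatFunc K) A) G)
        ((MulEquiv.irreducible_iff (translationEquiv hm (algebraMap K (RatFunc K) A))).2 hirr)
        (map_dvd _ hG)
      have htr : ∀ B : Ser (RatFunc K), Transform bz (.translation m A) B
          (translationEquiv hm (algebraMap K (RatFunc K) A) B) := fun B =>
        (transform_translation_iff hm).2 rfl
      exact ⟨.translation m A :: path, S', n', m', ⟨_, hT, htr S, h1⟩, h2,
        ⟨_, _, d, htr S, htr G, by change HasYOrder G (1 * d); rwa [one_mul],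
          (hasYOrder_translation_iff hm _).2 hGd, h3⟩⟩
    · exact exists_attached_of_not_translation hbz ihN hS hN hT G hirr hG

end Paths

/-! ### Normalization and the factorization of the pencil. -/

section Main

variable {K : Type*} [Field K] {bz : ℕ → ℕ → ℕ × ℕ} {S : Ser (RatFunc K)} {c : ℕ}

/-- The factor of an attached series, normalized so that its last transform has weighted initial
form equal to `q_ℓ(x ^ m, y ^ n)`. -/
theorem DicriticalEdge.exists_isFactor [IsAlgClosed K] (hbz : IsBezoutChoice bz)
    (hS : Special S c) (l : DicriticalEdge bz S) :
    ∃ Q, Attached bz l.path S l.n l.m Q ∧ l.IsFactor Q := by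
  obtain ⟨Q, hQ⟩ := exists_attached hbz hS l.reached l.dicritical
  obtain ⟨-, -, -, -, Q', hQ', -, -, -, h4, h5⟩ := hQ.factor hbz hS l.reached
  have hE := l.dicritical.1
  have h := hbz.bezout hE.n_pos hE.m_pos hE.coprime
  obtain ⟨hv, c', hc'⟩ := l.reached.valid hbz hS
  have hd : edgeDegree l.n l.m Q' = edgeDegree l.n l.m l.node := by
    rw [← natDegree_edgePoly h.n_pos h.m_pos h.coprime h4.ne_zero,
      ← natDegree_edgePoly h.n_pos h.m_pos h.coprime hc'.ne_zero]
    exact Polynomial.natDegree_eq_of_degree_eq (Polynomial.degree_eq_degree_of_associated h5)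
  obtain ⟨-, hu, hv'⟩ := edge_of_hasYOrder h h4 hd.ge
  -- The initial form is right up to a constant `r`. Scaling commutes with all transforms, so
  -- multiplying `Q` by `r⁻¹` corrects the last one.
  obtain ⟨u, hu'⟩ := h5.symm
  obtain ⟨r, hr, hr'⟩ := Polynomial.isUnit_iff.1 u.isUnit
  have hin := initialForm_eq_smul_edgeForm h h4.ne_zero hu hv' hd (r := r)
    (by rw [hr', mul_comm, hu'])
  have hr0 : r⁻¹ ≠ 0 := inv_ne_zero hr.ne_zero
  have hass : ∀ B : Ser (RatFunc K), Associated B (C r⁻¹ * B) := fun B =>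
    ⟨(isUnit_C hr0).unit, mul_comm _ _⟩
  have hQ₁ := hQ.of_associated hbz hS l.reached l.dicritical (hass Q)
  have htr := Transforms.C_mul hv hr0 hQ'
  obtain ⟨g1, g2, -, -, Q'', g3, g4, g5, -, -, -⟩ := hQ₁.factor hbz hS l.reached
  refine ⟨C r⁻¹ * Q, hQ₁, g1.irreducible, g2, C r⁻¹ * Q', htr, ?_, ?_, ?_⟩
  · exact (Transforms.unique hv g3 htr) ▸ g4.irreducible
  · exact (Transforms.unique hv g3 htr) ▸ g5
  · rw [initialForm_C_mul _ _ hr0, hin, ← mul_assoc, ← map_mul, inv_mul_cancel₀ hr.ne_zero, map_one,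
      one_mul]

theorem DicriticalEdge.ext_of_path (hbz : IsBezoutChoice bz) (hS : Special S c)
    {l l' : DicriticalEdge bz S} (hp : l.path = l'.path) (hn : l.n = l'.n) (hm : l.m = l'.m) :
    l = l' := by
  obtain ⟨path, node, n, m, h1, h2⟩ := l
  obtain ⟨path', node', n', m', h1', h2'⟩ := l'
  simp only at hp hn hm
  subst hp hn hm
  obtain rfl := h1.unique hbz hS h1'
  rfl

theorem prod_dvd_of_prime {ι : Type*} {Q : ι → Ser (RatFunc K)} (hp : ∀ i, Prime (Q i))
    (hinj : ∀ i j, Associated (Q i) (Q j) → i = j) (hd : ∀ i, Q i ∣ S) (s : Finset ι) :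
    ∏ i ∈ s, Q i ∣ S := by
  classical
  induction s using Finset.induction_on with
  | empty => simp
  | insert i s hi ih =>
    rw [Finset.prod_insert hi]
    obtain ⟨B, rfl⟩ := ih
    obtain ⟨D, rfl⟩ := ((hp i).dvd_or_dvd (hd i)).resolve_left fun h0 => by
      obtain ⟨j, hj, h1⟩ := (hp i).exists_mem_finset_dvd h0
      exact hi (hinj i j ((hp i).irreducible.associated_of_dvd (hp j).irreducible h1) ▸ hj)
    exact ⟨D, by ring⟩

theorem exists_hasYOrder_prod {F : Type*} [Field F] {ι : Type*} {Q : ι → Ser F} {d : ι → ℕ}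
    (hQ : ∀ i, HasYOrder (Q i) (d i)) (hd : ∀ i, 0 < d i) (s : Finset ι) :
    ∃ k, s.card ≤ k ∧ HasYOrder (∏ i ∈ s, Q i) k := by
  classical
  induction s using Finset.induction_on with
  | empty => exact ⟨0, le_rfl, by simpa using isUnit_iff_hasYOrder.1 (isUnit_one (M := Ser F))⟩
  | insert i s hi ih =>
    obtain ⟨k, hk, h⟩ := ih
    rw [Finset.prod_insert hi, Finset.card_insert_of_notMem hi]
    have := hd i
    exact ⟨d i + k, by omega, (hQ i).mul h⟩

theorem Special.factorization [IsAlgClosed K] (hbz : IsBezoutChoice bz) (hS : Special S c) :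
    Finite (DicriticalEdge bz S) ∧ ∃ Q : DicriticalEdge bz S → Ser (RatFunc K),
      (∀ l : DicriticalEdge bz S, l.IsFactor (Q l)) ∧
      (∀ l : DicriticalEdge bz S, HasYOrder (Q l) (l.degree * l.vProduct)) ∧
      (∀ G : Ser (RatFunc K), Irreducible G → G ∣ S → ∃! l, Associated G (Q l)) ∧
      Associated S (∏ᶠ l, Q l) := by
  obtain ⟨N, hN⟩ := hS.regular
  choose Q hQ hQf using fun l : DicriticalEdge bz S => l.exists_isFactor hbz hS
  have hfac := fun l : DicriticalEdge bz S => (hQ l).factor hbz hS l.reached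
  have hinj : ∀ l l' : DicriticalEdge bz S, Associated (Q l) (Q l') → l = l' := by
    intro l l' hll
    obtain ⟨h1, h2, h3⟩ := ((hQ l).of_associated hbz hS l.reached l.dicritical hll).path_unique
      hbz hS l.reached l.dicritical l'.reached l'.dicritical (hQ l')
    exact DicriticalEdge.ext_of_path hbz hS h1 h2 h3
  have hord : ∀ l : DicriticalEdge bz S, HasYOrder (Q l) (l.degree * l.vProduct) :=
    fun l => (hfac l).2.2.2.1
  have hprod := prod_dvd_of_prime (fun l => (hfac l).1) hinj (fun l => (hfac l).2.1)
  have hfin : Finite (DicriticalEdge bz S) := by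
    by_contra hinf
    rw [not_finite_iff_infinite] at hinf
    -- The product of `N + 1` of the primes would divide `S` and have `y`-order greater than `N`.
    obtain ⟨s, hs⟩ := Infinite.exists_subset_card_eq (DicriticalEdge bz S) (N + 1)
    obtain ⟨k, hk, hk'⟩ := exists_hasYOrder_prod hord (fun l => Nat.pos_of_ne_zero fun h0 =>
      (hfac l).1.not_isUnit ((hord l).isUnit_iff.2 h0)) s
    obtain ⟨k', h1, h2⟩ := hN.of_dvd (hprod s)
    have := hk'.unique h2
    omega
  have hcov : ∀ G : Ser (RatFunc K), Irreducible G → G ∣ S → ∃ l, Associated G (Q l) := by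
    intro G hirr hG
    obtain ⟨path, S', n, m, h1, h2, h3⟩ := exists_attached_of_irreducible hbz N c c S hS hN
      (fun i hi => absurd hi (by omega)) G hirr hG
    exact ⟨⟨path, S', n, m, h1, h2⟩, h3.unique_factor hbz hS h1 h2 (hQ ⟨path, S', n, m, h1, h2⟩)⟩
  refine ⟨hfin, Q, hQf, hord, fun G hirr hG => ?_, ?_⟩
  · obtain ⟨l, hl⟩ := hcov G hirr hG
    exact ⟨l, hl, fun l' hl' => hinj _ _ (hl'.symm.trans hl)⟩
  · have := Fintype.ofFinite (DicriticalEdge bz S)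
    rw [finprod_eq_prod_of_fintype]
    obtain ⟨B, hB⟩ := hprod Finset.univ
    suffices hu : IsUnit B by
      exact Associated.symm ⟨hu.unit, hB.symm⟩
    by_contra hu
    obtain ⟨k, -, hk⟩ := hN.of_dvd (Dvd.intro_left _ hB.symm)
    obtain ⟨G, hirr, hG⟩ := exists_irreducible_dvd_of_not_isUnit hk hu
    obtain ⟨l, hl⟩ := hcov G hirr (hB ▸ hG.mul_left _)
    -- An irreducible factor of the cofactor `B` is associated to some `Q l`, which already divides
    -- the product; its square would divide `S`.
    refine (hfac l).2.2.1 ?_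
    have h1 := mul_dvd_mul (Finset.dvd_prod_of_mem Q (Finset.mem_univ l)) (hl.symm.dvd.trans hG)
    rwa [← hB] at h1

end Main
end ToricNewton

theorem mainTheorem6 {K : Type*} [Field K] [IsAlgClosed K]
    (p U : MvPowerSeries (Fin 2) K) (c : ℕ)
    (hp : ¬ (MvPowerSeries.X 0 ∣ p)) (hc : 0 < c) (hU : IsUnit U)
    (bz : ℕ → ℕ → ℕ × ℕ) (hbz : ToricNewton.IsBezoutChoice bz) :
    Finite (ToricNewton.DicriticalEdge bz (ToricNewton.pencil p U c)) ∧
    ∃ Q : ToricNewton.DicriticalEdge bz (ToricNewton.pencil p U c) →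
        MvPowerSeries (Fin 2) (RatFunc K),
      (∀ l : ToricNewton.DicriticalEdge bz (ToricNewton.pencil p U c), l.IsFactor (Q l)) ∧
      (∀ l : ToricNewton.DicriticalEdge bz (ToricNewton.pencil p U c),
        ToricNewton.HasYOrder (Q l) (l.degree * l.vProduct)) ∧
      (∀ G : MvPowerSeries (Fin 2) (RatFunc K),
        Irreducible G → G ∣ ToricNewton.pencil p U c → ∃! l, Associated G (Q l)) ∧
      Associated (ToricNewton.pencil p U c) (∏ᶠ l, Q l) :=
  (ToricNewton.special_pencil hp hc hU).factorization hbz
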